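/- Let $d\ge 1$ be an integer and, for $t>0$ and $\mathbf x\in\mathbb R^d$, let $K_t(\mathbf x)=(4\pi t)^{-d/2}\exp\{-\|\mathbf x\|_2^2/(4t)\}$. Let $\mathcal C_0=C^{2,1}(\mathbb R^d\times(0,\infty))$ be the space of functions $u(\mathbf x,t)$ that are continuous on $\mathbb R^d\times(0,\infty)$ together with their partial derivatives $\partial u/\partial x_i$, $\partial^2u/\partial x_j\partial x_i$ and $\partial u/\partial t$, with the topology of uniform convergence on compacts of $u$ and of these derivatives, and with its Borel $\sigma$-algebra. For $\alpha>-1$ let $Y^{(\alpha)}_t=\int_0^\infty g_t(r)\,dW_r\big/\big(\int_0^\infty g_t(r)^2dr\big)^{1/2}$, $t\in\mathbb R$, with $g_t(r)=r^{\alpha/2}\exp(-e^{-t}r)$ and $W$ a standard Brownian motion; this is a centered Gaussian process, taken with $C^\infty$ sample paths. Its persistence exponent $b_\alpha$ is the number such that for every choice of $\delta_T\to0$ $$b_\alpha=-\lim_{T\to\infty}\frac1T\log\mathbb P\Big(\sup_{t\in[0,T]}Y^{(\alpha)}_t\le\delta_T\Big).$$ Then, for $\alpha=d/2-1$, the exponent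 $b_\alpha$ exists in $\mathbb R$ (the limit exists, is finite, and does not depend on the choice of $\delta_T\to0$), and there is a $\mathcal C_0$-valued random variable $\phi_d$ on some probability space with the following properties. 1. $\phi_d(\mathbf x,t)$ is a centered Gaussian field with covariance $\mathbb E[\phi_d(\mathbf x_1,t)\phi_d(\mathbf x_2,s)]=K_{s+t}(\mathbf x_1-\mathbf x_2)$ for all $\mathbf x_1,\mathbf x_2\in\mathbb R^d$ and $s,t>0$. 2. Every realization of $\phi_d$ solves the heat equation $\partial\phi_d/\partial t=\Delta\phi_d$ on $\mathbb R^d\times(0,\infty)$ and is $C^\infty$ on $\mathbb R^d\times(0,\infty)$. 3. For every realization, all $0<t_1<t_2$ and all $\mathbf x\in\mathbb R^d$, $\phi_d(\mathbf x,t_2)=\int_{\mathbb R^d}K_{t_2-t_1}(\mathbf x-\mathbf y)\,\phi_d(\mathbf y,t_1)\,d\mathbf y$, the integral being absolutely convergent. 4. For every fixed $\mathbf x\in\mathbb R^d$, $\mathbb P\big(\phi_d(\mathbf x,t)\ne0\ \text{for all }t\in[1,T]\big)=T^{-b_{d/2-1}+o(1)}$ as $T\to\infty$. -/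

import Mathlib

open MeasureTheory ProbabilityTheory Filter Topology Set

noncomputable section

namespace WhiteNoiseHeat

/-- `ℝ^d` with its Euclidean norm. -/
abbrev Space (d : ℕ) : Type := EuclideanSpace ℝ (Fin d)

/-- The open half space `D_0 = ℝ^d × (0, ∞)`. -/
abbrev HalfSpace (d : ℕ) : Type := Space d × Ioi (0 : ℝ)

/-- The heat kernel `K_t(x) = (4πt)^{-d/2} exp(-‖x‖² / (4t))` (used for `t > 0` only). -/
def heatKernel {d : ℕ} (t : ℝ) (x : Space d) : ℝ :=
  (4 * Real.pi * t) ^ (-(d : ℝ) / 2) * Real.exp (-‖x‖ ^ 2 / (4 * t))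

/-- A function on `ℝ^d × (0, ∞)` written as a function of `x` and of a real time `t`. The value `0`
at times `t ≤ 0` is a dummy value and is never used. -/
def timeExtend {d : ℕ} (u : HalfSpace d → ℝ) (x : Space d) (t : ℝ) : ℝ :=
  if h : 0 < t then u (x, ⟨t, h⟩) else 0

/-- The space `C^{2,1}(ℝ^d × (0, ∞))`: a continuous function `u` such that the partial derivatives
`∂u/∂x_i`, `∂²u/∂x_j∂x_i` and `∂u/∂t` exist at every point of `ℝ^d × (0, ∞)` and are continuous there.
The derivatives are recorded as fields; they are determined by the function. -/
structure C21 (d : ℕ) where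
  toFun : C(HalfSpace d, ℝ)
  dx : Fin d → C(HalfSpace d, ℝ)
  dxx : Fin d → Fin d → C(HalfSpace d, ℝ)
  dt : C(HalfSpace d, ℝ)
  hasDeriv_dx : ∀ (i : Fin d) (p : HalfSpace d),
    HasDerivAt (fun h : ℝ => toFun (p.1 + h • EuclideanSpace.single i (1 : ℝ), p.2)) (dx i p) 0
  hasDeriv_dxx : ∀ (i j : Fin d) (p : HalfSpace d),
    HasDerivAt (fun h : ℝ => dx i (p.1 + h • EuclideanSpace.single j (1 : ℝ), p.2)) (dxx i j p) 0
  hasDeriv_dt : ∀ p : HalfSpace d,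
    HasDerivAt (fun s : ℝ => timeExtend toFun p.1 s) (dt p) (p.2 : ℝ)

namespace C21

/-- The value `u(x, t)`, meaningful for `t > 0`. -/
def val {d : ℕ} (u : C21 d) (x : Space d) (t : ℝ) : ℝ := timeExtend u.toFun x t

/-- A function of class `C^{2,1}` together with its relevant partial derivatives. -/
def jet {d : ℕ} (u : C21 d) :
    C(HalfSpace d, ℝ) × (Fin d → C(HalfSpace d, ℝ)) ×
      (Fin d → Fin d → C(HalfSpace d, ℝ)) × C(HalfSpace d, ℝ) :=
  (u.toFun, u.dx, u.dxx, u.dt)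

/-- The topology of uniform convergence on compacts of the function and of its derivatives
`∂u/∂x_i`, `∂²u/∂x_j∂x_i`, `∂u/∂t` (each `C(HalfSpace d, ℝ)` has the compact-open topology). -/
instance (d : ℕ) : TopologicalSpace (C21 d) := TopologicalSpace.induced jet inferInstance

/-- The Borel sigma-algebra of that topology. -/
instance (d : ℕ) : MeasurableSpace (C21 d) := borel (C21 d)

end C21

/-- `φ` is a random element of `C^{2,1}(ℝ^d × (0, ∞))` with its Borel sigma-algebra, and it is a
centered Gaussian field with covariance `Cov(φ(x₁,t), φ(x₂,s)) = K_{s+t}(x₁ - x₂)`. -/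
structure IsHeatField {d : ℕ} {Ω : Type} [MeasurableSpace Ω] (P : Measure Ω) (φ : Ω → C21 d) :
    Prop where
  measurable : Measurable φ
  gaussian : IsGaussianProcess (fun (p : HalfSpace d) (ω : Ω) => (φ ω).val p.1 p.2) P
  centered : ∀ (x : Space d) (t : ℝ), 0 < t → ∫ ω, (φ ω).val x t ∂P = 0
  cov_eq : ∀ (x₁ x₂ : Space d) (t s : ℝ), 0 < t → 0 < s →
    covariance (fun ω => (φ ω).val x₁ t) (fun ω => (φ ω).val x₂ s) P = heatKernel (s + t) (x₁ - x₂)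

/-- The integrand `g_t(r) = r^{α/2} exp(-e^{-t} r)`, `r > 0`. -/
def gFun (α t r : ℝ) : ℝ := r ^ (α / 2) * Real.exp (-Real.exp (-t) * r)

/-- The inner product `∫_0^∞ g_s(r) g_t(r) dr`, which is finite for `α > -1`. -/
def gInner (α s t : ℝ) : ℝ := ∫ r in Ioi (0 : ℝ), gFun α s r * gFun α t r

/-- `Y` is (a smooth version of) the process
`Y_t = ∫_0^∞ g_t(r) dW_r / (∫_0^∞ g_t(r)² dr)^{1/2}`, `t ∈ ℝ`, `W` a Brownian motion, given through
its law: it is a centered Gaussian process with `C^∞` sample paths whose covariance is the one that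
the Itô isometry gives to these Wiener integrals. -/
structure IsYProcess (α : ℝ) {Ω : Type} [MeasurableSpace Ω] (P : Measure Ω) (Y : ℝ → Ω → ℝ) :
    Prop where
  measurable : ∀ t, Measurable (Y t)
  smooth : ∀ ω, ContDiff ℝ (⊤ : ℕ∞) (fun t => Y t ω)
  gaussian : IsGaussianProcess Y P
  centered : ∀ t, ∫ ω, Y t ω ∂P = 0
  cov_eq : ∀ s t, covariance (Y s) (Y t) P =
    gInner α s t / (Real.sqrt (gInner α s s) * Real.sqrt (gInner α t t))

/-- `b = b_α`, the persistence exponent of `Y^{(α)}`: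
`b = - lim_{T → ∞} T⁻¹ log P(sup_{t ∈ [0,T]} Y_t ≤ δ_T)` whatever the choice of `δ_T → 0`. The limit is
required to exist, with probabilities that are positive for large `T`. All realizations of `Y^{(α)}`
have the same law, so it does not matter which one is taken. -/
def IsPersistenceExponent (α b : ℝ) : Prop :=
  ∃ (Ω : Type) (_ : MeasurableSpace Ω) (P : Measure Ω) (Y : ℝ → Ω → ℝ),
    IsProbabilityMeasure P ∧ IsYProcess α P Y ∧
    ∀ δ : ℝ → ℝ, Tendsto δ atTop (𝓝 0) →
      (∀ᶠ T in atTop, 0 < P.real {ω | ∀ t ∈ Icc (0 : ℝ) T, Y t ω ≤ δ T}) ∧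
      Tendsto (fun T : ℝ => -(Real.log (P.real {ω | ∀ t ∈ Icc (0 : ℝ) T, Y t ω ≤ δ T}) / T))
        atTop (𝓝 b)

end WhiteNoiseHeat

end

open WhiteNoiseHeat

/-! The field is the heat flow of white noise: φ(x,t) = W(K_t(x - ·)), with W an isonormal process
on L²(ℝ^d). Its covariance is the Chapman–Kolmogorov identity. White noise is not a function, so the
flow is restarted at small positive times 1/(m+1). There the flow, divided by a polynomial weight,
is an L²-valued Gaussian series, because the map from initial data to weighted slice is
Hilbert–Schmidt (`summable_norm_sq_sliceLp`, `exists_gaussianSeries`). Multiplied back by the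
weight, a slice is integrable against every centered Gaussian density. Its heat flow is smooth,
solves the heat equation and has the semigroup property, for every realization. The flows from
different starting times agree almost surely at countably many points, hence everywhere by
continuity; on the remaining null event the field is set to 0 (`exists_heatField_version`).

At a fixed point x, in logarithmic time and normalized, the field is stationary Gaussian with
covariance cosh((s-t)/2)^(-a), a = d/2. This is also the covariance of Y^(d/2-1) (`gInner_div_eq`,
`isSechProcess_logProcess`), so property 4 concerns zero-free intervals of one process.

Existence of the exponent at level 0 is Fekete's lemma for -log P(sup ≤ 0). The
supermultiplicativity comes from expanding the covariance as cosh(s/2)^(-a) cosh(t/2)^(-a) (1 -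
tanh(s/2) tanh(t/2))^(-a). For times ≤ 0 this exhibits the process as a limit of nonnegative
combinations of independent Gaussians, to which Harris' inequality applies
(`IsSechProcess.persist_mul_le`).

Levels tending to 0 do not matter, by a Cameron–Martin argument: raising the level by η on [0,L] is
paid for by a shift whose energy is O(η²L) (`IsSechProcess.persist_add_le`). Having no zero lies
between staying below -1/T and, by symmetry, twice the probability of staying below 0
(`IsSechProcess.tendsto_nonzero`). -/

open scoped NNReal ENNReal

noncomputable section
namespace WhiteNoiseHeat

/-! ### Laws and orthant probabilities of centered Gaussian vectors -/

section GaussianVectors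

variable {ι : Type*} [Fintype ι] {Ω Ω' : Type*} [MeasurableSpace Ω] [MeasurableSpace Ω']
  {P : Measure Ω} {P' : Measure Ω'}

/-- The characteristic function of a centered Gaussian vector in terms of its covariances. -/
lemma charFun_toLp_of_centered {X : ι → Ω → ℝ} (hX : HasGaussianLaw (fun ω i ↦ X i ω) P)
    (h0 : ∀ i, ∫ ω, X i ω ∂P = 0) (t : EuclideanSpace ℝ ι) :
    charFun (P.map fun ω ↦ WithLp.toLp 2 fun i ↦ X i ω) t =
      Complex.exp (((-(∑ i, ∑ j, t i * t j * cov[X i, X j; P]) / 2 : ℝ)) : ℂ) := by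
  have := hX.isProbabilityMeasure
  have hXi (i : ι) : HasGaussianLaw (X i) P := hX.map_fun (.proj i)
  have h2 : HasGaussianLaw (fun ω ↦ WithLp.toLp 2 fun i ↦ X i ω) P :=
    hX.map_equiv_fun (PiLp.continuousLinearEquiv 2 ℝ (fun _ : ι ↦ ℝ)).symm
  rw [h2.charFun_map_eq]
  have hin (ω : Ω) : inner ℝ t (WithLp.toLp 2 fun i ↦ X i ω) = ∑ i, t i * X i ω := by
    simp [PiLp.inner_apply, mul_comm]
  simp_rw [hin]
  have hm : ∫ ω, ∑ i, t i * X i ω ∂P = 0 := by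
    rw [integral_finsetSum _ fun i _ ↦ (hXi i).integrable.const_mul _]
    simp [integral_const_mul, h0]
  have hv : Var[fun ω ↦ ∑ i, t i * X i ω; P] = ∑ i, ∑ j, t i * t j * cov[X i, X j; P] := by
    rw [variance_fun_sum fun i ↦ (hXi i).memLp_two.const_mul _]
    simp_rw [covariance_const_mul_left, covariance_const_mul_right, mul_assoc]
  rw [hm, hv]
  congr 1
  push_cast
  ring

lemma map_toLp_eq_of_centered {X : ι → Ω → ℝ} {X' : ι → Ω' → ℝ}
    (hX : HasGaussianLaw (fun ω i ↦ X i ω) P) (hX' : HasGaussianLaw (fun ω i ↦ X' i ω) P')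
    (h0 : ∀ i, ∫ ω, X i ω ∂P = 0) (h0' : ∀ i, ∫ ω, X' i ω ∂P' = 0)
    (hc : ∀ i j, cov[X i, X j; P] = cov[X' i, X' j; P']) :
    (P.map fun ω ↦ WithLp.toLp 2 fun i ↦ X i ω) = P'.map fun ω ↦ WithLp.toLp 2 fun i ↦ X' i ω := by
  have := hX.isProbabilityMeasure
  have := hX'.isProbabilityMeasure
  refine Measure.ext_of_charFun ?_
  ext t
  rw [charFun_toLp_of_centered hX h0, charFun_toLp_of_centered hX' h0']
  simp_rw [hc]

/-- Centered Gaussian vectors with the same covariances have the same law. -/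
lemma measureReal_eq_of_centered {X : ι → Ω → ℝ} {X' : ι → Ω' → ℝ}
    (hX : HasGaussianLaw (fun ω i ↦ X i ω) P) (hX' : HasGaussianLaw (fun ω i ↦ X' i ω) P')
    (h0 : ∀ i, ∫ ω, X i ω ∂P = 0) (h0' : ∀ i, ∫ ω, X' i ω ∂P' = 0)
    (hc : ∀ i j, cov[X i, X j; P] = cov[X' i, X' j; P']) {s : Set (ι → ℝ)}
    (hs : MeasurableSet s) :
    P.real {ω | (fun i ↦ X i ω) ∈ s} = P'.real {ω | (fun i ↦ X' i ω) ∈ s} := by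
  have h := map_toLp_eq_of_centered hX hX' h0 h0' hc
  have hs' : MeasurableSet ((WithLp.ofLp : EuclideanSpace ℝ ι → ι → ℝ) ⁻¹' s) :=
    (WithLp.measurable_ofLp 2 _) hs
  have h1 := congrArg (fun μ ↦ μ ((WithLp.ofLp : EuclideanSpace ℝ ι → ι → ℝ) ⁻¹' s)) h
  have m1 : AEMeasurable (fun ω ↦ WithLp.toLp 2 fun i ↦ X i ω) P :=
    (WithLp.measurable_toLp 2 _).comp_aemeasurable hX.aemeasurable
  have m2 : AEMeasurable (fun ω ↦ WithLp.toLp 2 fun i ↦ X' i ω) P' :=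
    (WithLp.measurable_toLp 2 _).comp_aemeasurable hX'.aemeasurable
  simp only [Measure.map_apply_of_aemeasurable m1 hs', Measure.map_apply_of_aemeasurable m2 hs']
    at h1
  simpa [Measure.real] using! congrArg ENNReal.toReal h1

/-- Orthant probabilities of centered Gaussian vectors depend continuously on the covariances. -/
lemma tendsto_measureReal_orthant {Ωn : ℕ → Type*} [∀ n, MeasurableSpace (Ωn n)]
    {Pn : ∀ n, Measure (Ωn n)} {Xn : ∀ n, ι → Ωn n → ℝ} {X : ι → Ω → ℝ}
    (hXn : ∀ n, HasGaussianLaw (fun ω i ↦ Xn n i ω) (Pn n))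
    (hX : HasGaussianLaw (fun ω i ↦ X i ω) P)
    (h0n : ∀ n i, ∫ ω, Xn n i ω ∂(Pn n) = 0) (h0 : ∀ i, ∫ ω, X i ω ∂P = 0)
    (hc : ∀ i j, Tendsto (fun n ↦ cov[Xn n i, Xn n j; Pn n]) atTop (𝓝 cov[X i, X j; P]))
    (hv : ∀ i, cov[X i, X i; P] ≠ 0) (δ : ℝ) (J : Set ι) :
    Tendsto (fun n ↦ (Pn n).real {ω | ∀ i ∈ J, Xn n i ω ≤ δ}) atTop
      (𝓝 (P.real {ω | ∀ i ∈ J, X i ω ≤ δ})) := by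
  have := hX.isProbabilityMeasure
  have (n : ℕ) := (hXn n).isProbabilityMeasure
  have m1 (n : ℕ) : AEMeasurable (fun ω ↦ WithLp.toLp 2 fun i ↦ Xn n i ω) (Pn n) :=
    (WithLp.measurable_toLp 2 _).comp_aemeasurable (hXn n).aemeasurable
  have m2 : AEMeasurable (fun ω ↦ WithLp.toLp 2 fun i ↦ X i ω) P :=
    (WithLp.measurable_toLp 2 _).comp_aemeasurable hX.aemeasurable
  let μn (n : ℕ) : ProbabilityMeasure (EuclideanSpace ℝ ι) :=
    ⟨(Pn n).map fun ω ↦ WithLp.toLp 2 fun i ↦ Xn n i ω, Measure.isProbabilityMeasure_map (m1 n)⟩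
  let μ : ProbabilityMeasure (EuclideanSpace ℝ ι) :=
    ⟨P.map fun ω ↦ WithLp.toLp 2 fun i ↦ X i ω, Measure.isProbabilityMeasure_map m2⟩
  have hμ : Tendsto μn atTop (𝓝 μ) := by
    refine ProbabilityMeasure.tendsto_of_tendsto_charFun fun t ↦ ?_
    simp only [μn, μ, ProbabilityMeasure.coe_mk, charFun_toLp_of_centered (hXn _) (h0n _),
      charFun_toLp_of_centered hX h0]
    refine (Complex.continuous_exp.tendsto _).comp ((Complex.continuous_ofReal.tendsto _).comp ?_)
    refine Tendsto.div_const (Tendsto.neg ?_) 2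
    exact tendsto_finsetSum _ fun i _ ↦ tendsto_finsetSum _ fun j _ ↦ (hc i j).const_mul _
  let S : Set (EuclideanSpace ℝ ι) := {x | ∀ i ∈ J, x i ≤ δ}
  have hScl : IsClosed S := by
    simp only [S, Set.ofPred_forall]
    exact isClosed_biInter fun i _ ↦ isClosed_le (by fun_prop) continuous_const
  have hSo : IsOpen {x : EuclideanSpace ℝ ι | ∀ i ∈ J, x i < δ} := by
    simp only [Set.ofPred_forall]
    exact (Set.toFinite J).isOpen_biInter fun i _ ↦ isOpen_lt (by fun_prop) continuous_const
  -- Weak convergence gives convergence on sets with null frontier. Here the frontier lies in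
  -- finitely many hyperplanes, each null since every limit marginal is a nondegenerate Gaussian.
  have hfr : frontier S ⊆ ⋃ i, {x | x i = δ} := by
    intro x hx
    rw [hScl.frontier_eq] at hx
    by_contra hcon
    simp only [mem_iUnion, mem_ofPred_eq, not_exists] at hcon
    refine hx.2 (mem_interior.2 ⟨_, fun y hy i hi ↦ (hy i hi).le, hSo, fun i hi ↦ ?_⟩)
    exact lt_of_le_of_ne (hx.1 i hi) (hcon i)
  have hnull : (μ : Measure (EuclideanSpace ℝ ι)) (frontier S) = 0 := by
    refine measure_mono_null hfr (measure_iUnion_null fun i ↦ ?_)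
    have hms : MeasurableSet {x : EuclideanSpace ℝ ι | x i = δ} :=
      (isClosed_eq (by fun_prop) continuous_const).measurableSet
    have hXi : HasGaussianLaw (X i) P := hX.map_fun (.proj i)
    change P.map (fun ω ↦ WithLp.toLp 2 fun i ↦ X i ω) _ = 0
    rw [Measure.map_apply_of_aemeasurable m2 hms]
    have h3 : P.map (X i) {δ} = 0 := by
      rw [hXi.map_eq_gaussianReal]
      have hne : Var[X i; P].toNNReal ≠ 0 := by
        have h4 : Var[X i; P] ≠ 0 := by
          rw [← covariance_self hXi.aemeasurable]
          exact hv i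
        rw [ne_eq, Real.toNNReal_eq_zero, not_le]
        exact lt_of_le_of_ne (variance_nonneg _ _) h4.symm
      have := nullSingletonClass_gaussianReal (μ := P[X i]) hne
      exact measure_singleton _
    rwa [Measure.map_apply_of_aemeasurable hXi.aemeasurable (measurableSet_singleton _)] at h3
  have hlim := ProbabilityMeasure.tendsto_measure_of_null_frontier_of_tendsto' hμ hnull
  have e1 (n : ℕ) : (Pn n).real {ω | ∀ i ∈ J, Xn n i ω ≤ δ} =
      ((μn n : Measure (EuclideanSpace ℝ ι)) S).toReal := by
    simp only [μn, ProbabilityMeasure.coe_mk]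
    rw [Measure.map_apply_of_aemeasurable (m1 n) hScl.measurableSet]
    rfl
  have e2 : P.real {ω | ∀ i ∈ J, X i ω ≤ δ} = ((μ : Measure (EuclideanSpace ℝ ι)) S).toReal := by
    simp only [μ, ProbabilityMeasure.coe_mk]
    rw [Measure.map_apply_of_aemeasurable m2 hScl.measurableSet]
    rfl
  simp_rw [e1, e2]
  exact (ENNReal.tendsto_toReal (measure_ne_top _ _)).comp hlim

end GaussianVectors

/-! ### Harris' inequality -/

section Harris

/-- Decreasing `[0, 1]`-valued functions are nonnegatively correlated under `μ`. -/
def PosAssociated {α : Type*} [Preorder α] [MeasurableSpace α] (μ : Measure α) : Prop :=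
  ∀ f g : α → ℝ, Measurable f → Measurable g → Antitone f → Antitone g →
    (∀ x, f x ∈ Icc (0 : ℝ) 1) → (∀ x, g x ∈ Icc (0 : ℝ) 1) →
    (∫ x, f x ∂μ) * ∫ x, g x ∂μ ≤ ∫ x, f x * g x ∂μ

lemma integrable_of_mem_unit {α : Type*} [MeasurableSpace α] {μ : Measure α} [IsFiniteMeasure μ]
    {f : α → ℝ} (hf : Measurable f) (h : ∀ x, f x ∈ Icc (0 : ℝ) 1) : Integrable f μ :=
  Integrable.of_bound hf.aestronglyMeasurable 1 (.of_forall fun x ↦ by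
    rw [Real.norm_of_nonneg (h x).1]; exact (h x).2)

lemma mul_mem_unit {a b : ℝ} (ha : a ∈ Icc (0 : ℝ) 1) (hb : b ∈ Icc (0 : ℝ) 1) :
    a * b ∈ Icc (0 : ℝ) 1 :=
  ⟨mul_nonneg ha.1 hb.1, mul_le_one₀ ha.2 hb.1 hb.2⟩

lemma integral_mem_unit {α : Type*} [MeasurableSpace α] {μ : Measure α} [IsProbabilityMeasure μ]
    {f : α → ℝ} (hf : Measurable f) (h : ∀ x, f x ∈ Icc (0 : ℝ) 1) :
    ∫ x, f x ∂μ ∈ Icc (0 : ℝ) 1 :=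
  ⟨integral_nonneg fun x ↦ (h x).1, by
    simpa using integral_mono (integrable_of_mem_unit (μ := μ) hf h) (integrable_const (1 : ℝ))
      fun x ↦ (h x).2⟩

/-- Chebyshev's integral inequality. -/
lemma posAssociated_of_linearOrder {α : Type*} [LinearOrder α] [MeasurableSpace α]
    (μ : Measure α) [IsProbabilityMeasure μ] : PosAssociated μ := by
  intro f g hf hg af ag bf bg
  have If := integrable_of_mem_unit (μ := μ) hf bf
  have Ig := integrable_of_mem_unit (μ := μ) hg bg
  have Ifg : Integrable (fun x ↦ f x * g x) μ := integrable_of_mem_unit (hf.mul hg) fun x ↦ mul_mem_unit (bf x) (bg x)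
  -- The two factors always have the same sign on a linear order, and expanding the double integral
  -- gives twice the covariance of f and g.
  have h1 : 0 ≤ ∫ x, ∫ y, (f x - f y) * (g x - g y) ∂μ ∂μ := by
    refine integral_nonneg fun x ↦ integral_nonneg fun y ↦ ?_
    rcases le_total x y with h | h
    · exact mul_nonneg (sub_nonneg.2 (af h)) (sub_nonneg.2 (ag h))
    · exact mul_nonneg_of_nonpos_of_nonpos (sub_nonpos.2 (af h)) (sub_nonpos.2 (ag h))
  have h2 (x : α) : ∫ y, (f x - f y) * (g x - g y) ∂μ =
      f x * g x - f x * (∫ y, g y ∂μ) - g x * (∫ y, f y ∂μ) + ∫ y, f y * g y ∂μ := by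
    have e : (fun y ↦ (f x - f y) * (g x - g y)) =
        fun y ↦ f x * g x - f x * g y - g x * f y + f y * g y := by ext y; ring
    rw [e, integral_add (by fun_prop) Ifg, integral_sub (by fun_prop) (by fun_prop),
      integral_sub (by fun_prop) (by fun_prop), integral_const_mul, integral_const_mul]
    simp [integral_const_mul]
  simp_rw [h2] at h1
  rw [integral_add (by exact (Ifg.sub (If.mul_const _)).sub (Ig.mul_const _)) (by fun_prop),
    integral_sub (by exact Ifg.sub (If.mul_const _)) (by fun_prop),
    integral_sub Ifg (by fun_prop), integral_mul_const, integral_mul_const] at h1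
  simp only [integral_const, probReal_univ, one_smul] at h1
  nlinarith

/-- Association of ν handles each section. The section integrals are again decreasing with values in
[0,1], so association of μ applies to them. -/
lemma PosAssociated.prod {α β : Type*} [Preorder α] [Preorder β] [MeasurableSpace α]
    [MeasurableSpace β] {μ : Measure α} {ν : Measure β} [IsProbabilityMeasure μ]
    [IsProbabilityMeasure ν] (hμ : PosAssociated μ) (hν : PosAssociated ν) :
    PosAssociated (μ.prod ν) := by
  intro f g hf hg af ag bf bg
  have If := integrable_of_mem_unit (μ := μ.prod ν) hf bf
  have Ig := integrable_of_mem_unit (μ := μ.prod ν) hg bg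
  have bfg : ∀ x, f x * g x ∈ Icc (0 : ℝ) 1 := fun x ↦ mul_mem_unit (bf x) (bg x)
  have Ifg : Integrable (fun x ↦ f x * g x) (μ.prod ν) :=
    integrable_of_mem_unit (hf.mul hg) bfg
  have sec {h : α × β → ℝ} (mh : Measurable h) (x : α) : Measurable fun y ↦ h (x, y) :=
    mh.comp measurable_prodMk_left
  have mint {h : α × β → ℝ} (mh : Measurable h) : Measurable fun x ↦ ∫ y, h (x, y) ∂ν :=
    mh.stronglyMeasurable.integral_prod_right'.measurable
  have anti {h : α × β → ℝ} (mh : Measurable h) (ah : Antitone h)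
      (bh : ∀ x, h x ∈ Icc (0 : ℝ) 1) : Antitone fun x ↦ ∫ y, h (x, y) ∂ν := fun x x' hx ↦
    integral_mono (integrable_of_mem_unit (sec mh x') fun y ↦ bh _)
      (integrable_of_mem_unit (sec mh x) fun y ↦ bh _) fun y ↦ ah ⟨hx, le_rfl⟩
  rw [integral_prod _ If, integral_prod _ Ig, integral_prod _ Ifg]
  have bint {h : α × β → ℝ} (mh : Measurable h) (bh : ∀ x, h x ∈ Icc (0 : ℝ) 1) (x : α) :
      ∫ y, h (x, y) ∂ν ∈ Icc (0 : ℝ) 1 := integral_mem_unit (sec mh x) fun y ↦ bh _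
  refine (hμ _ _ (mint hf) (mint hg) (anti hf af bf) (anti hg ag bg) (bint hf bf)
    (bint hg bg)).trans (integral_mono ?_ Ifg.integral_prod_left fun x ↦ ?_)
  · exact integrable_of_mem_unit ((mint hf).mul (mint hg)) fun x ↦
      mul_mem_unit (bint hf bf x) (bint hg bg x)
  · exact hν _ _ (sec hf x) (sec hg x) (fun y y' h ↦ af ⟨le_rfl, h⟩)
      (fun y y' h ↦ ag ⟨le_rfl, h⟩) (fun y ↦ bf _) fun y ↦ bg _

lemma PosAssociated.of_measurePreserving {α β : Type*} [Preorder α] [Preorder β]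
    [MeasurableSpace α] [MeasurableSpace β] {μ : Measure α} {ν : Measure β} {φ : β → α}
    (hν : PosAssociated ν) (hφ : MeasurePreserving φ ν μ) (hm : Monotone φ) :
    PosAssociated μ := by
  intro f g hf hg af ag bf bg
  rw [← hφ.map_eq, integral_map hφ.aemeasurable hf.aestronglyMeasurable,
    integral_map hφ.aemeasurable hg.aestronglyMeasurable,
    integral_map (f := fun x ↦ f x * g x) hφ.aemeasurable (hf.mul hg).aestronglyMeasurable]
  exact hν _ _ (hf.comp hφ.measurable) (hg.comp hφ.measurable) (af.comp_monotone hm)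
    (ag.comp_monotone hm) (fun _ ↦ bf _) fun _ ↦ bg _

/-- **Harris' inequality** for product measures. -/
lemma posAssociated_pi (μ : Measure ℝ) [IsProbabilityMeasure μ] (n : ℕ) :
    PosAssociated (Measure.pi fun _ : Fin n ↦ μ) := by
  induction n with
  | zero =>
    intro f g hf hg af ag bf bg
    have (h : (Fin 0 → ℝ) → ℝ) : ∫ x, h x ∂(Measure.pi fun _ : Fin 0 ↦ μ) = h 0 := by
      have : h = fun _ ↦ h 0 := by ext x; rw [Subsingleton.elim x 0]
      rw [this]; simp
    simp [this]
  | succ n ih =>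
    refine PosAssociated.of_measurePreserving ((posAssociated_of_linearOrder μ).prod ih)
      (measurePreserving_piFinSuccAbove (fun _ : Fin (n + 1) ↦ μ) 0).symm fun x y h i ↦ ?_
    refine Fin.cases ?_ (fun i ↦ ?_) i
    · simpa using! h.1
    · simpa using! h.2 i

end Harris

/-! ### Stationary Gaussian processes with covariance cosh^(-a): supermultiplicative persistence -/

section SechProcess

/-- A centered Gaussian process with continuous paths and covariance `cosh((s - t) / 2) ^ (-a)`. -/
structure IsSechProcess (a : ℝ) {Ω : Type*} [MeasurableSpace Ω] (P : Measure Ω)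
    (Y : ℝ → Ω → ℝ) : Prop where
  measurable : ∀ t, Measurable (Y t)
  continuous : ∀ ω, Continuous fun t ↦ Y t ω
  gaussian : IsGaussianProcess Y P
  centered : ∀ t, ∫ ω, Y t ω ∂P = 0
  cov_eq : ∀ s t, cov[Y s, Y t; P] = Real.cosh ((s - t) / 2) ^ (-a)

/-- The probability that `Y` stays below `δ` on `[c, c + L]`. -/
def persist {Ω : Type*} [MeasurableSpace Ω] (P : Measure Ω) (Y : ℝ → Ω → ℝ) (δ c L : ℝ) : ℝ :=
  P.real {ω | ∀ t ∈ Icc c (c + L), Y t ω ≤ δ}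

/-- Finite subsets of `[c, c + L]` increasing to a dense subset. -/
def grid (c L : ℝ) (n : ℕ) : Finset ℝ :=
  (Finset.range n).image fun k ↦ c + L * (TopologicalSpace.denseSeq (Icc (0 : ℝ) 1) k : ℝ)

lemma grid_subset {c L : ℝ} (hL : 0 ≤ L) (n : ℕ) {t : ℝ} (ht : t ∈ grid c L n) :
    t ∈ Icc c (c + L) := by
  simp only [grid, Finset.mem_image] at ht
  obtain ⟨k, -, rfl⟩ := ht
  have h := (TopologicalSpace.denseSeq (Icc (0 : ℝ) 1) k).2
  constructor
  · nlinarith [h.1]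
  · nlinarith [h.2]

lemma grid_mono (c L : ℝ) : Monotone (grid c L) := fun _ _ h ↦
  Finset.image_subset_image (Finset.range_mono h)

/-- All grids of length L come from one dense sequence in [0,1]. Being translates of each other,
they let stationarity be used grid by grid in `IsSechProcess.persist_eq`. -/
lemma grid_shift (c c' L : ℝ) (n : ℕ) : grid c' L n = (grid c L n).image fun t ↦ t + (c' - c) := by
  simp only [grid, Finset.image_image]
  congr 1
  ext k
  simp only [Function.comp_apply]
  ring

lemma forall_grid_iff {c L δ : ℝ} (hL : 0 ≤ L) {y : ℝ → ℝ} (hy : Continuous y) :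
    (∀ n, ∀ t ∈ grid c L n, y t ≤ δ) ↔ ∀ t ∈ Icc c (c + L), y t ≤ δ := by
  refine ⟨fun h t ht ↦ ?_, fun h n t ht ↦ h t (grid_subset hL n ht)⟩
  have key (u : Icc (0 : ℝ) 1) : y (c + L * u) ≤ δ := by
    refine (TopologicalSpace.denseRange_denseSeq (Icc (0 : ℝ) 1)).induction_on
      (p := fun u : Icc (0 : ℝ) 1 ↦ y (c + L * u) ≤ δ) u
      (isClosed_le (by fun_prop) continuous_const) fun k ↦ ?_
    exact h (k + 1) _ (Finset.mem_image_of_mem _ (Finset.mem_range.2 k.lt_succ_self))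
  rcases hL.eq_or_lt with rfl | hL
  · have : t = c := le_antisymm (by simpa using ht.2) ht.1
    simpa [this] using key ⟨0, by simp⟩
  · have := key ⟨(t - c) / L, div_nonneg (by linarith [ht.1]) hL.le,
      (div_le_one hL).2 (by linarith [ht.2])⟩
    rwa [show c + L * ((t - c) / L) = t by field_simp; ring] at this

variable {Ω Ω' : Type*} [MeasurableSpace Ω] [MeasurableSpace Ω'] {P : Measure Ω} {P' : Measure Ω'}
  {Y : ℝ → Ω → ℝ} {Y' : ℝ → Ω' → ℝ} {a : ℝ}

lemma measurableSet_finset_le (hm : ∀ t, Measurable (Y t)) (J : Finset ℝ) (δ : ℝ) :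
    MeasurableSet {ω | ∀ t ∈ J, Y t ω ≤ δ} := by
  simp only [Set.ofPred_forall]
  exact Finset.measurableSet_biInter _ fun t _ ↦ measurableSet_le (hm t) measurable_const

lemma tendsto_iInter_finset [IsFiniteMeasure P] (hm : ∀ t, Measurable (Y t)) {J : ℕ → Finset ℝ}
    (hJ : Monotone J) (δ : ℝ) :
    Tendsto (fun n ↦ P.real {ω | ∀ t ∈ J n, Y t ω ≤ δ}) atTop
      (𝓝 (P.real {ω | ∀ n, ∀ t ∈ J n, Y t ω ≤ δ})) := by
  have h := tendsto_measure_iInter_atTop (μ := P)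
    (s := fun n ↦ {ω | ∀ t ∈ J n, Y t ω ≤ δ})
    (fun n ↦ (measurableSet_finset_le hm (J n) δ).nullMeasurableSet)
    (fun m n hmn ω hω t ht ↦ hω t (hJ hmn ht)) ⟨0, measure_ne_top _ _⟩
  rw [← Set.ofPred_forall] at h
  exact (ENNReal.tendsto_toReal (measure_ne_top _ _)).comp h

lemma tendsto_persist [IsFiniteMeasure P] (hm : ∀ t, Measurable (Y t))
    (hc : ∀ ω, Continuous fun t ↦ Y t ω) (δ c : ℝ) {L : ℝ} (hL : 0 ≤ L) :
    Tendsto (fun n ↦ P.real {ω | ∀ t ∈ grid c L n, Y t ω ≤ δ}) atTop (𝓝 (persist P Y δ c L)) := by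
  have := tendsto_iInter_finset (P := P) hm (grid_mono c L) δ
  simpa only [forall_grid_iff hL (hc _)] using! this

lemma IsSechProcess.hasGaussianLaw (hY : IsSechProcess a P Y) {ι : Type*} [Finite ι] (τ : ι → ℝ) :
    HasGaussianLaw (fun ω i ↦ Y (τ i) ω) P := by
  classical
  have := Fintype.ofFinite ι
  have h := (hY.gaussian.comp_right τ).hasGaussianLaw Finset.univ
  let Lm : (((Finset.univ : Finset ι) : Type _) → ℝ) →L[ℝ] ι → ℝ :=
    ContinuousLinearMap.pi fun i ↦ .proj (⟨i, Finset.mem_univ i⟩ : (Finset.univ : Finset ι))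
  exact h.map_fun Lm

/-- Persistence probabilities only depend on the parameter `a` and on the length of the interval. -/
lemma IsSechProcess.persist_eq (hY : IsSechProcess a P Y) (hY' : IsSechProcess a P' Y')
    (δ c c' : ℝ) {L : ℝ} (hL : 0 ≤ L) : persist P Y δ c L = persist P' Y' δ c' L := by
  have := hY.gaussian.isProbabilityMeasure
  have := hY'.gaussian.isProbabilityMeasure
  refine tendsto_nhds_unique (tendsto_persist hY.measurable hY.continuous δ c hL) ?_
  convert! tendsto_persist (P := P') hY'.measurable hY'.continuous δ c' hL using 2 with n
  have h := measureReal_eq_of_centered (hY.hasGaussianLaw fun i : grid c L n ↦ (i : ℝ))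
    (hY'.hasGaussianLaw fun i : grid c L n ↦ (i : ℝ) + (c' - c)) (fun _ ↦ hY.centered _)
    (fun _ ↦ hY'.centered _) (fun i j ↦ by rw [hY.cov_eq, hY'.cov_eq]; congr 3; ring)
    (s := {x | ∀ i, x i ≤ δ}) (by
      simp only [Set.ofPred_forall]
      exact MeasurableSet.iInter fun i ↦ measurableSet_le (measurable_pi_apply i) measurable_const)
  simp only [grid_shift c c' L n, Finset.forall_mem_image]
  simpa using! h

/-- `P(X ≤ 0)` on a union is at least the product, for positive combinations of iid variables. -/
lemma posAssociated_orthant {μ : Measure ℝ} [IsProbabilityMeasure μ] {N : ℕ} {ι : Type*} [Finite ι]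
    (w : ι → Fin N → ℝ) (hw : ∀ i k, 0 ≤ w i k) (δ : ℝ) (I J : Set ι) :
    (Measure.pi fun _ : Fin N ↦ μ).real {x | ∀ i ∈ I, ∑ k, w i k * x k ≤ δ} *
      (Measure.pi fun _ : Fin N ↦ μ).real {x | ∀ i ∈ J, ∑ k, w i k * x k ≤ δ} ≤
      (Measure.pi fun _ : Fin N ↦ μ).real {x | ∀ i ∈ I ∪ J, ∑ k, w i k * x k ≤ δ} := by
  have ms (I : Set ι) : MeasurableSet {x : Fin N → ℝ | ∀ i ∈ I, ∑ k, w i k * x k ≤ δ} := by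
    simp only [Set.ofPred_forall]
    exact MeasurableSet.biInter (Set.to_countable I) fun i _ ↦
      measurableSet_le (by fun_prop) measurable_const
  -- Nonnegative weights make the events decreasing in x, so Harris' inequality applies to their
  -- indicators.
  have an (I : Set ι) : Antitone
      ({x : Fin N → ℝ | ∀ i ∈ I, ∑ k, w i k * x k ≤ δ}.indicator (1 : (Fin N → ℝ) → ℝ)) := by
    intro x y hxy
    by_cases hy : y ∈ {x : Fin N → ℝ | ∀ i ∈ I, ∑ k, w i k * x k ≤ δ}
    · have hx : x ∈ {x : Fin N → ℝ | ∀ i ∈ I, ∑ k, w i k * x k ≤ δ} := fun i hi ↦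
        (Finset.sum_le_sum fun k _ ↦ mul_le_mul_of_nonneg_left (hxy k) (hw i k)).trans (hy i hi)
      rw [indicator_of_mem hx, indicator_of_mem hy]
      exact le_rfl
    · rw [indicator_of_notMem hy]
      exact indicator_nonneg (fun _ _ ↦ zero_le_one) _
  have bd (I : Set ι) (x : Fin N → ℝ) :
      ({x : Fin N → ℝ | ∀ i ∈ I, ∑ k, w i k * x k ≤ δ}.indicator (1 : (Fin N → ℝ) → ℝ)) x ∈
        Icc (0 : ℝ) 1 :=
    ⟨indicator_nonneg (fun _ _ ↦ zero_le_one) _, indicator_le_self' (fun _ _ ↦ zero_le_one) _⟩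
  have := posAssociated_pi μ N _ _ (measurable_one.indicator (ms I))
    (measurable_one.indicator (ms J)) (an I) (an J) (bd I) (bd J)
  rw [integral_indicator_one (ms I), integral_indicator_one (ms J)] at this
  refine this.trans_eq ?_
  rw [← integral_indicator_one (ms (I ∪ J))]
  congr 1 with x
  rw [← Pi.mul_apply, ← inter_indicator_one]
  congr 2 with x
  simp only [mem_inter_iff, mem_ofPred_eq, mem_union]
  grind

lemma cosh_sub_eq (s t : ℝ) :
    Real.cosh (s - t) = Real.cosh s * Real.cosh t * (1 - Real.tanh s * Real.tanh t) := by
  rw [Real.tanh_eq_sinh_div_cosh, Real.tanh_eq_sinh_div_cosh, Real.cosh_sub]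
  have := (Real.cosh_pos s).ne'
  have := (Real.cosh_pos t).ne'
  field_simp

/-- The coefficients of `(1 - x) ^ (-a)`. -/
def binomCoeff (a : ℝ) (n : ℕ) : ℝ := Ring.choose (a + n - 1) n

/-- The coefficient is the rising factorial a(a+1)⋯(a+n-1) divided by n!. Its nonnegativity allows
the square roots in `truncCoeff`. -/
lemma binomCoeff_nonneg {a : ℝ} (ha : 0 < a) (n : ℕ) : 0 ≤ binomCoeff a n := by
  have h := Ring.factorial_nsmul_multichoose_eq_ascPochhammer a n
  have h1 : binomCoeff a n = Ring.multichoose a n := by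
    rw [binomCoeff, Ring.choose]
    congr 1
    ring
  rw [h1]
  rw [Polynomial.ascPochhammer_smeval_eq_eval, nsmul_eq_mul] at h
  have h2 := ascPochhammer_pos n a ha
  rw [← h] at h2
  exact (pos_of_mul_pos_right h2 (Nat.cast_nonneg _)).le

lemma hasSum_binomCoeff (a : ℝ) {x : ℝ} (hx : |x| < 1) :
    HasSum (fun n ↦ binomCoeff a n * x ^ n) ((1 - x) ^ (-a)) := by
  have h := (Real.one_div_one_sub_rpow_hasFPowerSeriesOnBall_zero a).hasSum (y := x)
    (by simpa [enorm_eq_nnnorm, ← NNReal.coe_lt_coe] using hx)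
  rw [Real.rpow_neg (by linarith [(abs_lt.1 hx).2])]
  simpa [binomCoeff, mul_comm] using h

/-- The truncated expansion of the covariance. -/
def truncCoeff (a τ : ℝ) (k : ℕ) : ℝ :=
  Real.cosh (τ / 2) ^ (-a) * (√(binomCoeff a k) * (-Real.tanh (τ / 2)) ^ k)

/-- The binomial series at x = tanh(s/2) tanh(t/2), of modulus below 1. The minus signs in
`truncCoeff` cancel in the product; they are there to make the coefficients nonnegative at times ≤
0. -/
lemma hasSum_truncCoeff {a : ℝ} (ha : 0 < a) (s t : ℝ) :
    HasSum (fun k ↦ truncCoeff a s k * truncCoeff a t k) (Real.cosh ((s - t) / 2) ^ (-a)) := by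
  have hs := Real.tanh_lt_one (s / 2)
  have hs' := Real.neg_one_lt_tanh (s / 2)
  have ht := Real.tanh_lt_one (t / 2)
  have ht' := Real.neg_one_lt_tanh (t / 2)
  have hx : |Real.tanh (s / 2) * Real.tanh (t / 2)| < 1 := by
    rw [abs_mul]
    exact mul_lt_one_of_nonneg_of_lt_one_left (abs_nonneg _) (abs_lt.2 ⟨hs', hs⟩)
      (abs_lt.2 ⟨ht', ht⟩).le
  have h := (hasSum_binomCoeff a hx).mul_left (Real.cosh (s / 2) ^ (-a) * Real.cosh (t / 2) ^ (-a))
  rw [← Real.mul_rpow (Real.cosh_pos _).le (Real.cosh_pos _).le, ← Real.mul_rpow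
    (mul_pos (Real.cosh_pos _) (Real.cosh_pos _)).le (by linarith [(abs_lt.1 hx).2]),
    ← cosh_sub_eq, ← sub_div] at h
  refine h.congr_fun fun k ↦ ?_
  have h2 := Real.mul_self_sqrt (binomCoeff_nonneg ha k)
  rw [Real.mul_rpow (Real.cosh_pos _).le (Real.cosh_pos _).le, truncCoeff, truncCoeff,
    ← neg_mul_neg (Real.tanh (s / 2)), mul_pow]
  linear_combination (-(Real.cosh (s / 2) ^ (-a) * Real.cosh (t / 2) ^ (-a) *
    (-Real.tanh (s / 2)) ^ k * (-Real.tanh (t / 2)) ^ k)) * -h2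

lemma truncCoeff_nonneg {a τ : ℝ} (hτ : τ ≤ 0) (k : ℕ) : 0 ≤ truncCoeff a τ k := by
  refine mul_nonneg (Real.rpow_nonneg (Real.cosh_pos _).le _) (mul_nonneg (Real.sqrt_nonneg _)
    (pow_nonneg ?_ _))
  rw [Real.tanh_eq_sinh_div_cosh, ← neg_div]
  exact div_nonneg (neg_nonneg.2 (Real.sinh_nonpos_iff.2 (by linarith))) (Real.cosh_pos _).le

lemma hasGaussianLaw_pi_eval (N : ℕ) (k : Fin N) :
    HasGaussianLaw (fun x : Fin N → ℝ ↦ x k) (Measure.pi fun _ : Fin N ↦ gaussianReal 0 1) where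
  isGaussian_map := by
    rw [(measurePreserving_eval (fun _ : Fin N ↦ gaussianReal 0 1) k).map_eq]
    infer_instance

lemma iIndepFun_pi_eval (N : ℕ) :
    iIndepFun (fun (k : Fin N) (x : Fin N → ℝ) ↦ x k)
      (Measure.pi fun _ : Fin N ↦ gaussianReal 0 1) :=
  iIndepFun_pi (X := fun _ ↦ id) fun _ ↦ aemeasurable_id

lemma hasGaussianLaw_pi_sum {N : ℕ} {ι : Type*} [Finite ι] (w : ι → Fin N → ℝ) :
    HasGaussianLaw (fun x i ↦ ∑ k, w i k * x k)
      (Measure.pi fun _ : Fin N ↦ gaussianReal 0 1) := by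
  have := Fintype.ofFinite ι
  have h := (iIndepFun_pi_eval N).hasGaussianLaw (hasGaussianLaw_pi_eval N)
  let A : (Fin N → ℝ) →L[ℝ] ι → ℝ :=
    ContinuousLinearMap.pi fun i ↦ ∑ k, w i k • ContinuousLinearMap.proj k
  convert! h.map_fun A using 3 with x i
  simp [A]

lemma integral_pi_sum {N : ℕ} (w : Fin N → ℝ) :
    ∫ x, ∑ k, w k * x k ∂(Measure.pi fun _ : Fin N ↦ gaussianReal 0 1) = 0 := by
  rw [integral_finsetSum _ fun k _ ↦ (hasGaussianLaw_pi_eval N k).integrable.const_mul _]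
  have h (k : Fin N) : ∫ x, x k ∂(Measure.pi fun _ : Fin N ↦ gaussianReal 0 1) = 0 := by
    have := (measurePreserving_eval (fun _ : Fin N ↦ gaussianReal 0 1) k)
    have h2 := integral_id_gaussianReal (μ := 0) (v := 1)
    rwa [← this.map_eq, integral_map this.aemeasurable (by fun_prop)] at h2
  simp [integral_const_mul, h]

lemma covariance_pi_sum {N : ℕ} (w v : Fin N → ℝ) :
    cov[fun x ↦ ∑ k, w k * x k, fun x ↦ ∑ k, v k * x k;
      Measure.pi fun _ : Fin N ↦ gaussianReal 0 1] = ∑ k, w k * v k := by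
  have h (k l : Fin N) : cov[fun x ↦ x k, fun x ↦ x l;
      Measure.pi fun _ : Fin N ↦ gaussianReal 0 1] = if k = l then 1 else 0 := by
    split_ifs with hkl
    · subst hkl
      have := (measurePreserving_eval (fun _ : Fin N ↦ gaussianReal 0 1) k)
      rw [covariance_self (hasGaussianLaw_pi_eval N k).aemeasurable]
      have h2 := variance_id_gaussianReal (μ := 0) (v := 1)
      rw [← this.map_eq, variance_map aemeasurable_id this.aemeasurable] at h2
      simpa using! h2
    · exact ((iIndepFun_pi_eval N).indepFun hkl).covariance_eq_zero
        (hasGaussianLaw_pi_eval N k).memLp_two (hasGaussianLaw_pi_eval N l).memLp_two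
  rw [covariance_fun_sum_fun_sum (fun k ↦ (hasGaussianLaw_pi_eval N k).memLp_two.const_mul _)
    fun k ↦ (hasGaussianLaw_pi_eval N k).memLp_two.const_mul _]
  simp [covariance_const_mul_left, covariance_const_mul_right, h, mul_comm]

/-- The partial sums Σ_{k<N} `truncCoeff a t k` ξ_k, with ξ_k independent standard Gaussians, have
covariances converging to that of Y. For t ≤ 0 their weights are nonnegative, so the inequality
holds for each N and passes to the limit of orthant probabilities. -/
lemma IsSechProcess.mul_le_union (hY : IsSechProcess a P Y) (ha : 0 < a) {I J : Finset ℝ}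
    (hI : ∀ t ∈ I, t ≤ 0) (hJ : ∀ t ∈ J, t ≤ 0) (δ : ℝ) :
    P.real {ω | ∀ t ∈ I, Y t ω ≤ δ} * P.real {ω | ∀ t ∈ J, Y t ω ≤ δ} ≤
      P.real {ω | ∀ t ∈ I ∪ J, Y t ω ≤ δ} := by
  let ι := (I ∪ J : Finset ℝ)
  have conv (S : Finset ℝ) (hS : S ⊆ I ∪ J) :
      {ω | ∀ t ∈ S, Y t ω ≤ δ} = {ω | ∀ i ∈ {i : ι | (i : ℝ) ∈ S}, Y i ω ≤ δ} := by
    ext ω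
    exact ⟨fun h i hi ↦ h i hi, fun h t ht ↦ h ⟨t, hS ht⟩ ht⟩
  have lim (S : Set ι) := tendsto_measureReal_orthant
    (Xn := fun N (i : ι) (x : Fin N → ℝ) ↦ ∑ k : Fin N, truncCoeff a i k * x k)
    (X := fun i ↦ Y i) (fun N ↦ hasGaussianLaw_pi_sum _) (hY.hasGaussianLaw fun i : ι ↦ (i : ℝ))
    (fun N i ↦ integral_pi_sum _) (fun i ↦ hY.centered i) (fun i j ↦ by
      simp_rw [covariance_pi_sum, hY.cov_eq,
        Fin.sum_univ_eq_sum_range (fun k ↦ truncCoeff a i k * truncCoeff a j k)]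
      exact (hasSum_truncCoeff ha i j).tendsto_sum_nat) (fun i ↦ by simp [hY.cov_eq]) δ S
  rw [conv I Finset.subset_union_left, conv J Finset.subset_union_right, conv (I ∪ J) subset_rfl]
  refine le_of_tendsto_of_tendsto' ((lim _).mul (lim _)) (lim _) fun N ↦ ?_
  refine (posAssociated_orthant (fun (i : ι) (k : Fin N) ↦ truncCoeff a i k) (fun i k ↦
    truncCoeff_nonneg ?_ _) δ _ _).trans_eq ?_
  · rcases Finset.mem_union.1 i.2 with h | h
    exacts [hI _ h, hJ _ h]
  · congr 1
    ext x
    have hm (i : ι) : (i : ℝ) ∈ I ∨ (i : ℝ) ∈ J := Finset.mem_union.1 i.2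
    simp only [mem_union, mem_ofPred_eq, Finset.mem_union, hm]

/-- Stationarity moves the intervals to [-(L+M), -M] and [-M, 0], where all times are ≤ 0 and
`IsSechProcess.mul_le_union` applies to grids. -/
lemma IsSechProcess.persist_mul_le (hY : IsSechProcess a P Y) (ha : 0 < a) (δ c : ℝ) {L M : ℝ}
    (hL : 0 ≤ L) (hM : 0 ≤ M) :
    persist P Y δ c L * persist P Y δ c M ≤ persist P Y δ c (L + M) := by
  have := hY.gaussian.isProbabilityMeasure
  rw [hY.persist_eq hY δ c (-(L + M)) hL, hY.persist_eq hY δ c (-M) hM,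
    hY.persist_eq hY δ c (-(L + M)) (add_nonneg hL hM)]
  have h1 := tendsto_persist (P := P) hY.measurable hY.continuous δ (-(L + M)) hL
  have h2 := tendsto_persist (P := P) hY.measurable hY.continuous δ (-M) hM
  have h3 := tendsto_iInter_finset (P := P) hY.measurable
    (J := fun n ↦ grid (-(L + M)) L n ∪ grid (-M) M n)
    (fun m n h ↦ Finset.union_subset_union (grid_mono _ _ h) (grid_mono _ _ h)) δ
  have e : {ω | ∀ n, ∀ t ∈ grid (-(L + M)) L n ∪ grid (-M) M n, Y t ω ≤ δ} =
      {ω | ∀ t ∈ Icc (-(L + M)) (-(L + M) + (L + M)), Y t ω ≤ δ} := by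
    ext ω
    have e1 := forall_grid_iff (c := -(L + M)) (δ := δ) hL (hY.continuous ω)
    have e2 := forall_grid_iff (c := -M) (δ := δ) hM (hY.continuous ω)
    simp only [mem_ofPred_eq, Finset.mem_union, or_imp, forall_and, e1, e2]
    constructor
    · rintro ⟨h1, h2⟩ t ht
      rcases le_total t (-M) with h | h
      · exact h1 t ⟨ht.1, by linarith⟩
      · exact h2 t ⟨h, by linarith [ht.2]⟩
    · intro h
      exact ⟨fun t ht ↦ h t ⟨ht.1, by linarith [ht.2]⟩, fun t ht ↦
        h t ⟨by linarith [ht.1], by linarith [ht.2]⟩⟩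
  rw [e] at h3
  refine le_of_tendsto_of_tendsto' (h1.mul h2) h3 fun n ↦ hY.mul_le_union ha (fun t ht ↦ ?_)
    (fun t ht ↦ ?_) δ
  · linarith [(grid_subset hL n ht).2]
  · linarith [(grid_subset hM n ht).2]

end SechProcess

/-! ### Cameron–Martin shifts of Gaussian vectors -/

section LevelChange

/-- Comparison of a Gaussian measure with its translate. -/
lemma gaussianReal_translate_le {V : ℝ≥0} (hV : V ≠ 0) (θ m : ℝ) {r : ℝ} (hr : 0 ≤ r) {B : Set ℝ}
    (hB : MeasurableSet B) :
    gaussianReal 0 V ((fun z ↦ z - θ * V) ⁻¹' B) ≤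
      ENNReal.ofReal (Real.exp m) * gaussianReal 0 V B +
        ENNReal.ofReal (Real.exp (-(r * m) + r * (1 + r) * θ ^ 2 * V / 2)) := by
  rw [← Measure.map_apply (by fun_prop) hB, gaussianReal_map_sub_const, zero_sub,
    gaussianReal_apply _ hV, gaussianReal_apply _ hV]
  -- Let ℓ = -θz - θ²V/2 be the log-ratio of the shifted to the centered density. If ℓ ≤ m, the
  -- ratio is at most exp m. If ℓ ≥ m, then ℓ ≤ (1+r)ℓ - rm, and exp((1+r)ℓ) times the centered
  -- density is a constant times the density centered at -(1+r)θV, whose mass is 1.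
  have hpt (z : ℝ) : gaussianPDF (-(θ * V)) V z ≤
      ENNReal.ofReal (Real.exp m) * gaussianPDF 0 V z +
        ENNReal.ofReal (Real.exp (-(r * m) + r * (1 + r) * θ ^ 2 * V / 2)) *
          gaussianPDF (-((1 + r) * θ * V)) V z := by
    have hVp : (0 : ℝ) < V := by positivity
    simp only [gaussianPDF]
    rw [← ENNReal.ofReal_mul (Real.exp_pos _).le, ← ENNReal.ofReal_mul (Real.exp_pos _).le,
      ← ENNReal.ofReal_add (by positivity [gaussianPDFReal_nonneg 0 V z])
        (mul_nonneg (Real.exp_pos _).le (gaussianPDFReal_nonneg _ V z))]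
    refine ENNReal.ofReal_le_ofReal ?_
    simp only [gaussianPDFReal]
    have key : Real.exp (-(z - -(θ * V)) ^ 2 / (2 * V)) ≤
        Real.exp m * Real.exp (-(z - 0) ^ 2 / (2 * V)) +
          Real.exp (-(r * m) + r * (1 + r) * θ ^ 2 * V / 2) *
            Real.exp (-(z - -((1 + r) * θ * V)) ^ 2 / (2 * V)) := by
      rw [← Real.exp_add, ← Real.exp_add]
      have e1 : -(z - -(θ * V)) ^ 2 / (2 * V) =
          -(z - 0) ^ 2 / (2 * V) + (-(θ * z) - θ ^ 2 * V / 2) := by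
        field_simp
        ring
      have e2 : -(r * m) + r * (1 + r) * θ ^ 2 * V / 2 + -(z - -((1 + r) * θ * V)) ^ 2 / (2 * V) =
          -(z - 0) ^ 2 / (2 * V) + ((1 + r) * (-(θ * z) - θ ^ 2 * V / 2) - r * m) := by
        field_simp
        ring
      rw [e1, e2]
      rcases le_total (-(θ * z) - θ ^ 2 * V / 2) m with h | h
      · refine le_add_of_le_of_nonneg (Real.exp_le_exp.2 (by linarith)) (Real.exp_pos _).le
      · refine le_add_of_nonneg_of_le (Real.exp_pos _).le (Real.exp_le_exp.2 ?_)
        nlinarith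
    have hc : 0 ≤ (√(2 * Real.pi * V))⁻¹ := by positivity
    nlinarith [mul_le_mul_of_nonneg_left key hc]
  refine (lintegral_mono hpt).trans ?_
  rw [lintegral_add_left (by fun_prop), lintegral_const_mul _ (by fun_prop),
    lintegral_const_mul _ (by fun_prop)]
  gcongr
  refine mul_le_of_le_one_right' ((setLIntegral_le_lintegral _ _).trans ?_)
  rw [lintegral_gaussianPDF_eq_one _ hV]

variable {Ω : Type*} [MeasurableSpace Ω] {P : Measure Ω} {Y : ℝ → Ω → ℝ} {a : ℝ}

/-- A Gaussian vector shifted in the direction of its covariance with a linear functional. -/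
lemma measure_shift_le {ι κ : Type*} [Fintype ι] [Fintype κ] {X : ι → Ω → ℝ} {Z : κ → Ω → ℝ}
    (hXZ : HasGaussianLaw (fun ω (s : ι ⊕ κ) ↦ Sum.elim X Z s ω) P)
    (hZ0 : ∀ k, ∫ ω, Z k ω ∂P = 0) {V : ℝ≥0} (hV : V ≠ 0)
    (hVar : ∑ k, ∑ l, cov[Z k, Z l; P] = V) (θ m δ : ℝ) {r : ℝ} (hr : 0 ≤ r) :
    P {ω | ∀ i, X i ω - θ * ∑ k, cov[X i, Z k; P] ≤ δ} ≤
      ENNReal.ofReal (Real.exp m) * P {ω | ∀ i, X i ω ≤ δ} +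
        ENNReal.ofReal (Real.exp (-(r * m) + r * (1 + r) * θ ^ 2 * V / 2)) := by
  have := hXZ.isProbabilityMeasure
  have hVp : (V : ℝ) ≠ 0 := by exact_mod_cast hV
  have gX (i : ι) : HasGaussianLaw (X i) P := hXZ.map_fun (.proj (Sum.inl i))
  have gZ (k : κ) : HasGaussianLaw (Z k) P := hXZ.map_fun (.proj (Sum.inr k))
  set h : ι → ℝ := fun i ↦ ∑ k, cov[X i, Z k; P] with hh
  let S : Ω → ℝ := fun ω ↦ ∑ k, Z k ω
  -- Removing the regression on S leaves a vector independent of S. Shifting X by -θh then amounts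
  -- to shifting S alone by -θV, which reduces the claim to dimension one.
  let X' : ι → Ω → ℝ := fun i ω ↦ X i ω - h i / V * S ω
  let A : (ι ⊕ κ → ℝ) →L[ℝ] (ι → ℝ) × (Unit → ℝ) :=
    (ContinuousLinearMap.pi fun i ↦ .proj (Sum.inl i) -
      (h i / V) • ∑ k, .proj (Sum.inr k)).prod
      (ContinuousLinearMap.pi fun _ ↦ ∑ k, .proj (Sum.inr k))
  have gA : HasGaussianLaw (fun ω ↦ (fun i ↦ X' i ω, fun _ : Unit ↦ S ω)) P := by
    convert! hXZ.map_fun A using 2 with ω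
    ext <;> simp [A, X', S]
  have gS : HasGaussianLaw S P := by
    convert! hXZ.map_fun (∑ k, .proj (Sum.inr k)) using 1
    ext ω
    simp [S]
  have cXS (i : ι) : cov[X i, S; P] = h i :=
    covariance_fun_sum_right (fun k ↦ (gZ k).memLp_two) (gX i).memLp_two
  have cSS : cov[S, S; P] = V := by
    rw [← hVar]
    exact covariance_fun_sum_fun_sum (fun k ↦ (gZ k).memLp_two) fun k ↦ (gZ k).memLp_two
  have ind := gA.indepFun_of_covariance_eval (fun i _ ↦ by
    change cov[fun ω ↦ X i ω - h i / V * S ω, S; P] = 0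
    rw [covariance_fun_sub_left (gX i).memLp_two (gS.memLp_two.const_mul _) gS.memLp_two,
      covariance_const_mul_left, cXS, cSS]
    field_simp
    ring)
  have ind' : IndepFun (fun ω i ↦ X' i ω) S P :=
    ind.comp measurable_id (measurable_pi_apply ())
  have mX' : AEMeasurable (fun ω i ↦ X' i ω) P := gA.fst.aemeasurable
  have mS : AEMeasurable S P := gS.aemeasurable
  have lawS : P.map S = gaussianReal 0 V := by
    rw [gS.map_eq_gaussianReal]
    congr 1
    · change ∫ ω, ∑ k, Z k ω ∂P = 0
      rw [integral_finsetSum _ fun k _ ↦ (gZ k).integrable]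
      simp [hZ0]
    · rw [← covariance_self mS, cSS, Real.toNNReal_coe]
  have joint := (indepFun_iff_map_prod_eq_prod_map_map mX' mS).1 ind'
  rw [lawS] at joint
  have : IsProbabilityMeasure (P.map fun ω i ↦ X' i ω) := Measure.isProbabilityMeasure_map mX'
  let D : ℝ → Set ((ι → ℝ) × ℝ) := fun s ↦ {p | ∀ i, p.1 i + h i / V * (p.2 - s) ≤ δ}
  have mD (s : ℝ) : MeasurableSet (D s) := by
    simp only [D, Set.ofPred_forall]
    exact MeasurableSet.iInter fun i ↦ measurableSet_le (by fun_prop) measurable_const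
  have e1 (s : ℝ) : P {ω | ∀ i, X i ω - s / V * h i ≤ δ} =
      ((P.map fun ω i ↦ X' i ω).prod (gaussianReal 0 V)) (D s) := by
    rw [← joint, Measure.map_apply_of_aemeasurable (mX'.prodMk mS) (mD s)]
    congr 1
    ext ω
    refine forall_congr' fun i ↦ ?_
    simp only [X']
    rw [show X i ω - h i / V * S ω + h i / V * (S ω - s) = X i ω - s / V * h i by ring]
  have e2 := e1 (θ * V)
  rw [mul_div_cancel_right₀ _ hVp] at e2
  have e3 := e1 0
  simp only [zero_div, zero_mul, sub_zero] at e3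
  rw [e2, e3, Measure.prod_apply (mD _), Measure.prod_apply (mD _),
    ← lintegral_const_mul _ (measurable_measure_prodMk_left (mD 0))]
  have e4 : ENNReal.ofReal (Real.exp (-(r * m) + r * (1 + r) * θ ^ 2 * V / 2)) =
      ∫⁻ _, ENNReal.ofReal (Real.exp (-(r * m) + r * (1 + r) * θ ^ 2 * V / 2))
        ∂(P.map fun ω i ↦ X' i ω) := by simp
  rw [e4, ← lintegral_add_left ((measurable_measure_prodMk_left (mD 0)).const_mul _)]
  refine lintegral_mono fun y ↦ ?_
  refine le_trans (le_of_eq ?_) (gaussianReal_translate_le hV θ m hr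
    (B := Prod.mk y ⁻¹' D 0) (measurable_prodMk_left (mD 0)))
  congr 1
  ext z
  simp [D]

end LevelChange

/-! ### Cost of changing the level of persistence -/

section LevelChangeSech

lemma cosh_rpow_neg_le {a : ℝ} (ha : 0 < a) (h : ℝ) :
    Real.cosh (h / 2) ^ (-a) ≤ 2 ^ a * Real.exp (-(a / 2)) ^ |h| := by
  have h1 : Real.exp |h / 2| / 2 ≤ Real.cosh (h / 2) := by
    rw [← Real.cosh_abs, Real.cosh_eq]
    have := Real.exp_pos (-|h / 2|)
    linarith
  refine (Real.rpow_le_rpow_of_nonpos (by positivity) h1 (by linarith)).trans_eq ?_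
  rw [Real.div_rpow (Real.exp_pos _).le zero_le_two, Real.rpow_neg zero_le_two, div_inv_eq_mul,
    mul_comm, ← Real.exp_mul, ← Real.exp_mul, abs_div, abs_two]
  congr 2
  ring

/-- The covariances of the process sampled at the integers are uniformly summable. -/
lemma exists_sum_cosh_le {a : ℝ} (ha : 0 < a) : ∃ C : ℝ, 0 < C ∧ ∀ n k : ℕ,
    ∑ j ∈ Finset.range n, Real.cosh (((k : ℝ) - j) / 2) ^ (-a) ≤ C := by
  set f : ℤ → ℝ := fun m ↦ Real.cosh ((m : ℝ) / 2) ^ (-a) with hf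
  have f0 (m : ℤ) : 0 < f m := Real.rpow_pos_of_pos (Real.cosh_pos _) _
  have hg : Summable fun m : ℕ ↦ 2 ^ a * Real.exp (-(a / 2)) ^ m :=
    (summable_geometric_of_lt_one (Real.exp_pos _).le
      (Real.exp_lt_one_iff.2 (by linarith))).mul_left _
  have hs : Summable f := by
    refine summable_int_iff_summable_nat_and_neg.2 ⟨?_, ?_⟩ <;>
    · refine hg.of_nonneg_of_le (fun m ↦ (f0 _).le) fun m ↦ ?_
      have := cosh_rpow_neg_le ha (m : ℝ)
      rw [Nat.abs_cast, Real.rpow_natCast] at this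
      simpa [hf, neg_div, Real.cosh_neg] using this
  refine ⟨∑' m, f m, hs.tsum_pos (fun m ↦ (f0 m).le) 0 (f0 0), fun n k ↦ ?_⟩
  have h1 : ∑ j ∈ Finset.range n, Real.cosh (((k : ℝ) - j) / 2) ^ (-a) =
      ∑ m ∈ (Finset.range n).image fun j : ℕ ↦ (k : ℤ) - j, f m := by
    rw [Finset.sum_image (fun i _ j _ h ↦ by simpa using h)]
    simp [hf]
  rw [h1]
  exact hs.sum_le_tsum _ fun m _ ↦ (f0 m).le

variable {Ω : Type*} [MeasurableSpace Ω] {P : Measure Ω} {Y : ℝ → Ω → ℝ} {a : ℝ}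

/-- The shift is in the direction of the sum of Y over the integers of the interval. Its covariance
with Y_t is at least κ for every t in [0,L], so θ = η/κ lowers the path by η. Summability of the
covariances makes the variance of that sum linear in L. -/
lemma IsSechProcess.persist_add_le (hY : IsSechProcess a P Y) (ha : 0 < a) :
    ∃ C : ℝ, 0 < C ∧ ∀ L η δ r m : ℝ, 0 ≤ L → 0 ≤ η → 0 ≤ r →
      persist P Y (δ + η) 0 L ≤ Real.exp m * persist P Y δ 0 L +
        Real.exp (-(r * m) + r * (1 + r) * η ^ 2 * (C * (L + 2))) := by
  have := hY.gaussian.isProbabilityMeasure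
  obtain ⟨C, hC, hsum⟩ := exists_sum_cosh_le ha
  set κ : ℝ := Real.cosh (1 / 2) ^ (-a) with hκ
  have κ0 : 0 < κ := Real.rpow_pos_of_pos (Real.cosh_pos _) _
  refine ⟨C / (2 * κ ^ 2), by positivity, fun L η δ r m hL hη hr ↦ ?_⟩
  -- With this many sample points, ⌊t⌋ is one of them for every t in [0,L]; its distance to t is at
  -- most 1, hence the value of κ.
  set n := ⌈L⌉₊ + 1 with hn
  set V' : ℝ := ∑ k : Fin n, ∑ l : Fin n, cov[Y k, Y l; P] with hV'
  have V'_le : V' ≤ C * (L + 2) := by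
    have h1 : V' ≤ ∑ k : Fin n, C := by
      refine Finset.sum_le_sum fun k _ ↦ ?_
      simp_rw [hY.cov_eq, Fin.sum_univ_eq_sum_range
        (fun l ↦ Real.cosh (((k : ℕ) - (l : ℝ)) / 2) ^ (-a)) n]
      exact hsum n k
    have h2 : (n : ℝ) ≤ L + 2 := by
      have := Nat.ceil_lt_add_one hL
      push_cast [hn]
      linarith
    simp only [Finset.sum_const, Finset.card_univ, Fintype.card_fin, nsmul_eq_mul] at h1
    nlinarith
  have cpos (s t : ℝ) : 0 < cov[Y s, Y t; P] := by
    rw [hY.cov_eq]; exact Real.rpow_pos_of_pos (Real.cosh_pos _) _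
  have V'_pos : 0 < V' := by
    have : Nonempty (Fin n) := ⟨0⟩
    exact Finset.sum_pos (fun k _ ↦ Finset.sum_pos (fun l _ ↦ cpos _ _) Finset.univ_nonempty)
      Finset.univ_nonempty
  lift V' to ℝ≥0 using V'_pos.le with V hVeq
  have hV0 : V ≠ 0 := by rintro rfl; simp at V'_pos
  have lower {t : ℝ} (ht : t ∈ Icc 0 L) : κ ≤ ∑ k : Fin n, cov[Y t, Y k; P] := by
    have hk : ⌊t⌋₊ < n := by
      have := Nat.floor_le_floor ht.2
      have := Nat.floor_le_ceil L
      omega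
    refine le_trans ?_ (Finset.single_le_sum (f := fun k : Fin n ↦ cov[Y t, Y k; P])
      (fun k _ ↦ (cpos _ _).le) (Finset.mem_univ ⟨⌊t⌋₊, hk⟩))
    simp only [hY.cov_eq]
    have h1 := Nat.floor_le ht.1
    have h2 := Nat.lt_floor_add_one t
    refine Real.rpow_le_rpow_of_nonpos (Real.cosh_pos _) ?_ (by linarith)
    rw [Real.cosh_le_cosh, abs_of_nonneg (by linarith), abs_of_nonneg (by norm_num)]
    linarith
  have step (J : ℕ) : P.real {ω | ∀ t ∈ grid 0 L J, Y t ω ≤ δ + η} ≤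
      Real.exp m * P.real {ω | ∀ t ∈ grid 0 L J, Y t ω ≤ δ} +
        Real.exp (-(r * m) + r * (1 + r) * (η / κ) ^ 2 * V / 2) := by
    have h := measure_shift_le (X := fun i : grid 0 L J ↦ Y i) (Z := fun k : Fin n ↦ Y k)
      (by
        convert! hY.hasGaussianLaw (Sum.elim (fun i : grid 0 L J ↦ (i : ℝ))
          fun k : Fin n ↦ (k : ℝ)) using 3 with ω s
        cases s <;> rfl)
      (fun k ↦ hY.centered _) hV0 hVeq.symm (η / κ) m δ hr
    have sub : {ω | ∀ t ∈ grid 0 L J, Y t ω ≤ δ + η} ⊆ {ω | ∀ i : grid 0 L J,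
        Y i ω - η / κ * ∑ k : Fin n, cov[Y i, Y k; P] ≤ δ} := by
      intro ω hω i
      have h1 := hω i i.2
      have h2 : η ≤ η / κ * ∑ k : Fin n, cov[Y i, Y k; P] := by
        have := mul_le_mul_of_nonneg_left (lower (by simpa using grid_subset hL J i.2))
          (div_nonneg hη κ0.le)
        rwa [div_mul_cancel₀ _ κ0.ne'] at this
      change Y i ω - η / κ * ∑ k : Fin n, cov[Y i, Y k; P] ≤ δ
      linarith
    have h' := (measure_mono sub).trans h
    have h'' := ENNReal.toReal_mono (by finiteness) h'
    rw [ENNReal.toReal_add (by finiteness) (by finiteness), ENNReal.toReal_mul,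
      ENNReal.toReal_ofReal (Real.exp_pos _).le, ENNReal.toReal_ofReal (Real.exp_pos _).le] at h''
    simpa [Measure.real] using! h''
  have lim := le_of_tendsto_of_tendsto' (tendsto_persist (P := P) hY.measurable hY.continuous
    (δ + η) 0 hL) (((tendsto_persist (P := P) hY.measurable hY.continuous δ 0 hL).const_mul
      (Real.exp m)).add_const _) step
  refine lim.trans ?_
  gcongr Real.exp m * _ + Real.exp (_ + ?_)
  have e1 : r * (1 + r) * (η / κ) ^ 2 * V / 2 = r * (1 + r) * η ^ 2 / (2 * κ ^ 2) * V := by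
    field_simp
  have e2 : r * (1 + r) * η ^ 2 * (C / (2 * κ ^ 2) * (L + 2)) =
    r * (1 + r) * η ^ 2 / (2 * κ ^ 2) * (C * (L + 2)) := by field_simp
  rw [e1, e2]
  exact mul_le_mul_of_nonneg_left V'_le (by positivity)

lemma persist_nonneg (P : Measure Ω) (Y : ℝ → Ω → ℝ) (δ c L : ℝ) : 0 ≤ persist P Y δ c L :=
  measureReal_nonneg

lemma persist_mono [IsFiniteMeasure P] {δ δ' : ℝ} (h : δ ≤ δ') (c L : ℝ) :
    persist P Y δ c L ≤ persist P Y δ' c L :=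
  measureReal_mono fun _ hω t ht ↦ (hω t ht).trans h

lemma persist_anti [IsFiniteMeasure P] (δ c : ℝ) : Antitone (persist P Y δ c) :=
  fun _ _ h ↦ measureReal_mono fun _ hω t ht ↦ hω t ⟨ht.1, by linarith [ht.2]⟩

/-- The logarithmic form of the comparison between the levels `δ` and `δ + η`. -/
lemma IsSechProcess.log_persist_le (hY : IsSechProcess a P Y) (ha : 0 < a) :
    ∃ C : ℝ, 0 < C ∧ ∀ L η δ r : ℝ, 0 ≤ L → 0 ≤ η → 0 < r → 0 < persist P Y (δ + η) 0 L →
      0 < persist P Y δ 0 L ∧ -Real.log (persist P Y δ 0 L) ≤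
        (1 + 1 / r) * (-Real.log (persist P Y (δ + η) 0 L) + Real.log 2) +
          (1 + r) * η ^ 2 * (C * (L + 2)) := by
  obtain ⟨C, hC, h⟩ := hY.persist_add_le ha
  refine ⟨C, hC, fun L η δ r hL hη hr hp ↦ ?_⟩
  set p := persist P Y (δ + η) 0 L
  -- This m makes the error term exactly p/2, so that it can be absorbed into the left side.
  set m := (-Real.log p + Real.log 2) / r + (1 + r) * η ^ 2 * (C * (L + 2)) with hm
  have h1 := h L η δ r m hL hη hr.le
  have h2 : Real.exp (-(r * m) + r * (1 + r) * η ^ 2 * (C * (L + 2))) = p / 2 := by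
    have : -(r * m) + r * (1 + r) * η ^ 2 * (C * (L + 2)) = Real.log (p / 2) := by
      rw [Real.log_div hp.ne' two_ne_zero, hm]
      field_simp
      ring
    rw [this, Real.exp_log (by positivity)]
  rw [h2] at h1
  have h3 : p / 2 ≤ Real.exp m * persist P Y δ 0 L := by linarith
  have h4 : 0 < persist P Y δ 0 L := by
    refine lt_of_le_of_ne (persist_nonneg _ _ _ _ _) fun h0 ↦ ?_
    rw [← h0, mul_zero] at h3
    linarith
  refine ⟨h4, ?_⟩
  have h5 := Real.log_le_log (by positivity) h3
  rw [Real.log_div hp.ne' two_ne_zero, Real.log_mul (Real.exp_pos _).ne' h4.ne', Real.log_exp] at h5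
  rw [hm] at h5
  have : (1 + 1 / r) * (-Real.log p + Real.log 2) =
    (-Real.log p + Real.log 2) + (-Real.log p + Real.log 2) / r := by ring
  rw [this]
  linarith

end LevelChangeSech

/-! ### Existence of the persistence exponent and independence of the level -/

section Exponent

variable {Ω : Type*} [MeasurableSpace Ω] {P : Measure Ω} {Y : ℝ → Ω → ℝ} {a : ℝ}

lemma IsSechProcess.measure_neg_pos (hY : IsSechProcess a P Y) : P {ω | Y 0 ω < 0} ≠ 0 := by
  have := hY.gaussian.isProbabilityMeasure
  have g := hY.gaussian.hasGaussianLaw_eval 0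
  have hv : Var[Y 0; P] = 1 := by
    rw [← covariance_self g.aemeasurable, hY.cov_eq]
    simp
  have h1 := g.map_eq_gaussianReal
  rw [hv, hY.centered, Real.toNNReal_one] at h1
  have h2 : P {ω | Y 0 ω < 0} = P.map (Y 0) (Iio 0) := by
    rw [Measure.map_apply (hY.measurable 0) measurableSet_Iio]
    rfl
  rw [h2, h1]
  intro h0
  have := gaussianReal_absolutelyContinuous' 0 one_ne_zero h0
  simp at this

/-- Y_0 < 0 has positive probability, and by continuity some short interval then has positive
persistence probability. Supermultiplicativity extends this to every length. -/
lemma IsSechProcess.persist_pos (hY : IsSechProcess a P Y) (ha : 0 < a) (L : ℝ) :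
    0 < persist P Y 0 0 L := by
  have := hY.gaussian.isProbabilityMeasure
  obtain ⟨n, hn⟩ : ∃ n : ℕ, 0 < persist P Y 0 0 (1 / ((n : ℝ) + 1)) := by
    by_contra! hcon
    refine hY.measure_neg_pos (measure_mono_null (t := ⋃ n : ℕ,
      {ω | ∀ t ∈ Icc (0 : ℝ) (0 + 1 / ((n : ℝ) + 1)), Y t ω ≤ 0}) (fun ω hω ↦ ?_)
      (measure_iUnion_null fun n ↦ ?_))
    · have h1 : ∀ᶠ t in 𝓝 (0 : ℝ), Y t ω < 0 :=
        (hY.continuous ω).continuousAt.eventually_lt continuousAt_const hω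
      obtain ⟨ε, hε, h2⟩ := Metric.eventually_nhds_iff.1 h1
      obtain ⟨n, hn⟩ := exists_nat_one_div_lt hε
      refine mem_iUnion.2 ⟨n, fun t ht ↦ (h2 ?_).le⟩
      rw [Real.dist_eq, sub_zero, abs_of_nonneg ht.1]
      linarith [ht.2]
    · have h1 := le_antisymm (hcon n) (persist_nonneg _ _ _ _ _)
      rwa [persist, measureReal_eq_zero_iff] at h1
  set h := 1 / ((n : ℝ) + 1) with hh
  have hpos : 0 < h := by positivity
  have key (k : ℕ) : 0 < persist P Y 0 0 (k * h) := by
    induction k with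
    | zero => 
      refine hn.trans_le (persist_anti _ _ ?_)
      simpa using hpos.le
    | succ k ih =>
      push_cast
      rw [add_mul, one_mul]
      exact (mul_pos ih hn).trans_le (hY.persist_mul_le ha 0 0 (by positivity) hpos.le)
  obtain ⟨k, hk⟩ := exists_nat_ge (L / h)
  exact (key k).trans_le (persist_anti _ _ ((div_le_iff₀ hpos).1 hk))

/-- The persistence exponent at level `0` exists. -/
lemma IsSechProcess.exists_tendsto (hY : IsSechProcess a P Y) (ha : 0 < a) :
    ∃ b : ℝ, Tendsto (fun T ↦ -Real.log (persist P Y 0 0 T) / T) atTop (𝓝 b) := by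
  have := hY.gaussian.isProbabilityMeasure
  have pos := hY.persist_pos ha
  set u : ℝ → ℝ := fun T ↦ -Real.log (persist P Y 0 0 T) with hu
  have u_nonneg (T : ℝ) : 0 ≤ u T := by
    rw [hu]
    exact neg_nonneg.2 (Real.log_nonpos (persist_nonneg _ _ _ _ _) measureReal_le_one)
  have u_mono : Monotone u := fun s t h ↦
    neg_le_neg (Real.log_le_log (pos t) (persist_anti _ _ h))
  have sub : Subadditive fun n : ℕ ↦ u n := by
    intro m n
    have h := hY.persist_mul_le ha 0 0 (L := m) (M := n) (by positivity) (by positivity)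
    have h1 := Real.log_le_log (mul_pos (pos _) (pos _)) h
    rw [Real.log_mul (pos _).ne' (pos _).ne'] at h1
    simp only [hu]
    push_cast
    linarith
  have lim := sub.tendsto_lim ⟨0, by
    rintro _ ⟨n, rfl⟩
    exact div_nonneg (u_nonneg _) (by positivity)⟩
  refine ⟨sub.lim, ?_⟩
  -- Fekete's lemma gives the limit along integers; monotonicity of u squeezes real T between its
  -- floor and its ceiling.
  have l1 : Tendsto (fun T : ℝ ↦ u ⌊T⌋₊ / (⌊T⌋₊ : ℝ) * ((⌊T⌋₊ : ℝ) / T)) atTop (𝓝 sub.lim) := by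
    simpa using (lim.comp tendsto_nat_floor_atTop).mul tendsto_nat_floor_div_atTop
  have l2 : Tendsto (fun T : ℝ ↦ u ⌈T⌉₊ / (⌈T⌉₊ : ℝ) * ((⌈T⌉₊ : ℝ) / T)) atTop (𝓝 sub.lim) := by
    simpa using (lim.comp tendsto_nat_ceil_atTop).mul tendsto_nat_ceil_div_atTop
  refine tendsto_of_tendsto_of_tendsto_of_le_of_le' l1 l2 ?_ ?_
  · filter_upwards [eventually_ge_atTop 1] with T hT
    have h0 : 0 < ⌊T⌋₊ := Nat.floor_pos.2 hT
    rw [div_mul_div_cancel₀ (by positivity)]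
    exact div_le_div_of_nonneg_right (u_mono (Nat.floor_le (by linarith))) (by linarith)
  · filter_upwards [eventually_ge_atTop 1] with T hT
    have h0 : 0 < ⌈T⌉₊ := Nat.ceil_pos.2 (by linarith)
    rw [div_mul_div_cancel₀ (by positivity)]
    exact div_le_div_of_nonneg_right (u_mono (Nat.le_ceil T)) (by linarith)

/-- The persistence exponent does not depend on the level `δ T → 0`. -/
lemma IsSechProcess.tendsto_level (hY : IsSechProcess a P Y) (ha : 0 < a) {b : ℝ}
    (hb : Tendsto (fun T ↦ -Real.log (persist P Y 0 0 T) / T) atTop (𝓝 b)) {δ : ℝ → ℝ}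
    (hδ : Tendsto δ atTop (𝓝 0)) :
    (∀ᶠ T in atTop, 0 < persist P Y (δ T) 0 T) ∧
      Tendsto (fun T ↦ -Real.log (persist P Y (δ T) 0 T) / T) atTop (𝓝 b) := by
  have := hY.gaussian.isProbabilityMeasure
  obtain ⟨C, hC, h⟩ := hY.log_persist_le ha
  have pos := hY.persist_pos ha
  set η : ℝ → ℝ := fun T ↦ |δ T| with hη
  have η0 : Tendsto η atTop (𝓝 0) := by simpa using hδ.abs
  -- The factor 1 + 1/r must tend to 1 while r η² tends to 0. Here r → ∞ and r η ≤ 1, so r η² ≤ η;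
  -- the summand 1/T keeps r positive when η vanishes.
  set r : ℝ → ℝ := fun T ↦ (η T + 1 / T)⁻¹ with hr
  have inv0 : Tendsto (fun T : ℝ ↦ 1 / T) atTop (𝓝 0) := by
    simpa using tendsto_inv_atTop_zero (𝕜 := ℝ)
  have r0 : Tendsto (fun T ↦ 1 / r T) atTop (𝓝 0) := by
    simpa [hr] using η0.add inv0
  have e0 : Tendsto (fun T ↦ (1 + r T) * η T ^ 2 * (C * (T + 2)) / T) atTop (𝓝 0) := by
    have up : Tendsto (fun T ↦ (η T ^ 2 + η T) * (C * (1 + 2 * (1 / T)))) atTop (𝓝 0) := by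
      have := ((η0.pow 2).add η0).mul (((inv0.const_mul 2).const_add 1).const_mul C)
      simpa using this
    refine squeeze_zero' ?_ ?_ up
    · filter_upwards [eventually_gt_atTop 0] with T hT
      have : 0 ≤ η T := abs_nonneg _
      positivity
    · filter_upwards [eventually_gt_atTop 0] with T hT
      have h1 : 0 ≤ η T := abs_nonneg _
      have h2 : r T * η T ≤ 1 := by
        rw [hr]
        simp only
        rw [inv_mul_le_iff₀ (by positivity)]
        have : 0 < 1 / T := by positivity
        linarith
      have h3 : (1 + r T) * η T ^ 2 ≤ η T ^ 2 + η T := by nlinarith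
      have h4 : (1 + r T) * η T ^ 2 * (C * (T + 2)) / T =
          (1 + r T) * η T ^ 2 * (C * (1 + 2 * (1 / T))) := by field_simp
      rw [h4]
      exact mul_le_mul_of_nonneg_right h3 (by positivity)
  have ev : ∀ᶠ T : ℝ in atTop, 0 < T ∧ 0 < r T := by
    filter_upwards [eventually_gt_atTop 0] with T hT
    exact ⟨hT, inv_pos.2 (by positivity)⟩
  -- Since -η ≤ δ ≤ η, two comparisons suffice: level -η with level 0 here, and level 0 with level η
  -- below.
  have low (T : ℝ) (hT : 0 < T) (hrT : 0 < r T) := h T (η T) (-η T) (r T) hT.le (abs_nonneg _) hrT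
    (by simpa using pos T)
  have mono1 (T : ℝ) : persist P Y (-η T) 0 T ≤ persist P Y (δ T) 0 T :=
    persist_mono (neg_abs_le _) _ _
  have ppos : ∀ᶠ T in atTop, 0 < persist P Y (δ T) 0 T := by
    filter_upwards [ev] with T hT
    exact (low T hT.1 hT.2).1.trans_le (mono1 T)
  refine ⟨ppos, ?_⟩
  have lim1 : Tendsto (fun T ↦ (-Real.log (persist P Y 0 0 T) / T -
      (1 + r T) * η T ^ 2 * (C * (T + 2)) / T) / (1 + 1 / r T) - Real.log 2 * (1 / T)) atTop
      (𝓝 b) := by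
    have := ((hb.sub e0).div (r0.const_add 1) (by norm_num)).sub (inv0.const_mul (Real.log 2))
    simpa using this
  have lim2 : Tendsto (fun T ↦ (1 + 1 / r T) * (-Real.log (persist P Y 0 0 T) / T +
      Real.log 2 * (1 / T)) + (1 + r T) * η T ^ 2 * (C * (T + 2)) / T) atTop (𝓝 b) := by
    have := ((r0.const_add 1).mul (hb.add (inv0.const_mul (Real.log 2)))).add e0
    simpa using this
  refine tendsto_of_tendsto_of_tendsto_of_le_of_le' lim1 lim2 ?_ ?_
  · filter_upwards [ev, ppos] with T ⟨hT, hrT⟩ hp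
    have h1 : persist P Y (δ T) 0 T ≤ persist P Y (0 + η T) 0 T := by
      rw [zero_add]
      exact persist_mono (le_abs_self _) _ _
    have h2 := (h T (η T) 0 (r T) hT.le (abs_nonneg _) hrT (hp.trans_le h1)).2
    have h3 := Real.log_le_log hp h1
    have h4 : -Real.log (persist P Y 0 0 T) ≤ (1 + 1 / r T) *
        (-Real.log (persist P Y (δ T) 0 T) + Real.log 2) +
          (1 + r T) * η T ^ 2 * (C * (T + 2)) := by
      refine h2.trans ?_
      gcongr
    rw [sub_le_iff_le_add, div_le_iff₀ (by positivity), sub_le_iff_le_add]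
    have h5 := div_le_div_of_nonneg_right h4 hT.le
    refine h5.trans_eq ?_
    ring
  · filter_upwards [ev, ppos] with T ⟨hT, hrT⟩ hp
    obtain ⟨h1, h2⟩ := low T hT hrT
    have h3 := Real.log_le_log h1 (mono1 T)
    rw [neg_add_cancel] at h2
    have h4 := div_le_div_of_nonneg_right ((neg_le_neg h3).trans h2) hT.le
    refine h4.trans_eq ?_
    ring

lemma IsSechProcess.neg (hY : IsSechProcess a P Y) : IsSechProcess a P fun t ω ↦ -Y t ω where
  measurable t := (hY.measurable t).neg
  continuous ω := (hY.continuous ω).neg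
  gaussian := by simpa using hY.gaussian.smul fun _ ↦ -1
  centered t := by rw [integral_neg, hY.centered, neg_zero]
  cov_eq s t := by
    rw [covariance_fun_neg_left, covariance_fun_neg_right, neg_neg, hY.cov_eq]

/-- The probability of having no zero decays with the same exponent. -/
lemma IsSechProcess.tendsto_nonzero (hY : IsSechProcess a P Y) (ha : 0 < a) {b : ℝ}
    (hb : Tendsto (fun T ↦ -Real.log (persist P Y 0 0 T) / T) atTop (𝓝 b)) :
    (∀ᶠ T in atTop, 0 < P.real {ω | ∀ t ∈ Icc 0 T, Y t ω ≠ 0}) ∧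
      Tendsto (fun T ↦ -Real.log (P.real {ω | ∀ t ∈ Icc 0 T, Y t ω ≠ 0}) / T) atTop (𝓝 b) := by
  have := hY.gaussian.isProbabilityMeasure
  have inv0 : Tendsto (fun T : ℝ ↦ 1 / T) atTop (𝓝 0) := by
    simpa using tendsto_inv_atTop_zero (𝕜 := ℝ)
  -- A strictly negative level is needed because staying ≤ 0 does not exclude zeros.
  obtain ⟨hp, hl⟩ := hY.tendsto_level ha hb (δ := fun T ↦ -(1 / T)) (by simpa using inv0.neg)
  have low : ∀ᶠ T in atTop, persist P Y (-(1 / T)) 0 T ≤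
      P.real {ω | ∀ t ∈ Icc 0 T, Y t ω ≠ 0} := by
    filter_upwards [eventually_gt_atTop 0] with T hT
    refine measureReal_mono fun ω hω t ht ↦ ne_of_lt ?_
    have h1 := hω t (by simpa using ht)
    have : 0 < 1 / T := by positivity
    linarith
  -- A continuous path without zeros has constant sign, and -Y has the same persistence
  -- probabilities as Y.
  have up : ∀ᶠ T : ℝ in atTop, P.real {ω | ∀ t ∈ Icc 0 T, Y t ω ≠ 0} ≤ 2 * persist P Y 0 0 T := by
    filter_upwards [eventually_gt_atTop 0] with T hT
    have h1 : {ω | ∀ t ∈ Icc 0 T, Y t ω ≠ 0} ⊆ {ω | ∀ t ∈ Icc 0 (0 + T), Y t ω ≤ 0} ∪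
        {ω | ∀ t ∈ Icc 0 (0 + T), -Y t ω ≤ 0} := by
      intro ω hω
      rw [zero_add]
      by_contra hcon
      simp only [mem_union, mem_ofPred_eq, not_or, not_forall, not_le] at hcon
      obtain ⟨⟨s, hs, hs'⟩, t, ht, ht'⟩ := hcon
      obtain ⟨x, hx, hx0⟩ := isPreconnected_Icc.intermediate_value ht hs
        (hY.continuous ω).continuousOn ⟨by linarith, hs'.le⟩
      exact hω x hx hx0
    refine (measureReal_mono h1).trans ((measureReal_union_le _ _).trans_eq ?_)
    have h2 := hY.persist_eq hY.neg 0 0 0 hT.le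
    rw [two_mul]
    nth_rewrite 2 [h2]
    rfl
  have pos : ∀ᶠ T in atTop, 0 < P.real {ω | ∀ t ∈ Icc 0 T, Y t ω ≠ 0} := by
    filter_upwards [hp, low] with T h1 h2 using h1.trans_le h2
  refine ⟨pos, ?_⟩
  have lim1 : Tendsto (fun T ↦ -Real.log (persist P Y 0 0 T) / T - Real.log 2 * (1 / T)) atTop
      (𝓝 b) := by simpa using hb.sub (inv0.const_mul (Real.log 2))
  refine tendsto_of_tendsto_of_tendsto_of_le_of_le' lim1 hl ?_ ?_
  · filter_upwards [eventually_gt_atTop 0, up, pos] with T hT h1 h2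
    have h3 := Real.log_le_log h2 h1
    rw [Real.log_mul two_ne_zero (hY.persist_pos ha T).ne'] at h3
    have := div_le_div_of_nonneg_right (neg_le_neg h3) hT.le
    refine le_trans (le_of_eq ?_) this
    ring
  · filter_upwards [eventually_gt_atTop 0, low, hp] with T hT h1 h2
    exact div_le_div_of_nonneg_right (neg_le_neg (Real.log_le_log h2 h1)) hT.le

end Exponent

/-! ### The process Y^(α) has covariance cosh^(-(α+1)) -/

section PersistenceExponent

/-- The integrand is r^α exp(-(e^(-s) + e^(-t)) r), so this is the Gamma integral. -/
lemma gInner_eq {α : ℝ} (hα : -1 < α) (s t : ℝ) :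
    gInner α s t = (1 / (Real.exp (-s) + Real.exp (-t))) ^ (α + 1) * Real.Gamma (α + 1) := by
  have hpos : 0 < Real.exp (-s) + Real.exp (-t) := by positivity
  rw [← Real.integral_rpow_mul_exp_neg_mul_Ioi (by linarith) hpos, gInner]
  refine setIntegral_congr_fun measurableSet_Ioi fun r hr ↦ ?_
  have hr : 0 < r := hr
  simp only [gFun]
  rw [show α + 1 - 1 = α / 2 + α / 2 by ring, Real.rpow_add hr,
    show -((Real.exp (-s) + Real.exp (-t)) * r) = -Real.exp (-s) * r + -Real.exp (-t) * r by ring,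
    Real.exp_add]
  ring

lemma exp_neg_add_exp_neg (s t : ℝ) :
    Real.exp (-s) + Real.exp (-t) = 2 * Real.exp (-(s + t) / 2) * Real.cosh ((s - t) / 2) := by
  rw [Real.cosh_eq, show -s = -(s + t) / 2 + -((s - t) / 2) by ring,
    show -t = -(s + t) / 2 + (s - t) / 2 by ring, Real.exp_add, Real.exp_add]
  ring

/-- Apart from the hyperbolic cosine, e^(-s) + e^(-t) is 2 e^(-(s+t)/2). That factor and the Gamma
value cancel against the normalization. -/
lemma gInner_div_eq {α : ℝ} (hα : -1 < α) (s t : ℝ) :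
    gInner α s t / (√(gInner α s s) * √(gInner α t t)) =
      Real.cosh ((s - t) / 2) ^ (-(α + 1)) := by
  have hG : 0 < Real.Gamma (α + 1) := Real.Gamma_pos_of_pos (by linarith)
  have hc := Real.cosh_pos ((s - t) / 2)
  have e (s t : ℝ) : gInner α s t = Real.cosh ((s - t) / 2) ^ (-(α + 1)) *
      ((1 / (2 * Real.exp (-(s + t) / 2))) ^ (α + 1) * Real.Gamma (α + 1)) := by
    have hc := Real.cosh_pos ((s - t) / 2)
    rw [gInner_eq hα, exp_neg_add_exp_neg, one_div, Real.inv_rpow (by positivity),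
      Real.mul_rpow (by positivity) hc.le, mul_inv, ← Real.rpow_neg hc.le, one_div,
      Real.inv_rpow (by positivity)]
    ring
  have h1 : gInner α s s * gInner α t t =
      ((1 / (2 * Real.exp (-(s + t) / 2))) ^ (α + 1) * Real.Gamma (α + 1)) ^ 2 := by
    rw [e, e]
    simp only [sub_self, zero_div, Real.cosh_zero, Real.one_rpow, one_mul]
    have h2 : (1 / (2 * Real.exp (-(s + s) / 2))) ^ (α + 1) *
        (1 / (2 * Real.exp (-(t + t) / 2))) ^ (α + 1) =
        (1 / (2 * Real.exp (-(s + t) / 2))) ^ (α + 1) *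
        (1 / (2 * Real.exp (-(s + t) / 2))) ^ (α + 1) := by
      rw [← Real.mul_rpow (by positivity) (by positivity),
        ← Real.mul_rpow (by positivity) (by positivity)]
      congr 1
      have h3 : Real.exp (-(s + s) / 2) * Real.exp (-(t + t) / 2) =
          Real.exp (-(s + t) / 2) * Real.exp (-(s + t) / 2) := by
        rw [← Real.exp_add, ← Real.exp_add]
        ring_nf
      rw [div_mul_div_comm, div_mul_div_comm]
      congr 1
      linear_combination 4 * h3
    linear_combination Real.Gamma (α + 1) ^ 2 * h2
  have h0 : 0 ≤ gInner α s s := by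
    rw [gInner_eq hα]
    positivity
  rw [← Real.sqrt_mul h0, h1, Real.sqrt_sq (by positivity), e s t]
  field_simp

variable {Ω : Type} [MeasurableSpace Ω] {P : Measure Ω}

lemma IsSechProcess.isYProcess {a : ℝ} {Y : ℝ → Ω → ℝ} (hY : IsSechProcess a P Y) (ha : 0 < a)
    (hs : ∀ ω, ContDiff ℝ (⊤ : ℕ∞) fun t ↦ Y t ω) : IsYProcess (a - 1) P Y where
  measurable := hY.measurable
  smooth := hs
  gaussian := hY.gaussian
  centered := hY.centered
  cov_eq s t := by rw [gInner_div_eq (by linarith), hY.cov_eq]; simp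

lemma IsSechProcess.isPersistenceExponent {a b : ℝ} {Y : ℝ → Ω → ℝ} (hY : IsSechProcess a P Y)
    (ha : 0 < a) (hs : ∀ ω, ContDiff ℝ (⊤ : ℕ∞) fun t ↦ Y t ω)
    (hb : Tendsto (fun T ↦ -Real.log (persist P Y 0 0 T) / T) atTop (𝓝 b)) :
    IsPersistenceExponent (a - 1) b := by
  refine ⟨Ω, inferInstance, P, Y, hY.gaussian.isProbabilityMeasure, hY.isYProcess ha hs,
    fun δ hδ ↦ ?_⟩
  have h := hY.tendsto_level ha hb hδ
  simpa only [persist, zero_add, neg_div] using h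

/-- If the zero-free probability of `Y` on `[0, L]` is `exp (-(b + o(1)) L)`, then for the process in
logarithmic time it is `T ^ (-b + o(1))`. -/
lemma exists_rpow_of_tendsto_log {p : ℝ → ℝ} {b : ℝ} (hp : ∀ᶠ L in atTop, 0 < p L)
    (hl : Tendsto (fun L ↦ -Real.log (p L) / L) atTop (𝓝 b)) :
    ∃ ε : ℝ → ℝ, Tendsto ε atTop (𝓝 0) ∧
      ∀ᶠ T : ℝ in atTop, p (Real.log T) = T ^ (-b + ε T) := by
  refine ⟨fun T ↦ b - -Real.log (p (Real.log T)) / Real.log T, ?_, ?_⟩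
  · simpa using (hl.comp Real.tendsto_log_atTop).const_sub b
  · filter_upwards [Real.tendsto_log_atTop.eventually hp, eventually_gt_atTop 1] with T h1 h2
    have h3 := Real.log_pos h2
    rw [Real.rpow_def_of_pos (by linarith)]
    have : Real.log T * (-b + (b - -Real.log (p (Real.log T)) / Real.log T)) =
        Real.log (p (Real.log T)) := by
      field_simp
      ring
    rw [this, Real.exp_log h1]

end PersistenceExponent

/-! ### Smoothness of Gaussian exponential families -/

section ExponentialFamily

variable {d : ℕ} {F : Type*} [NormedAddCommGroup F] [NormedSpace ℝ F]

/-- Functions that are integrable against every centered Gaussian density. -/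
def Moderate (g : Space d → F) : Prop :=
  ∀ c : ℝ, 0 < c → Integrable fun y ↦ Real.exp (-c * ‖y‖ ^ 2) • g y

/-- The linear functional `(q, s) ↦ ⟪q, y⟫ + s ‖y‖²`. -/
def expoLin (y : Space d) : Space d × ℝ →L[ℝ] ℝ :=
  (innerSL ℝ y).comp (.fst ℝ (Space d) ℝ) + ‖y‖ ^ 2 • .snd ℝ (Space d) ℝ

lemma expoLin_apply (y : Space d) (q : Space d × ℝ) :
    expoLin y q = inner ℝ y q.1 + ‖y‖ ^ 2 * q.2 := by
  simp [expoLin]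

lemma continuous_expoLin : Continuous (expoLin : Space d → Space d × ℝ →L[ℝ] ℝ) := by
  unfold expoLin
  fun_prop

lemma norm_expoLin_le (y : Space d) : ‖expoLin y‖ ≤ 1 + 2 * ‖y‖ ^ 2 := by
  refine ContinuousLinearMap.opNorm_le_bound _ (by positivity) fun q ↦ ?_
  rw [expoLin_apply]
  have h1 : ‖q.1‖ ≤ ‖q‖ := norm_fst_le q
  have h2 : ‖q.2‖ ≤ ‖q‖ := norm_snd_le q
  have h3 := norm_inner_le_norm (𝕜 := ℝ) y q.1
  have h4 : ‖‖y‖ ^ 2 * q.2‖ ≤ ‖y‖ ^ 2 * ‖q‖ := by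
    rw [norm_mul, norm_pow, norm_norm]
    gcongr
  have h5 : ‖y‖ * ‖q.1‖ ≤ ‖y‖ * ‖q‖ := by gcongr
  have h6 : ‖y‖ * ‖q‖ ≤ (1 + ‖y‖ ^ 2) * ‖q‖ := by
    gcongr
    nlinarith [sq_nonneg (‖y‖ - 1)]
  refine (norm_add_le _ _).trans ?_
  nlinarith

lemma Moderate.aestronglyMeasurable {g : Space d → F} (hg : Moderate g) :
    AEStronglyMeasurable g := by
  have h := (hg 1 one_pos).aestronglyMeasurable
  have h2 : AEStronglyMeasurable fun y : Space d ↦ Real.exp (‖y‖ ^ 2) :=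
    (by fun_prop : Continuous fun y : Space d ↦ Real.exp (‖y‖ ^ 2)).aestronglyMeasurable
  convert! h2.smul h using 1
  ext y
  simp [smul_smul, ← Real.exp_add]

/-- Half of the Gaussian decay absorbs a quadratic weight. This is why differentiation, which
multiplies g by at most 1 + ‖y‖² up to constants, stays inside the class. -/
lemma Moderate.mono {G : Type*} [NormedAddCommGroup G] [NormedSpace ℝ G] {g : Space d → F}
    {f : Space d → G} (hg : Moderate g) (hf : AEStronglyMeasurable f) {C : ℝ}
    (h : ∀ y, ‖f y‖ ≤ (C * (1 + ‖y‖ ^ 2)) * ‖g y‖) : Moderate f := by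
  intro c hc
  have h1 := ((hg (c / 2) (by positivity)).norm.const_mul (|C| * (1 + 2 / c)))
  refine h1.mono' ((by fun_prop : Continuous fun y : Space d ↦
    Real.exp (-c * ‖y‖ ^ 2)).aestronglyMeasurable.smul hf) (.of_forall fun y ↦ ?_)
  rw [norm_smul, norm_smul, Real.norm_of_nonneg (Real.exp_pos _).le,
    Real.norm_of_nonneg (Real.exp_pos _).le]
  have h2 : 1 + ‖y‖ ^ 2 ≤ (1 + 2 / c) * Real.exp (c / 2 * ‖y‖ ^ 2) := by
    have h3 := Real.add_one_le_exp (c / 2 * ‖y‖ ^ 2)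
    have h4 : 1 ≤ Real.exp (c / 2 * ‖y‖ ^ 2) := Real.one_le_exp (by positivity)
    have h5 : ‖y‖ ^ 2 ≤ 2 / c * Real.exp (c / 2 * ‖y‖ ^ 2) := by
      rw [div_mul_eq_mul_div, le_div_iff₀ hc]
      nlinarith
    linarith
  have h6 : Real.exp (-c * ‖y‖ ^ 2) * Real.exp (c / 2 * ‖y‖ ^ 2) =
      Real.exp (-(c / 2) * ‖y‖ ^ 2) := by
    rw [← Real.exp_add]
    congr 1
    ring
  calc Real.exp (-c * ‖y‖ ^ 2) * ‖f y‖
      ≤ Real.exp (-c * ‖y‖ ^ 2) *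
          ((|C| * ((1 + 2 / c) * Real.exp (c / 2 * ‖y‖ ^ 2))) * ‖g y‖) := by
        gcongr
        refine (h y).trans ?_
        gcongr
        exact le_abs_self C
    _ = |C| * (1 + 2 / c) * (Real.exp (-(c / 2) * ‖y‖ ^ 2) * ‖g y‖) := by
        rw [← h6]
        ring

lemma Moderate.smulRight {g : Space d → F} (hg : Moderate g) :
    Moderate fun y ↦ (expoLin y).smulRight (g y) := by
  refine hg.mono (C := 2) ?_ fun y ↦ ?_
  · exact (ContinuousLinearMap.smulRightL ℝ (Space d × ℝ) F).continuous₂.comp_aestronglyMeasurable₂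
      continuous_expoLin.aestronglyMeasurable hg.aestronglyMeasurable
  · rw [ContinuousLinearMap.norm_smulRight_apply]
    gcongr
    refine (norm_expoLin_le y).trans ?_
    nlinarith

/-- `∫ exp(⟪q, y⟫ + s ‖y‖²) g(y) dy`. -/
def expoInt (g : Space d → F) (q : Space d × ℝ) : F := ∫ y, Real.exp (expoLin y q) • g y

/-- Completing the square spends half of the quadratic decay on the linear term. The bound is
uniform near a given parameter and serves as dominating function. -/
lemma exp_expoLin_le {y : Space d} {q : Space d × ℝ} {R κ : ℝ} (hκ : 0 < κ) (h1 : ‖q.1‖ ≤ R)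
    (h2 : q.2 ≤ -(2 * κ)) :
    Real.exp (expoLin y q) ≤ Real.exp (R ^ 2 / (4 * κ)) * Real.exp (-κ * ‖y‖ ^ 2) := by
  rw [← Real.exp_add, Real.exp_le_exp, expoLin_apply]
  have h3 := real_inner_le_norm y q.1
  have h4 : ‖y‖ * ‖q.1‖ ≤ ‖y‖ * R := by gcongr
  have h5 : ‖y‖ * R ≤ R ^ 2 / (4 * κ) + κ * ‖y‖ ^ 2 := by
    rw [← sub_nonneg]
    have : R ^ 2 / (4 * κ) + κ * ‖y‖ ^ 2 - ‖y‖ * R = (R - 2 * κ * ‖y‖) ^ 2 / (4 * κ) := by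
      field_simp
      ring
    rw [this]
    positivity
  have h6 : ‖y‖ ^ 2 * q.2 ≤ ‖y‖ ^ 2 * (-(2 * κ)) := by gcongr
  nlinarith

lemma Moderate.integrable_expo {g : Space d → F} (hg : Moderate g) {q : Space d × ℝ}
    (hq : q.2 < 0) : Integrable fun y ↦ Real.exp (expoLin y q) • g y := by
  have hκ : 0 < -q.2 / 2 := by linarith
  refine ((hg _ hκ).norm.const_mul (Real.exp (‖q.1‖ ^ 2 / (4 * (-q.2 / 2))))).mono'
    (((Real.continuous_exp.comp ((continuous_expoLin.clm_apply
      continuous_const)))).aestronglyMeasurable.smul hg.aestronglyMeasurable)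
    (.of_forall fun y ↦ ?_)
  rw [norm_smul, norm_smul, Real.norm_of_nonneg (Real.exp_pos _).le,
    Real.norm_of_nonneg (Real.exp_pos _).le, ← mul_assoc]
  gcongr
  exact exp_expoLin_le hκ le_rfl (by linarith)

lemma Moderate.hasFDerivAt_expoInt {g : Space d → F} (hg : Moderate g) {q : Space d × ℝ}
    (hq : q.2 < 0) :
    HasFDerivAt (expoInt g) (expoInt (fun y ↦ (expoLin y).smulRight (g y)) q) q := by
  -- With this choice -2κ = q.2/2, so the region p.2 < -2κ is a neighbourhood of q that stays away
  -- from 0.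
  set κ : ℝ := -q.2 / 4 with hκ
  have hκ0 : 0 < κ := by rw [hκ]; linarith
  set s : Set (Space d × ℝ) := {p | ‖p.1‖ < ‖q.1‖ + 1 ∧ p.2 < -(2 * κ)} with hs
  have hs_mem : s ∈ 𝓝 q := by
    refine IsOpen.mem_nhds ?_ ⟨by simp, by rw [hκ]; linarith⟩
    exact (isOpen_lt (f := fun p : Space d × ℝ ↦ ‖p.1‖) (by fun_prop) continuous_const).inter
      (isOpen_lt (f := fun p : Space d × ℝ ↦ p.2) (by fun_prop) continuous_const)
  refine hasFDerivAt_integral_of_dominated_of_fderiv_le (𝕜 := ℝ)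
    (F' := fun p y ↦ Real.exp (expoLin y p) • (expoLin y).smulRight (g y))
    (bound := fun y ↦ Real.exp ((‖q.1‖ + 1) ^ 2 / (4 * κ)) *
      ‖Real.exp (-κ * ‖y‖ ^ 2) • (expoLin y).smulRight (g y)‖) hs_mem ?_
    (hg.integrable_expo hq) (hg.smulRight.integrable_expo hq).aestronglyMeasurable
    (.of_forall fun y p hp ↦ ?_) ((hg.smulRight κ hκ0).norm.const_mul _)
    (.of_forall fun y p hp ↦ ?_)
  · filter_upwards [hs_mem] with p hp
    exact (hg.integrable_expo (by linarith [hp.2])).aestronglyMeasurable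
  · rw [norm_smul, norm_smul, Real.norm_of_nonneg (Real.exp_pos _).le,
      Real.norm_of_nonneg (Real.exp_pos _).le, ← mul_assoc]
    gcongr
    exact exp_expoLin_le hκ0 hp.1.le hp.2.le
  · have h := ((expoLin y).hasFDerivAt (x := p)).exp.smul_const (g y)
    convert! h using 1
    ext <;> simp [mul_smul]

/-- The derivative is an integral of the same kind, for a moderate function with values in a space
of linear maps. The induction therefore runs over all target spaces F. -/
lemma Moderate.contDiffOn_expoInt {g : Space d → F} (hg : Moderate g) (n : ℕ) :
    ContDiffOn ℝ n (expoInt g) {q | q.2 < 0} := by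
  have ho : IsOpen {q : Space d × ℝ | q.2 < 0} := isOpen_lt (by fun_prop) continuous_const
  induction n generalizing F with
  | zero =>
    refine contDiffOn_zero.2 fun q hq ↦ ?_
    exact (hg.hasFDerivAt_expoInt hq).continuousAt.continuousWithinAt
  | succ n ih =>
    push_cast
    rw [contDiffOn_succ_iff_fderiv_of_isOpen ho]
    refine ⟨fun q hq ↦ (hg.hasFDerivAt_expoInt hq).differentiableAt.differentiableWithinAt,
      by simp, (ih hg.smulRight).congr fun q hq ↦ (hg.hasFDerivAt_expoInt hq).fderiv⟩

end ExponentialFamily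

/-! ### The heat flow: smoothness and the heat equation -/

section HeatFlow

variable {d : ℕ}

/-- The normalizing factor `(4πt)^{-d/2}`. -/
def heatFactor (d : ℕ) (t : ℝ) : ℝ := (4 * Real.pi * t) ^ (-(d : ℝ) / 2)

/-- The solution of the heat equation with initial value `g`. -/
def heatFlow (g : Space d → ℝ) (t : ℝ) (x : Space d) : ℝ := ∫ y, heatKernel t (x - y) * g y

/-- The parameter of the exponential family that corresponds to `K_t(x - ·)`. -/
def heatParam (t : ℝ) (x : Space d) : Space d × ℝ := ((1 / (2 * t)) • x, -(1 / (4 * t)))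

/-- Expanding ‖x - y‖² turns the kernel into an exponential family in y with parameters x/(2t) and
-1/(4t), up to a factor free of y. All smoothness in (x,t) follows from this form. -/
lemma heatKernel_sub_eq {t : ℝ} (ht : t ≠ 0) (x y : Space d) :
    heatKernel t (x - y) = heatFactor d t * Real.exp (-‖x‖ ^ 2 / (4 * t)) *
      Real.exp (expoLin y (heatParam t x)) := by
  rw [heatKernel, heatFactor, mul_assoc (_ ^ _), ← Real.exp_add, expoLin_apply, heatParam,
    inner_smul_right, norm_sub_sq_real, real_inner_comm]
  congr 2
  field_simp
  ring

lemma heatFlow_eq {t : ℝ} (ht : t ≠ 0) (g : Space d → ℝ) (x : Space d) :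
    heatFlow g t x = heatFactor d t * Real.exp (-‖x‖ ^ 2 / (4 * t)) *
      expoInt g (heatParam t x) := by
  simp_rw [heatFlow, heatKernel_sub_eq ht, expoInt, mul_assoc, integral_const_mul, smul_eq_mul]

lemma Moderate.integrable_heatKernel {g : Space d → ℝ} (hg : Moderate g) {t : ℝ} (ht : 0 < t)
    (x : Space d) : Integrable fun y ↦ heatKernel t (x - y) * g y := by
  simp_rw [heatKernel_sub_eq ht.ne', mul_assoc]
  refine ((hg.integrable_expo (q := heatParam t x) ?_).const_mul _).const_mul _
  simpa [heatParam] using ht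

lemma Moderate.contDiffOn_heatFlow {g : Space d → ℝ} (hg : Moderate g) :
    ContDiffOn ℝ (⊤ : ℕ∞) (fun p : Space d × ℝ ↦ heatFlow g p.2 p.1) (univ ×ˢ Ioi (0 : ℝ)) := by
  rw [contDiffOn_infty]
  intro n
  have h1 : ContDiffOn ℝ n (fun p : Space d × ℝ ↦ heatFactor d p.2 *
      Real.exp (-‖p.1‖ ^ 2 / (4 * p.2)) * expoInt g (heatParam p.2 p.1))
      (univ ×ˢ Ioi (0 : ℝ)) := by
    intro p hp
    have hp2 : 0 < p.2 := hp.2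
    have e1 : ContDiffWithinAt ℝ n (fun p : Space d × ℝ ↦ heatFactor d p.2)
        (univ ×ˢ Ioi (0 : ℝ)) p := by
      unfold heatFactor
      refine ContDiffWithinAt.rpow_const_of_ne (by fun_prop) (by positivity)
    have e2 : ContDiffWithinAt ℝ n (fun p : Space d × ℝ ↦ Real.exp (-‖p.1‖ ^ 2 / (4 * p.2)))
        (univ ×ˢ Ioi (0 : ℝ)) p := by
      refine ContDiffWithinAt.exp (ContDiffWithinAt.div ?_ (by fun_prop) (by positivity))
      exact ((contDiff_fst.norm_sq ℝ).neg).contDiffWithinAt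
    have e3 : ContDiffWithinAt ℝ n (fun p : Space d × ℝ ↦ heatParam p.2 p.1)
        (univ ×ˢ Ioi (0 : ℝ)) p := by
      unfold heatParam
      refine ContDiffWithinAt.prodMk (ContDiffWithinAt.fun_smul ?_ contDiffWithinAt_fst) ?_
      · exact contDiffWithinAt_const.div (by fun_prop) (by positivity)
      · exact (contDiffWithinAt_const.div (by fun_prop) (by positivity)).neg
    have e4 : ContDiffWithinAt ℝ n (fun p : Space d × ℝ ↦ expoInt g (heatParam p.2 p.1))
        (univ ×ˢ Ioi (0 : ℝ)) p := by
      refine ContDiffWithinAt.comp p (t := {q : Space d × ℝ | q.2 < 0})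
        (hg.contDiffOn_expoInt n _ ?_) e3 fun p hp ↦ ?_
      · simpa [heatParam] using hp2
      · have : 0 < p.2 := hp.2
        simpa [heatParam] using this
    exact (e1.mul e2).mul e4
  exact h1.congr fun p hp ↦ heatFlow_eq (ne_of_gt hp.2) g p.1

lemma expoInt_smulRight_apply {g : Space d → ℝ} (hg : Moderate g) {q : Space d × ℝ}
    (hq : q.2 < 0) (v : Space d × ℝ) :
    expoInt (fun y ↦ (expoLin y).smulRight (g y)) q v = expoInt (fun y ↦ expoLin y v * g y) q := by
  rw [expoInt, ContinuousLinearMap.integral_apply (hg.smulRight.integrable_expo hq)]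
  rfl

lemma Moderate.inner_mul {g : Space d → ℝ} (hg : Moderate g) (e : Space d) :
    Moderate fun y ↦ inner ℝ y e * g y := by
  refine hg.mono (C := ‖e‖) ?_ fun y ↦ ?_
  · exact (by fun_prop : Continuous fun y : Space d ↦ (inner ℝ y e : ℝ)).aestronglyMeasurable.mul
      hg.aestronglyMeasurable
  · rw [norm_mul]
    gcongr
    refine (norm_inner_le_norm y e).trans ?_
    nlinarith [sq_nonneg (‖y‖ - 1), norm_nonneg e]

lemma Moderate.sq_mul {g : Space d → ℝ} (hg : Moderate g) :
    Moderate fun y ↦ ‖y‖ ^ 2 * g y := by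
  refine hg.mono (C := 1) ?_ fun y ↦ ?_
  · exact (by fun_prop : Continuous fun y : Space d ↦ ‖y‖ ^ 2).aestronglyMeasurable.mul
      hg.aestronglyMeasurable
  · rw [norm_mul, Real.norm_of_nonneg (by positivity)]
    gcongr
    linarith

/-- The derivative is again expressed by heat flows of moderate functions, so the formula can be
applied twice to reach the Laplacian. -/
lemma Moderate.hasFDerivAt_heatFlow {g : Space d → ℝ} (hg : Moderate g) {t : ℝ} (ht : 0 < t)
    (x : Space d) : ∃ A : Space d →L[ℝ] ℝ, HasFDerivAt (heatFlow g t) A x ∧ ∀ e,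
      A e = 1 / (2 * t) * (heatFlow (fun y ↦ inner ℝ y e * g y) t x -
        inner ℝ x e * heatFlow g t x) := by
  have hq : (heatParam t x).2 < 0 := by simpa [heatParam] using ht
  have h1 : HasFDerivAt (heatParam (d := d) t)
      ((((1 / (2 * t)) • ContinuousLinearMap.id ℝ (Space d))).prod 0) x :=
    ((hasFDerivAt_id x).const_smul (1 / (2 * t))).prodMk (hasFDerivAt_const _ _)
  have h2 := (hg.hasFDerivAt_expoInt hq).comp x h1
  have h3 : HasFDerivAt (fun x : Space d ↦ Real.exp (-‖x‖ ^ 2 / (4 * t)))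
      (Real.exp (-‖x‖ ^ 2 / (4 * t)) • ((4 * t)⁻¹ • (-(2 • innerSL ℝ x) : Space d →L[ℝ] ℝ))) x := by
    have := ((hasStrictFDerivAt_norm_sq x).hasFDerivAt.neg.mul_const (4 * t)⁻¹).exp
    simpa only [← div_eq_mul_inv, Pi.neg_apply] using! this
  refine ⟨_, ((h3.const_mul (heatFactor d t)).mul h2).congr_of_eventuallyEq
    (.of_forall fun z ↦ heatFlow_eq ht.ne' g z), fun e ↦ ?_⟩
  rw [heatFlow_eq ht.ne', heatFlow_eq ht.ne']
  simp only [add_apply, smul_apply,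
    ContinuousLinearMap.comp_apply, ContinuousLinearMap.prod_apply, neg_apply,
    innerSL_apply_apply, smul_eq_mul, Function.comp_apply]
  rw [expoInt_smulRight_apply hg hq]
  have h4 : expoInt (fun y ↦ expoLin y ((1 / (2 * t)) • ContinuousLinearMap.id ℝ (Space d) e,
      (0 : Space d →L[ℝ] ℝ) e) * g y) (heatParam t x) =
      1 / (2 * t) * expoInt (fun y ↦ inner ℝ y e * g y) (heatParam t x) := by
    rw [expoInt, expoInt, ← integral_const_mul]
    congr 1 with y
    simp [expoLin_apply, inner_smul_right]
    ring
  rw [h4]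
  field_simp
  ring

lemma Moderate.hasDerivAt_heatFlow {g : Space d → ℝ} (hg : Moderate g) {t : ℝ} (ht : 0 < t)
    (x : Space d) : HasDerivAt (fun s ↦ heatFlow g s x)
      (1 / (4 * t ^ 2) * (heatFlow (fun y ↦ ‖y‖ ^ 2 * g y) t x -
        2 * heatFlow (fun y ↦ inner ℝ y x * g y) t x + ‖x‖ ^ 2 * heatFlow g t x) -
          d / (2 * t) * heatFlow g t x) t := by
  have hq : (heatParam t x).2 < 0 := by simpa [heatParam] using ht
  have hi : HasDerivAt (fun s : ℝ ↦ 1 / s) (-(1 / t ^ 2)) t := by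
    simpa using hasDerivAt_inv ht.ne'
  have h1 : HasDerivAt (fun s ↦ heatParam s x) ((-(1 / (2 * t ^ 2))) • x, 1 / (4 * t ^ 2)) t := by
    have a1 : HasDerivAt (fun s : ℝ ↦ 1 / (2 * s)) (-(1 / (2 * t ^ 2))) t := by
      convert! hi.const_mul (1 / 2) using 1
      · ext s; ring
      · ring
    have a2 : HasDerivAt (fun s : ℝ ↦ -(1 / (4 * s))) (1 / (4 * t ^ 2)) t := by
      convert! hi.const_mul (-(1 / 4)) using 1
      · ext s; ring
      · ring
    exact (a1.smul_const x).prodMk a2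
  have h2 := (hg.hasFDerivAt_expoInt hq).comp_hasDerivAt t h1
  have h3 : HasDerivAt (fun s : ℝ ↦ Real.exp (-‖x‖ ^ 2 / (4 * s)))
      (Real.exp (-‖x‖ ^ 2 / (4 * t)) * (‖x‖ ^ 2 / (4 * t ^ 2))) t := by
    refine HasDerivAt.exp ?_
    convert! hi.const_mul (-‖x‖ ^ 2 / 4) using 1
    · ext s; ring
    · ring
  have h4 : HasDerivAt (heatFactor d) (heatFactor d t * (-(d / (2 * t)))) t := by
    have hp : 0 < 4 * Real.pi * t := by positivity
    have := ((hasDerivAt_id t).const_mul (4 * Real.pi)).rpow_const (p := -(d : ℝ) / 2)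
      (Or.inl hp.ne')
    convert! this using 1
    simp only [id_eq, heatFactor]
    rw [Real.rpow_sub_one hp.ne']
    field_simp
  refine (((h4.mul h3).mul h2).congr_of_eventuallyEq ?_).congr_deriv ?_
  · filter_upwards [lt_mem_nhds ht] with s hs
    exact heatFlow_eq hs.ne' g x
  · rw [heatFlow_eq ht.ne', heatFlow_eq ht.ne', heatFlow_eq ht.ne',
      expoInt_smulRight_apply hg hq]
    have h5 : expoInt (fun y ↦ expoLin y ((-(1 / (2 * t ^ 2))) • x, 1 / (4 * t ^ 2)) * g y)
        (heatParam t x) = 1 / (4 * t ^ 2) * (expoInt (fun y ↦ ‖y‖ ^ 2 * g y) (heatParam t x) -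
          2 * expoInt (fun y ↦ inner ℝ y x * g y) (heatParam t x)) := by
      have i1 := hg.sq_mul.integrable_expo hq
      have i2 := (hg.inner_mul x).integrable_expo hq
      rw [expoInt, expoInt, expoInt, ← integral_const_mul, ← integral_sub i1 (i2.const_mul 2),
        ← integral_const_mul]
      congr 1 with y
      simp only [expoLin_apply, inner_smul_right, smul_eq_mul]
      field_simp
      ring
    rw [h5]
    simp only [Pi.mul_apply, Function.comp_apply]
    ring

lemma heatFlow_finsetSum {ι : Type*} (s : Finset ι) {g : ι → Space d → ℝ}
    (hg : ∀ i, Moderate (g i)) {t : ℝ} (ht : 0 < t) (x : Space d) :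
    ∑ i ∈ s, heatFlow (g i) t x = heatFlow (fun y ↦ ∑ i ∈ s, g i y) t x := by
  simp_rw [heatFlow]
  rw [← integral_finsetSum _ fun i _ ↦ (hg i).integrable_heatKernel ht x]
  simp_rw [Finset.mul_sum]

/-- The heat equation. -/
lemma Moderate.deriv_heatFlow {g : Space d → ℝ} (hg : Moderate g) {t : ℝ} (ht : 0 < t)
    (x : Space d) :
    deriv (fun s ↦ heatFlow g s x) t = Laplacian.laplacian (heatFlow g t) x := by
  set b := EuclideanSpace.basisFun (Fin d) ℝ with hb
  have fd (g : Space d → ℝ) (hg : Moderate g) (z e : Space d) : fderiv ℝ (heatFlow g t) z e =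
      1 / (2 * t) * (heatFlow (fun y ↦ inner ℝ y e * g y) t z - inner ℝ z e * heatFlow g t z) := by
    obtain ⟨A, hA, hAe⟩ := hg.hasFDerivAt_heatFlow ht z
    rw [hA.fderiv, hAe]
  have df (g : Space d → ℝ) (hg : Moderate g) : Differentiable ℝ (heatFlow g t) := fun z ↦ by
    obtain ⟨A, hA, -⟩ := hg.hasFDerivAt_heatFlow ht z
    exact hA.differentiableAt
  have cd : ContDiff ℝ 2 (heatFlow g t) := by
    rw [← contDiffOn_univ]
    refine (contDiffOn_infty.1 hg.contDiffOn_heatFlow 2).comp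
      (f := fun z : Space d ↦ (z, t)) (by fun_prop) fun z _ ↦ ⟨mem_univ _, ht⟩
  have dd : Differentiable ℝ (fderiv ℝ (heatFlow g t)) :=
    (cd.fderiv_right (m := 1) (by norm_num)).differentiable (by norm_num)
  have second (e : Space d) : iteratedFDeriv ℝ 2 (heatFlow g t) x ![e, e] =
      1 / (4 * t ^ 2) * (heatFlow (fun y ↦ inner ℝ y e * (inner ℝ y e * g y)) t x -
        2 * (inner ℝ x e * heatFlow (fun y ↦ inner ℝ y e * g y) t x) +
          inner ℝ x e ^ 2 * heatFlow g t x) - inner ℝ e e / (2 * t) * heatFlow g t x := by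
    rw [iteratedFDeriv_two_apply]
    simp only [Matrix.cons_val_zero, Matrix.cons_val_one]
    have h1 : fderiv ℝ (fderiv ℝ (heatFlow g t)) x e e =
        fderiv ℝ (fun z ↦ fderiv ℝ (heatFlow g t) z e) x e := by
      rw [fderiv_clm_apply (dd x) (by fun_prop)]
      simp
    rw [h1]
    simp_rw [fd g hg]
    have hi : DifferentiableAt ℝ (fun z : Space d ↦ (inner ℝ z e : ℝ)) x :=
      differentiableAt_id.inner ℝ (differentiableAt_const e)
    rw [fderiv_const_mul (((df _ (hg.inner_mul e)) x).fun_sub (hi.fun_mul (df g hg x))),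
      fderiv_fun_sub ((df _ (hg.inner_mul e)) x) (hi.fun_mul (df g hg x)),
      fderiv_fun_mul hi (df g hg x)]
    have h2 : fderiv ℝ (fun z : Space d ↦ (inner ℝ z e : ℝ)) x e = inner ℝ e e := by
      rw [fderiv_inner_apply _ (by fun_prop) (by fun_prop)]
      simp
    simp only [smul_apply, sub_apply,
      add_apply, smul_eq_mul, fd _ (hg.inner_mul e), fd g hg, h2]
    field_simp
    ring
  rw [(hg.hasDerivAt_heatFlow ht x).deriv,
    InnerProductSpace.laplacian_eq_iteratedFDeriv_orthonormalBasis _ b]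
  simp_rw [second]
  rw [Finset.sum_sub_distrib, ← Finset.mul_sum, Finset.sum_add_distrib, Finset.sum_sub_distrib,
    ← Finset.mul_sum, ← Finset.sum_mul]
  -- Summing the second derivatives over an orthonormal basis, Parseval's identity turns the three
  -- kinds of terms into those of the time derivative.
  have s1 : ∑ i, heatFlow (fun y ↦ inner ℝ y (b i) * (inner ℝ y (b i) * g y)) t x =
      heatFlow (fun y ↦ ‖y‖ ^ 2 * g y) t x := by
    rw [heatFlow_finsetSum _ (fun i ↦ (hg.inner_mul _).inner_mul _) ht]
    congr 1 with y
    rw [← b.sum_sq_inner_left y, Finset.sum_mul]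
    refine Finset.sum_congr rfl fun i _ ↦ ?_
    ring
  have s2 : ∑ i, inner ℝ x (b i) * heatFlow (fun y ↦ inner ℝ y (b i) * g y) t x =
      heatFlow (fun y ↦ inner ℝ y x * g y) t x := by
    have (i : Fin d) : inner ℝ x (b i) * heatFlow (fun y ↦ inner ℝ y (b i) * g y) t x =
        heatFlow (fun y ↦ inner ℝ y (inner ℝ x (b i) • b i) * g y) t x := by
      rw [heatFlow, heatFlow, ← integral_const_mul]
      congr 1 with y
      rw [inner_smul_right]
      ring
    simp_rw [this]
    rw [heatFlow_finsetSum _ (fun i ↦ hg.inner_mul _) ht]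
    congr 1 with y
    rw [← Finset.sum_mul, ← inner_sum]
    congr 2
    simpa only [real_inner_comm x] using b.sum_repr' x
  rw [s1, s2, b.sum_sq_inner_left x]
  have s3 : ∑ i, inner ℝ (b i) (b i) / (2 * t) * heatFlow g t x = d / (2 * t) * heatFlow g t x := by
    simp [b.orthonormal.1]
    ring
  rw [s3]

end HeatFlow

/-! ### Chapman–Kolmogorov and the semigroup property -/

section Semigroup

variable {d : ℕ}

lemma continuous_heatKernel (t : ℝ) : Continuous (heatKernel t : Space d → ℝ) := by
  unfold heatKernel
  fun_prop

lemma heatKernel_pos {t : ℝ} (ht : 0 < t) (x : Space d) : 0 < heatKernel t x := by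
  unfold heatKernel
  positivity

lemma heatKernel_sub_comm (t : ℝ) (x y : Space d) : heatKernel t (x - y) = heatKernel t (y - x) := by
  simp_rw [heatKernel, norm_sub_rev]

lemma heatKernel_eq_exp (t : ℝ) (x : Space d) :
    heatKernel t x = heatFactor d t * Real.exp (-(1 / (4 * t)) * ‖x‖ ^ 2) := by
  rw [heatKernel, heatFactor]
  congr 2
  ring

lemma integrable_heatKernel {t : ℝ} (ht : 0 < t) : Integrable (heatKernel t : Space d → ℝ) := by
  simp_rw [funext (heatKernel_eq_exp (d := d) t)]
  refine Integrable.const_mul ?_ _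
  refine Integrable.of_integral_ne_zero ?_
  rw [GaussianFourier.integral_rexp_neg_mul_sq_norm (by positivity)]
  positivity

lemma integral_heatKernel {t : ℝ} (ht : 0 < t) : ∫ x : Space d, heatKernel t x = 1 := by
  simp_rw [heatKernel_eq_exp]
  rw [integral_const_mul, GaussianFourier.integral_rexp_neg_mul_sq_norm (by positivity),
    heatFactor, finrank_euclideanSpace_fin, show Real.pi / (1 / (4 * t)) = 4 * Real.pi * t by
      field_simp, ← Real.rpow_add (by positivity)]
  ring_nf
  simp

/-- Completing the square in y: the second factor is a heat kernel in y centered at the bridge mean,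
hence of mass 1, which makes the Chapman–Kolmogorov integral immediate. -/
lemma heatKernel_mul {s t : ℝ} (hs : 0 < s) (ht : 0 < t) (x y z : Space d) :
    heatKernel s (x - y) * heatKernel t (y - z) = heatKernel (s + t) (x - z) *
      heatKernel (s * t / (s + t)) (y - ((t / (s + t)) • x + (s / (s + t)) • z)) := by
  have hst : 0 < s + t := by positivity
  have key : ‖y - ((t / (s + t)) • x + (s / (s + t)) • z)‖ ^ 2 =
      t / (s + t) * ‖x - y‖ ^ 2 + s / (s + t) * ‖y - z‖ ^ 2 -
        s * t / (s + t) ^ 2 * ‖x - z‖ ^ 2 := by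
    have e : y - ((t / (s + t)) • x + (s / (s + t)) • z) =
        (s / (s + t)) • (y - z) - (t / (s + t)) • (x - y) := by
      have : y = (s / (s + t) + t / (s + t)) • y := by
        rw [← add_div, div_self hst.ne', one_smul]
      nth_rewrite 1 [this]
      module
    have e2 : x - z = (x - y) + (y - z) := by abel
    rw [e, e2, norm_sub_sq_real, norm_add_sq_real, norm_smul, norm_smul, inner_smul_left,
      inner_smul_right, real_inner_comm (x - y), Real.norm_of_nonneg (by positivity),
      Real.norm_of_nonneg (by positivity)]
    simp only [conj_trivial]
    field_simp
    ring
  simp only [heatKernel]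
  rw [mul_mul_mul_comm, mul_mul_mul_comm (_ ^ _) (Real.exp (-‖x - z‖ ^ 2 / _)), ← Real.exp_add, ← Real.exp_add,
    ← Real.mul_rpow (by positivity) (by positivity),
    ← Real.mul_rpow (by positivity) (by positivity), key]
  congr 2
  · field_simp
  · field_simp
    ring

/-- The Chapman–Kolmogorov identity. -/
lemma integral_heatKernel_mul {s t : ℝ} (hs : 0 < s) (ht : 0 < t) (x z : Space d) :
    Integrable (fun y ↦ heatKernel s (x - y) * heatKernel t (y - z)) ∧
      ∫ y, heatKernel s (x - y) * heatKernel t (y - z) = heatKernel (s + t) (x - z) := by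
  have h : 0 < s * t / (s + t) := by positivity
  simp_rw [heatKernel_mul hs ht x _ z]
  refine ⟨((integrable_heatKernel h).comp_sub_right _).const_mul _, ?_⟩
  rw [integral_const_mul, integral_sub_right_eq_self (heatKernel (s * t / (s + t))),
    integral_heatKernel h, mul_one]

lemma Moderate.integrable_prod_heatKernel {g : Space d → ℝ} (hg : Moderate g) {s t : ℝ}
    (hs : 0 < s) (ht : 0 < t) (x : Space d) :
    Integrable (fun p : Space d × Space d ↦
      heatKernel s (x - p.1) * heatKernel t (p.1 - p.2) * g p.2) (volume.prod volume) := by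
  have hc : Continuous fun p : Space d × Space d ↦
      heatKernel s (x - p.1) * heatKernel t (p.1 - p.2) :=
    ((continuous_heatKernel s).comp (by fun_prop)).mul ((continuous_heatKernel t).comp (by fun_prop))
  have hm : AEStronglyMeasurable (fun p : Space d × Space d ↦ heatKernel s (x - p.1) *
      heatKernel t (p.1 - p.2) * g p.2) (volume.prod volume) :=
    hc.aestronglyMeasurable.mul hg.aestronglyMeasurable.comp_snd
  rw [integrable_prod_iff' hm]
  refine ⟨.of_forall fun z ↦ ?_, ?_⟩
  · exact (integral_heatKernel_mul hs ht x z).1.mul_const (g z)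
  refine (hg.integrable_heatKernel (add_pos hs ht) x).norm.congr (.of_forall fun z ↦ ?_)
  dsimp only
  simp_rw [norm_mul, Real.norm_of_nonneg (heatKernel_pos hs _).le,
    Real.norm_of_nonneg (heatKernel_pos ht _).le,
    Real.norm_of_nonneg (heatKernel_pos (add_pos hs ht) _).le]
  rw [integral_mul_const, (integral_heatKernel_mul hs ht x z).2]

/-- The semigroup property. -/
lemma Moderate.heatFlow_add {g : Space d → ℝ} (hg : Moderate g) {s t : ℝ}
    (hs : 0 < s) (ht : 0 < t) (x : Space d) :
    Integrable (fun y ↦ heatKernel s (x - y) * heatFlow g t y) ∧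
      heatFlow g (s + t) x = ∫ y, heatKernel s (x - y) * heatFlow g t y := by
  have h := hg.integrable_prod_heatKernel hs ht x
  have e (y : Space d) : ∫ z, heatKernel s (x - y) * heatKernel t (y - z) * g z =
      heatKernel s (x - y) * heatFlow g t y := by
    simp_rw [heatFlow, mul_assoc, integral_const_mul]
  constructor
  · exact h.integral_prod_left.congr (.of_forall e)
  · simp_rw [← e]
    rw [integral_integral_swap h, heatFlow]
    congr 1 with z
    rw [integral_mul_const, (integral_heatKernel_mul hs ht x z).2]

end Semigroup

/-! ### Weighted L² slices of the heat flow -/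

section Weighted

variable {d : ℕ}

/-- A polynomial weight. -/
def polyWeight (y : Space d) : ℝ := (1 + ‖y‖ ^ 2) ^ (d + 1)

lemma polyWeight_pos (y : Space d) : 0 < polyWeight y := by
  unfold polyWeight
  positivity

lemma continuous_polyWeight : Continuous (polyWeight : Space d → ℝ) := by
  unfold polyWeight
  fun_prop

lemma Moderate.polyWeight_pow_mul {g : Space d → ℝ} (hg : Moderate g) (n : ℕ) :
    Moderate fun y ↦ polyWeight y ^ n * g y := by
  simp_rw [polyWeight, ← pow_mul]
  induction (d + 1) * n with
  | zero => simpa using hg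
  | succ k ih =>
    refine ih.mono (C := 1) ?_ fun y ↦ ?_
    · exact (by fun_prop : Continuous fun y : Space d ↦
        (1 + ‖y‖ ^ 2) ^ (k + 1)).aestronglyMeasurable.mul hg.aestronglyMeasurable
    · rw [pow_succ', mul_assoc, norm_mul, one_mul, Real.norm_of_nonneg (by positivity)]

lemma MemLp.moderate {g : Space d → ℝ} (hg : MemLp g 2) : Moderate g := by
  intro c hc
  refine MemLp.integrable_mul (p := 2) (q := 2) ?_ hg
  rw [memLp_two_iff_integrable_sq (by fun_prop : Continuous fun y : Space d ↦
    Real.exp (-c * ‖y‖ ^ 2)).aestronglyMeasurable]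
  refine (?_ : Integrable fun y : Space d ↦ Real.exp (-(2 * c) * ‖y‖ ^ 2)).congr
    (.of_forall fun y ↦ ?_)
  · refine Integrable.of_integral_ne_zero ?_
    rw [GaussianFourier.integral_rexp_neg_mul_sq_norm (by positivity)]
    positivity
  · dsimp only
    rw [← Real.exp_nat_mul]
    congr 1
    push_cast
    ring

lemma moderate_one : Moderate fun _ : Space d ↦ (1 : ℝ) := by
  intro c hc
  simp_rw [smul_eq_mul, mul_one]
  refine Integrable.of_integral_ne_zero ?_
  rw [GaussianFourier.integral_rexp_neg_mul_sq_norm hc]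
  positivity

lemma heatKernel_le {t : ℝ} (ht : 0 < t) (x : Space d) : heatKernel t x ≤ heatFactor d t := by
  rw [heatKernel_eq_exp]
  refine mul_le_of_le_one_right (by unfold heatFactor; positivity) ?_
  rw [Real.exp_le_one_iff, neg_mul, neg_nonpos]
  positivity

/-- The kernel is bounded, so its square is at most a constant times the kernel, which is integrable
against polynomial weights. -/
lemma memLp_heatKernel_polyWeight {t : ℝ} (ht : 0 < t) (x : Space d) (n : ℕ) :
    MemLp (fun y ↦ heatKernel t (x - y) * polyWeight y ^ n) 2 := by
  have hc : Continuous fun y : Space d ↦ heatKernel t (x - y) * polyWeight y ^ n :=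
    ((continuous_heatKernel t).comp (by fun_prop)).mul (continuous_polyWeight.pow n)
  rw [memLp_two_iff_integrable_sq hc.aestronglyMeasurable]
  have h := ((moderate_one (d := d)).polyWeight_pow_mul (n * 2)).integrable_heatKernel ht x
  refine (h.const_mul (heatFactor d t)).mono' (hc.pow 2).aestronglyMeasurable
    (.of_forall fun y ↦ ?_)
  have hk := heatKernel_pos ht (x - y)
  have hw := polyWeight_pos y
  rw [Real.norm_of_nonneg (by positivity), mul_pow, ← pow_mul, sq, mul_one, mul_assoc]
  gcongr
  exact heatKernel_le ht _

/-- The function `K_t(x - ·)` times a power of the weight, as an element of `L²`. -/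
def heatLp {t : ℝ} (ht : 0 < t) (x : Space d) (n : ℕ) : Lp ℝ 2 (volume : Measure (Space d)) :=
  (memLp_heatKernel_polyWeight ht x n).toLp _

lemma inner_heatLp {t : ℝ} (ht : 0 < t) (x : Space d) (n : ℕ)
    (f : Lp ℝ 2 (volume : Measure (Space d))) :
    inner ℝ (heatLp ht x n) f = heatFlow (fun y ↦ polyWeight y ^ n * f y) t x := by
  rw [L2.inner_def, heatFlow]
  refine integral_congr_ae ?_
  filter_upwards [(memLp_heatKernel_polyWeight ht x n).coeFn_toLp] with y hy
  rw [heatLp, hy, RCLike.inner_apply, conj_trivial]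
  ring

lemma inner_heatLp_heatLp {s t : ℝ} (hs : 0 < s) (ht : 0 < t) (x z : Space d) :
    inner ℝ (heatLp ht x 0) (heatLp hs z 0) = heatKernel (s + t) (x - z) := by
  rw [inner_heatLp, heatFlow, add_comm, ← (integral_heatKernel_mul ht hs x z).2]
  refine integral_congr_ae ?_
  filter_upwards [(memLp_heatKernel_polyWeight hs z 0).coeFn_toLp] with y hy
  rw [heatLp, hy, heatKernel_sub_comm s z y]
  ring

lemma memLp_inv_polyWeight : MemLp (fun y : Space d ↦ (polyWeight y)⁻¹) 2 := by
  have hc : Continuous fun y : Space d ↦ (polyWeight y)⁻¹ :=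
    continuous_polyWeight.inv₀ fun y ↦ (polyWeight_pos y).ne'
  rw [memLp_two_iff_integrable_sq hc.aestronglyMeasurable]
  refine (integrable_rpow_neg_one_add_norm_sq (E := Space d) (μ := volume)
    (r := 4 * (d + 1)) ?_).congr (.of_forall fun y ↦ ?_)
  · rw [finrank_euclideanSpace_fin]
    linarith [(Nat.cast_nonneg d : (0 : ℝ) ≤ d)]
  · dsimp only
    rw [polyWeight, inv_pow, ← pow_mul, ← Real.rpow_natCast (1 + _), ← Real.rpow_neg (by positivity)]
    congr 1
    push_cast
    ring

/-- Cauchy–Schwarz, with ‖K_t(x - ·)‖² = K_{2t}(0) independent of x. A bounded slice divided by the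
weight is in L². -/
lemma abs_heatFlow_le {t : ℝ} (ht : 0 < t) (f : Lp ℝ 2 (volume : Measure (Space d)))
    (x : Space d) : ‖heatFlow f t x‖ ≤ √(heatKernel (t + t) (0 : Space d)) * ‖f‖ := by
  have h := norm_inner_le_norm (𝕜 := ℝ) (heatLp ht x 0) f
  rw [inner_heatLp, norm_eq_sqrt_real_inner (heatLp ht x 0), inner_heatLp_heatLp, sub_self] at h
  simpa using h

lemma moderate_coeFn (f : Lp ℝ 2 (volume : Measure (Space d))) : Moderate f :=
  MemLp.moderate (Lp.memLp f)

lemma continuous_heatFlow {g : Space d → ℝ} (hg : Moderate g) {t : ℝ} (ht : 0 < t) :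
    Continuous (heatFlow g t) :=
  continuous_iff_continuousAt.2 fun x ↦ by
    obtain ⟨A, hA, -⟩ := hg.hasFDerivAt_heatFlow ht x
    exact hA.continuousAt

lemma memLp_weighted_heatFlow {t : ℝ} (ht : 0 < t) (f : Lp ℝ 2 (volume : Measure (Space d))) :
    MemLp (fun y ↦ (polyWeight y)⁻¹ * heatFlow f t y) 2 := by
  refine (memLp_inv_polyWeight.const_mul (√(heatKernel (t + t) (0 : Space d)) * ‖f‖)).mono' ?_
    (.of_forall fun y ↦ ?_)
  · exact memLp_inv_polyWeight.aestronglyMeasurable.mul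
      (continuous_heatFlow (moderate_coeFn f) ht).aestronglyMeasurable
  · rw [norm_mul, Real.norm_of_nonneg (inv_nonneg.2 (polyWeight_pos y).le), mul_comm]
    gcongr
    · exact inv_nonneg.2 (polyWeight_pos y).le
    · exact abs_heatFlow_le ht f y

/-- The heat flow at time `t` divided by the weight, as an element of `L²`. -/
def sliceLp {t : ℝ} (ht : 0 < t) (f : Lp ℝ 2 (volume : Measure (Space d))) :
    Lp ℝ 2 (volume : Measure (Space d)) := (memLp_weighted_heatFlow ht f).toLp _

/-- The weights cancel and the semigroup property remains: flowing for time s from the slice at time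
t recovers the flow at s + t. -/
lemma inner_heatLp_sliceLp {s t : ℝ} (hs : 0 < s) (ht : 0 < t)
    (f : Lp ℝ 2 (volume : Measure (Space d))) (x : Space d) :
    inner ℝ (heatLp hs x 1) (sliceLp ht f) = inner ℝ (heatLp (add_pos hs ht) x 0) f := by
  rw [inner_heatLp, inner_heatLp]
  simp_rw [pow_zero, one_mul, pow_one]
  rw [((moderate_coeFn f).heatFlow_add hs ht x).2, heatFlow]
  refine integral_congr_ae ?_
  filter_upwards [(memLp_weighted_heatFlow ht f).coeFn_toLp] with y hy
  rw [sliceLp, hy, mul_inv_cancel_left₀ (polyWeight_pos y).ne']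

/-- Bessel's inequality for K_t(y - ·) bounds the sum of squares at each y by K_{2t}(0), and the
squared inverse weight is integrable. This is the Hilbert–Schmidt property behind the Gaussian
series. -/
lemma summable_norm_sq_sliceLp {t : ℝ} (ht : 0 < t) {ι : Type*}
    {e : ι → Lp ℝ 2 (volume : Measure (Space d))} (he : Orthonormal ℝ e) :
    Summable fun i ↦ ‖sliceLp ht (e i)‖ ^ 2 := by
  have hn (i : ι) : ‖sliceLp ht (e i)‖ ^ 2 =
      ∫ y, ((polyWeight y)⁻¹ * heatFlow (e i) t y) ^ 2 := by
    rw [← real_inner_self_eq_norm_sq, L2.inner_def]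
    refine integral_congr_ae ?_
    filter_upwards [(memLp_weighted_heatFlow ht (e i)).coeFn_toLp] with y hy
    rw [sliceLp, hy, real_inner_self_eq_norm_sq, Real.norm_eq_abs, sq_abs]
  refine summable_of_sum_le (c := ∫ y : Space d, (polyWeight y)⁻¹ ^ 2 *
    heatKernel (t + t) (0 : Space d)) (fun i ↦ by positivity) fun s ↦ ?_
  simp_rw [hn]
  rw [← integral_finsetSum _ fun i _ ↦ (memLp_weighted_heatFlow ht (e i)).integrable_sq]
  refine integral_mono (integrable_finsetSum _ fun i _ ↦
    (memLp_weighted_heatFlow ht (e i)).integrable_sq)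
    (memLp_inv_polyWeight.integrable_sq.mul_const _) fun y ↦ ?_
  dsimp only
  simp_rw [mul_pow]
  rw [← Finset.mul_sum]
  gcongr
  have h := he.sum_inner_products_le (x := heatLp ht y 0) (s := s)
  rw [← real_inner_self_eq_norm_sq (heatLp ht y 0), inner_heatLp_heatLp, sub_self] at h
  refine le_of_eq_of_le (Finset.sum_congr rfl fun i _ ↦ ?_) h
  rw [real_inner_comm, inner_heatLp, Real.norm_eq_abs, sq_abs]
  simp

end Weighted

/-! ### Centered Gaussian variables are closed in L² -/

section ClosedGaussian

variable {Ω : Type*} {mΩ : MeasurableSpace Ω} {P : Measure Ω}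

/-- Convergence in L² implies convergence in measure, hence in distribution. -/
lemma continuous_charFun_map [IsProbabilityMeasure P] (u : ℝ) :
    Continuous fun X : Lp ℝ 2 P ↦ charFun (P.map X) u := by
  refine continuous_iff_seqContinuous.2 fun X Y h ↦ ?_
  have h1 := (tendstoInMeasure_of_tendsto_Lp h).tendstoInDistribution
    fun n ↦ (Lp.aestronglyMeasurable (X n)).aemeasurable
  exact ProbabilityMeasure.tendsto_iff_tendsto_charFun.1 h1.tendsto u

lemma isClosed_charFun_map_eq [IsProbabilityMeasure P] :
    IsClosed {X : Lp ℝ 2 P | ∀ u : ℝ,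
      charFun (P.map X) u = Complex.exp (-(u ^ 2 * ‖X‖ ^ 2 / 2 : ℝ))} := by
  simp_rw [Set.ofPred_forall]
  exact isClosed_iInter fun u ↦ isClosed_eq (continuous_charFun_map u) (by fun_prop)

lemma variance_coeFn_eq_norm_sq {X : Lp ℝ 2 P} (h0 : ∫ ω, X ω ∂P = 0) :
    Var[X; P] = ‖X‖ ^ 2 := by
  rw [variance_of_integral_eq_zero (Lp.aestronglyMeasurable X).aemeasurable h0,
    ← real_inner_self_eq_norm_sq, L2.inner_def]
  simp [sq]

lemma charFun_map_of_gaussian {X : Lp ℝ 2 P} (hX : HasGaussianLaw X P) (h0 : ∫ ω, X ω ∂P = 0)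
    (u : ℝ) : charFun (P.map X) u = Complex.exp (-(u ^ 2 * ‖X‖ ^ 2 / 2 : ℝ)) := by
  rw [hX.map_eq_gaussianReal, h0, variance_coeFn_eq_norm_sq h0, charFun_gaussianReal]
  congr 1
  rw [Real.coe_toNNReal _ (by positivity)]
  push_cast
  ring

lemma map_eq_gaussianReal_of_charFun [IsProbabilityMeasure P] {X : Lp ℝ 2 P}
    (h : ∀ u : ℝ, charFun (P.map X) u = Complex.exp (-(u ^ 2 * ‖X‖ ^ 2 / 2 : ℝ))) :
    P.map X = gaussianReal 0 (‖X‖ ^ 2).toNNReal := by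
  have := Measure.isProbabilityMeasure_map (μ := P) (Lp.aestronglyMeasurable X).aemeasurable
  refine Measure.ext_of_charFun (funext fun u ↦ ?_)
  rw [h, charFun_gaussianReal]
  congr 1
  rw [Real.coe_toNNReal _ (by positivity)]
  push_cast
  ring

/-- Cramér–Wold: the characteristic functional of X at L is the characteristic function of L ∘ X at
1. -/
lemma hasGaussianLaw_of_forall_dual [IsProbabilityMeasure P] {E : Type*} [NormedAddCommGroup E] [NormedSpace ℝ E]
    [MeasurableSpace E] [BorelSpace E] [CompleteSpace E] [SecondCountableTopology E] {X : Ω → E}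
    (hX : AEMeasurable X P)
    (h : ∀ L : StrongDual ℝ E, HasGaussianLaw (fun ω ↦ L (X ω)) P) : HasGaussianLaw X P := by
  rw [hasGaussianLaw_iff_charFunDual_map_eq hX]
  intro L
  have h1 := (h L).charFun_map_eq 1
  rw [charFunDual_eq_charFun_map_one, AEMeasurable.map_map_of_aemeasurable (by fun_prop) hX]
  simpa [Function.comp_def] using h1

end ClosedGaussian

/-! ### The isonormal process and Hilbert-space valued Gaussian series -/

section Isonormal

variable {ι : Type*} {H : Type*} [NormedAddCommGroup H] [InnerProductSpace ℝ H]

/-- The law of independent standard Gaussian variables indexed by `ι`. -/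
abbrev stdGauss (ι : Type*) : Measure (ι → ℝ) := Measure.infinitePi fun _ ↦ gaussianReal 0 1

lemma map_eval_stdGauss (i : ι) : (stdGauss ι).map (fun ω ↦ ω i) = gaussianReal 0 1 :=
  Measure.infinitePi_map_eval _ i

lemma hasGaussianLaw_eval_stdGauss (i : ι) : HasGaussianLaw (fun ω ↦ ω i) (stdGauss ι) :=
  ⟨by rw [map_eval_stdGauss]; infer_instance⟩

lemma integral_eval_stdGauss (i : ι) : ∫ ω, ω i ∂stdGauss ι = 0 := by
  have h := integral_map (μ := stdGauss ι) (φ := fun ω ↦ ω i)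
    (measurable_pi_apply i).aemeasurable
    (f := fun x : ℝ ↦ x) (by fun_prop)
  rw [← h, map_eval_stdGauss, integral_id_gaussianReal]

lemma memLp_eval_stdGauss (i : ι) : MemLp (fun ω ↦ ω i) 2 (stdGauss ι) :=
  (hasGaussianLaw_eval_stdGauss i).memLp_two

lemma iIndepFun_eval_stdGauss : iIndepFun (fun (i : ι) (ω : ι → ℝ) ↦ ω i) (stdGauss ι) :=
  iIndepFun_infinitePi (X := fun _ x ↦ x) (by fun_prop)

/-- The coordinates as elements of `L²`. -/
def coordLp (i : ι) : Lp ℝ 2 (stdGauss ι) := (memLp_eval_stdGauss i).toLp _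

lemma coeFn_coordLp (i : ι) : coordLp i =ᵐ[stdGauss ι] fun ω ↦ ω i :=
  (memLp_eval_stdGauss i).coeFn_toLp

lemma integral_coordLp (i : ι) : ∫ ω, coordLp i ω ∂stdGauss ι = 0 := by
  rw [integral_congr_ae (coeFn_coordLp i), integral_eval_stdGauss]

lemma orthonormal_coordLp : Orthonormal ℝ (coordLp : ι → Lp ℝ 2 (stdGauss ι)) := by
  constructor
  · intro i
    have h : ‖coordLp i‖ ^ 2 = 1 := by
      rw [← variance_coeFn_eq_norm_sq (integral_coordLp i), variance_congr (coeFn_coordLp i)]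
      have h2 := variance_map (μ := stdGauss ι) (Y := fun ω ↦ ω i) (X := id) (by fun_prop)
        (measurable_pi_apply i).aemeasurable
      rw [map_eval_stdGauss] at h2
      simpa [Function.comp_def] using h2.symm
    exact (pow_eq_one_iff_of_nonneg (norm_nonneg _) two_ne_zero).1 h
  · intro i j hij
    rw [L2.inner_def]
    have h1 : ∫ ω, inner ℝ (coordLp i ω) (coordLp j ω) ∂stdGauss ι =
        ∫ ω, ω i * ω j ∂stdGauss ι := by
      refine integral_congr_ae ?_
      filter_upwards [coeFn_coordLp i, coeFn_coordLp j] with ω h1 h2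
      rw [h1, h2, RCLike.inner_apply, conj_trivial, mul_comm]
    rw [h1]
    have h2 := (iIndepFun_eval_stdGauss.indepFun hij).integral_fun_mul_eq_mul_integral
      (memLp_eval_stdGauss i).aestronglyMeasurable (memLp_eval_stdGauss j).aestronglyMeasurable
    rw [h2, integral_eval_stdGauss, zero_mul]

/-- The isonormal Gaussian process associated with a Hilbert basis. -/
def isonormal (e : HilbertBasis ι ℝ H) : H →ₗᵢ[ℝ] Lp ℝ 2 (stdGauss ι) :=
  (orthonormal_coordLp (ι := ι)).orthogonalFamily.linearIsometry.comp e.repr.toLinearIsometry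

lemma hasSum_isonormal (e : HilbertBasis ι ℝ H) (h : H) :
    HasSum (fun i ↦ (inner ℝ (e i) h : ℝ) • coordLp i) (isonormal e h) := by
  have := (orthonormal_coordLp (ι := ι)).orthogonalFamily.hasSum_linearIsometry (e.repr h)
  simp only [e.repr_apply_apply, LinearIsometry.toSpanSingleton_apply] at this
  exact this

lemma coeFn_sum_coordLp (s : Finset ι) (a : ι → ℝ) :
    (∑ i ∈ s, a i • coordLp i : Lp ℝ 2 (stdGauss ι)) =ᵐ[stdGauss ι]
      fun ω ↦ ∑ i ∈ s, a i * ω i := by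
  classical
  induction s using Finset.induction_on with
  | empty =>
    simp only [Finset.sum_empty]
    exact Lp.coeFn_zero ..
  | insert j s hj ih =>
    simp only [Finset.sum_insert hj]
    filter_upwards [Lp.coeFn_add (a j • coordLp j) (∑ i ∈ s, a i • coordLp i), ih,
      Lp.coeFn_smul (a j) (coordLp j), coeFn_coordLp j] with ω h1 h2 h3 h4
    rw [h1, Pi.add_apply, h2, h3, Pi.smul_apply, h4, smul_eq_mul]

/-- Finite partial sums of the series are Gaussian by independence, and the condition on the
characteristic function is closed in L². -/
lemma charFun_map_isonormal (e : HilbertBasis ι ℝ H) (h : H) (u : ℝ) :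
    charFun ((stdGauss ι).map (isonormal e h)) u =
      Complex.exp (-(u ^ 2 * ‖isonormal e h‖ ^ 2 / 2 : ℝ)) := by
  have hc := isClosed_charFun_map_eq (P := stdGauss ι)
  refine hc.mem_of_tendsto (hasSum_isonormal e h) (.of_forall fun s ↦ ?_) u
  set a : ι → ℝ := fun i ↦ inner ℝ (e i) h
  have ha := coeFn_sum_coordLp s a
  refine charFun_map_of_gaussian (HasGaussianLaw.congr ?_ ha.symm) ?_
  · simp_rw [fun ω : ι → ℝ ↦ (Finset.sum_coe_sort s fun i ↦ a i * ω i).symm]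
    refine iIndepFun.hasGaussianLaw_fun_sum (X := fun (i : s) (ω : ι → ℝ) ↦ a i * ω i)
      (fun i ↦ (hasGaussianLaw_eval_stdGauss (i : ι)).fun_smul (a i)) ?_
    exact (iIndepFun_eval_stdGauss.precomp Subtype.val_injective).comp
      (fun (i : s) x ↦ a i * x) (by fun_prop)
  · rw [integral_congr_ae ha, integral_finsetSum _ fun i _ ↦
      ((memLp_eval_stdGauss i).integrable one_le_two).const_mul _]
    simp [integral_const_mul, integral_eval_stdGauss]

lemma hasGaussianLaw_isonormal (e : HilbertBasis ι ℝ H) (h : H) :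
    HasGaussianLaw (isonormal e h) (stdGauss ι) :=
  ⟨by rw [map_eq_gaussianReal_of_charFun (charFun_map_isonormal e h)]; infer_instance⟩

lemma integral_isonormal (e : HilbertBasis ι ℝ H) (h : H) :
    ∫ ω, isonormal e h ω ∂stdGauss ι = 0 := by
  have h1 := integral_map (μ := stdGauss ι) (φ := isonormal e h)
    (Lp.aestronglyMeasurable _).aemeasurable (f := fun x : ℝ ↦ x) (by fun_prop)
  rw [← h1, map_eq_gaussianReal_of_charFun (charFun_map_isonormal e h), integral_id_gaussianReal]

lemma covariance_isonormal (e : HilbertBasis ι ℝ H) (h k : H) :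
    cov[isonormal e h, isonormal e k; stdGauss ι] = inner ℝ h k := by
  rw [covariance_eq_sub (Lp.memLp _) (Lp.memLp _), integral_isonormal, zero_mul, sub_zero,
    ← (isonormal e).inner_map_map, L2.inner_def]
  refine integral_congr_ae (.of_forall fun ω ↦ ?_)
  simp [mul_comm]

lemma coeFn_sum_isonormal (e : HilbertBasis ι ℝ H) {T : Type*} (s : Finset T) (a : T → ℝ)
    (k : T → H) : isonormal e (∑ t ∈ s, a t • k t) =ᵐ[stdGauss ι]
      fun ω ↦ ∑ t ∈ s, a t * isonormal e (k t) ω := by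
  classical
  induction s using Finset.induction_on with
  | empty =>
    simp only [Finset.sum_empty, map_zero]
    exact Lp.coeFn_zero ..
  | insert j s hj ih =>
    simp only [Finset.sum_insert hj, map_add, map_smul] at ih ⊢
    filter_upwards [Lp.coeFn_add (a j • isonormal e (k j)) (isonormal e (∑ i ∈ s, a i • k i)), ih,
      Lp.coeFn_smul (a j) (isonormal e (k j))] with ω h1 h2 h3
    rw [h1, Pi.add_apply, h2, h3, Pi.smul_apply, smul_eq_mul]

/-- By linearity, a linear functional of finitely many values is almost surely the value at one
vector of H, hence Gaussian. -/
lemma isGaussianProcess_isonormal (e : HilbertBasis ι ℝ H) {T : Type*} (k : T → H) :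
    IsGaussianProcess (fun t ω ↦ isonormal e (k t) ω) (stdGauss ι) := by
  classical
  refine ⟨fun I ↦ hasGaussianLaw_of_forall_dual ?_ fun L ↦ ?_⟩
  · exact aemeasurable_pi_iff.2 fun i ↦ (Lp.aestronglyMeasurable (isonormal e (k i))).aemeasurable
  · refine (hasGaussianLaw_isonormal e (∑ t, L (Pi.single t 1) • k t)).congr ?_
    filter_upwards [coeFn_sum_isonormal e Finset.univ (fun t : I ↦ L (Pi.single t 1))
      fun t ↦ k t] with ω hω
    rw [hω]
    conv_rhs => rw [pi_eq_sum_univ' (I.restrict fun x ↦ isonormal e (k x) ω), map_sum]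
    refine Finset.sum_congr rfl fun t _ ↦ ?_
    rw [map_smul, smul_eq_mul, mul_comm]
    rfl

/-- A Gaussian series in a Hilbert space whose coefficients are square summable. -/
lemma exists_gaussianSeries (e : HilbertBasis ι ℝ H) {E : Type*} [NormedAddCommGroup E]
    [InnerProductSpace ℝ E] [CompleteSpace E] {v : ι → E} (hv : Summable fun i ↦ ‖v i‖ ^ 2) :
    ∃ F : Lp E 2 (stdGauss ι), ∀ (L : E →L[ℝ] ℝ) (h : H), (∀ i, L (v i) = inner ℝ (e i) h) →
      (fun ω ↦ L (F ω)) =ᵐ[stdGauss ι] isonormal e h := by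
  set w : ι → Lp E 2 (stdGauss ι) :=
    fun i ↦ (ContinuousLinearMap.toSpanSingleton ℝ (v i)).compLpL 2 _ (coordLp i) with hw
  have hwc (i : ι) : w i =ᵐ[stdGauss ι] fun ω ↦ coordLp i ω • v i :=
    ContinuousLinearMap.coeFn_compLpL _ _
  have hwi (i j : ι) : inner ℝ (w i) (w j) = inner ℝ (coordLp i) (coordLp j) * inner ℝ (v i) (v j) := by
    rw [L2.inner_def, L2.inner_def, ← integral_mul_const]
    refine integral_congr_ae ?_
    filter_upwards [hwc i, hwc j] with ω h1 h2
    rw [h1, h2, real_inner_smul_left, real_inner_smul_right, RCLike.inner_apply, conj_trivial]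
    ring
  have hsum : Summable w := by
    classical
    -- The terms ξ_i v_i are orthogonal in L² because the ξ_i are, so summability of the squared
    -- norms is the Cauchy criterion for the series.
    have hn (s : Finset ι) : ‖∑ i ∈ s, w i‖ ^ 2 = ∑ i ∈ s, ‖v i‖ ^ 2 := by
      rw [← real_inner_self_eq_norm_sq, sum_inner]
      refine Finset.sum_congr rfl fun i hi ↦ ?_
      rw [inner_sum, Finset.sum_eq_single i, hwi, real_inner_self_eq_norm_sq,
        orthonormal_coordLp.1, real_inner_self_eq_norm_sq]
      · simp
      · intro j _ hj
        rw [hwi, orthonormal_coordLp.2 hj.symm, zero_mul]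
      · exact fun h ↦ absurd hi h
    rw [summable_iff_vanishing_norm] at hv ⊢
    intro ε hε
    obtain ⟨s, hs⟩ := hv (ε ^ 2) (by positivity)
    refine ⟨s, fun t ht ↦ ?_⟩
    have := hs t ht
    rw [← hn, Real.norm_of_nonneg (by positivity)] at this
    exact lt_of_pow_lt_pow_left₀ 2 hε.le this
  refine ⟨∑' i, w i, fun L h hL ↦ ?_⟩
  have h1 := (L.compLpL 2 (stdGauss ι)).hasSum hsum.hasSum
  have h2 : (fun i ↦ L.compLpL 2 (stdGauss ι) (w i)) =
      fun i ↦ (inner ℝ (e i) h : ℝ) • coordLp i := by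
    ext1 i
    refine Lp.ext ?_
    filter_upwards [L.coeFn_compLpL (w i), hwc i,
      Lp.coeFn_smul (inner ℝ (e i) h : ℝ) (coordLp i)] with ω h1 h2 h3
    rw [h1, h2, h3, map_smul, hL, Pi.smul_apply, smul_eq_mul, smul_eq_mul, mul_comm]
  rw [h2] at h1
  rw [← h1.unique (hasSum_isonormal e h)]
  exact (L.coeFn_compLpL _).symm

end Isonormal

/-! ### A version of the field whose every realization is a heat flow -/

section HeatFieldVersion

variable {d : ℕ}

lemma covariance_congr_ae {Ω : Type*} {mΩ : MeasurableSpace Ω} {P : Measure Ω}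
    {X X' Y Y' : Ω → ℝ} (hX : X =ᵐ[P] X') (hY : Y =ᵐ[P] Y') : cov[X, Y; P] = cov[X', Y'; P] := by
  rw [covariance, covariance, integral_congr_ae hX, integral_congr_ae hY]
  refine integral_congr_ae ?_
  filter_upwards [hX, hY] with ω h1 h2
  rw [h1, h2]

lemma continuousOn_heatFlow {g : Space d → ℝ} (hg : Moderate g) (τ : ℝ) :
    ContinuousOn (fun p : Space d × ℝ ↦ heatFlow g (p.2 - τ) p.1) (univ ×ˢ Ioi τ) :=
  hg.contDiffOn_heatFlow.continuousOn.comp (f := fun p : Space d × ℝ ↦ (p.1, p.2 - τ))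
    (by fun_prop) fun p hp ↦
      ⟨mem_univ _, (sub_pos.2 hp.2 : 0 < p.2 - τ)⟩

/-- Two heat flows that agree on a countable dense set of points agree. -/
lemma heatFlow_eq_of_denseSeq {g h : Space d → ℝ} (hg : Moderate g) (hh : Moderate h) {σ τ : ℝ}
    (H : ∀ (n : ℕ) (r : ℚ), σ < r → τ < r →
      heatFlow g (r - σ) (TopologicalSpace.denseSeq (Space d) n) =
        heatFlow h (r - τ) (TopologicalSpace.denseSeq (Space d) n))
    {t : ℝ} (ht : σ < t) (ht' : τ < t) (x : Space d) :
    heatFlow g (t - σ) x = heatFlow h (t - τ) x := by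
  set A : Set (Space d × ℝ) := univ ×ˢ Ioi (max σ τ)
  set S : Set (Space d × ℝ) :=
    range (TopologicalSpace.denseSeq (Space d)) ×ˢ range ((↑) : ℚ → ℝ)
  have hS : Dense S := (TopologicalSpace.denseRange_denseSeq _).prod Rat.denseRange_cast
  have hA : IsOpen A := isOpen_univ.prod isOpen_Ioi
  have key : EqOn (fun p : Space d × ℝ ↦ heatFlow g (p.2 - σ) p.1)
      (fun p ↦ heatFlow h (p.2 - τ) p.1) A := by
    refine EqOn.of_subset_closure (s := A ∩ S) ?_
      ((continuousOn_heatFlow hg σ).mono (prod_mono_right (Ioi_subset_Ioi (le_max_left _ _))))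
      ((continuousOn_heatFlow hh τ).mono (prod_mono_right (Ioi_subset_Ioi (le_max_right _ _))))
      inter_subset_left (hS.open_subset_closure_inter hA)
    rintro ⟨y, s⟩ ⟨⟨-, h1⟩, ⟨n, rfl⟩, ⟨r, rfl⟩⟩
    exact H n r ((le_max_left _ _).trans_lt h1) ((le_max_right _ _).trans_lt h1)
  exact key (x := (x, t)) ⟨mem_univ _, max_lt ht ht'⟩

/-- A realization of the heat flow of white noise in which every realization is, from any positive
time on, the heat flow of a function. -/
lemma exists_heatField_version (d : ℕ) :
    ∃ (Ω : Type) (_ : MeasurableSpace Ω) (P : Measure Ω) (U : Ω → Space d → ℝ → ℝ),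
      IsProbabilityMeasure P ∧
      (∀ ω τ, 0 < τ → ∃ σ ∈ Ioo 0 τ, ∃ g, Moderate g ∧
        ∀ t x, σ < t → U ω x t = heatFlow g (t - σ) x) ∧
      (∀ x t, 0 < t → Measurable fun ω ↦ U ω x t) ∧
      IsGaussianProcess (fun (p : HalfSpace d) ω ↦ U ω p.1 p.2) P ∧
      (∀ x t, 0 < t → ∫ ω, U ω x t ∂P = 0) ∧
      (∀ x₁ x₂ t s, 0 < t → 0 < s →
        cov[fun ω ↦ U ω x₁ t, fun ω ↦ U ω x₂ s; P] = heatKernel (s + t) (x₁ - x₂)) := by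
  classical
  obtain ⟨w, e, -⟩ := exists_hilbertBasis ℝ (Lp ℝ 2 (volume : Measure (Space d)))
  let T : ℕ → ℝ := fun m ↦ 1 / ((m : ℝ) + 1)
  have hT (m : ℕ) : 0 < T m := Nat.one_div_pos_of_nat
  choose F hF using fun m : ℕ ↦
    exists_gaussianSeries e (summable_norm_sq_sliceLp (hT m) e.orthonormal)
  let g : ℕ → (w → ℝ) → Space d → ℝ := fun m ω y ↦ polyWeight y ^ 1 * F m ω y
  have hgm (m : ℕ) (ω : w → ℝ) : Moderate (g m ω) := (moderate_coeFn (F m ω)).polyWeight_pow_mul 1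
  have hfl (m : ℕ) {s : ℝ} (hs : 0 < s) (x : Space d) (ω : w → ℝ) :
      heatFlow (g m ω) s x = inner ℝ (heatLp hs x 1) (F m ω) := (inner_heatLp hs x 1 _).symm
  have hmeas (m : ℕ) {s : ℝ} (hs : 0 < s) (x : Space d) :
      Measurable fun ω ↦ heatFlow (g m ω) s x := by
    rw [funext fun ω ↦ hfl m hs x ω]
    exact (stronglyMeasurable_const.inner (Lp.stronglyMeasurable (F m))).measurable
  -- The flow restarted at time T m is almost surely the white noise integral of K_t(x - ·),
  -- whatever m is. The auxiliary `hcast` identifies the times (t - T m) + T m and t.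
  have hae (m : ℕ) {t : ℝ} (ht : 0 < t) (hmt : T m < t) (x : Space d) :
      (fun ω ↦ heatFlow (g m ω) (t - T m) x) =ᵐ[stdGauss w] isonormal e (heatLp ht x 0) := by
    have hs : 0 < t - T m := sub_pos.2 hmt
    have hcast : ∀ {s : ℝ} (h : 0 < s), s = t → heatLp h x 0 = heatLp ht x 0 := by
      rintro s h rfl; rfl
    rw [← hcast (add_pos hs (hT m)) (by ring)]
    rw [funext fun ω ↦ hfl m hs x ω]
    exact hF m (innerSL ℝ (heatLp hs x 1)) _ fun i ↦ by
      rw [innerSL_apply_apply, inner_heatLp_sliceLp hs (hT m), real_inner_comm]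
  let D := TopologicalSpace.denseSeq (Space d)
  -- Only countably many conditions, so the event is measurable and has full probability; on it,
  -- continuity makes all restarted flows agree.
  let G : Set (w → ℝ) := {ω | ∀ (m k n : ℕ) (r : ℚ), T m < r → T k < r →
    heatFlow (g m ω) (r - T m) (D n) = heatFlow (g k ω) (r - T k) (D n)}
  have hGm : MeasurableSet G := by
    simp_rw [G, Set.ofPred_forall]
    refine .iInter fun m ↦ .iInter fun k ↦ .iInter fun n ↦ .iInter fun r ↦ .iInter fun h1 ↦
      .iInter fun h2 ↦ ?_
    exact measurableSet_eq_fun (hmeas m (sub_pos.2 h1) _) (hmeas k (sub_pos.2 h2) _)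
  have hG : ∀ᵐ ω ∂stdGauss w, ω ∈ G := by
    simp_rw [G, mem_ofPred_eq, ae_all_iff]
    intro m k n r h1 h2
    filter_upwards [hae m ((hT m).trans h1) h1 (D n), hae k ((hT m).trans h1) h2 (D n)]
      with ω e1 e2
    rw [e1, e2]
  have hcons {ω : w → ℝ} (hω : ω ∈ G) (m k : ℕ) {t : ℝ} (h1 : T m < t) (h2 : T k < t)
      (x : Space d) : heatFlow (g m ω) (t - T m) x = heatFlow (g k ω) (t - T k) x :=
    heatFlow_eq_of_denseSeq (hgm m ω) (hgm k ω) (fun n r ↦ hω m k n r) h1 h2 x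
  have hex (t : ℝ) : ∃ m, 0 < t → T m < t := by
    by_cases ht : 0 < t
    · obtain ⟨m, hm⟩ := exists_nat_one_div_lt ht
      exact ⟨m, fun _ ↦ hm⟩
    · exact ⟨0, fun h ↦ absurd h ht⟩
  choose M hM using hex
  -- Off G the zero function is itself a heat flow, so no realization is exceptional.
  let U : (w → ℝ) → Space d → ℝ → ℝ := fun ω x t ↦
    if ω ∈ G then heatFlow (g (M t) ω) (t - T (M t)) x else 0
  have hUae (x : Space d) {t : ℝ} (ht : 0 < t) :
      isonormal e (heatLp ht x 0) =ᵐ[stdGauss w] fun ω ↦ U ω x t := by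
    filter_upwards [hae (M t) ht (hM t ht) x, hG] with ω h1 h2
    simp only [U, h2, if_true, h1]
  refine ⟨w → ℝ, inferInstance, stdGauss w, U, inferInstance, ?_, ?_, ?_, ?_, ?_⟩
  · intro ω τ hτ
    by_cases hω : ω ∈ G
    · refine ⟨T (M τ), ⟨hT _, hM τ hτ⟩, g (M τ) ω, hgm _ _, fun t x ht ↦ ?_⟩
      simp only [U, hω, if_true]
      exact hcons hω _ _ (hM t ((hT _).trans ht)) ht x
    · refine ⟨T (M τ), ⟨hT _, hM τ hτ⟩, 0, ?_, fun t x ht ↦ ?_⟩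
      · intro c hc
        simp
      · simp [U, hω, heatFlow]
  · intro x t ht
    exact Measurable.ite hGm (hmeas _ (sub_pos.2 (hM t ht)) x) measurable_const
  · exact (isGaussianProcess_isonormal e fun p : HalfSpace d ↦ heatLp p.2.2 p.1 0).congr
      fun p ↦ hUae p.1 p.2.2
  · intro x t ht
    rw [← integral_congr_ae (hUae x ht), integral_isonormal]
  · intro x₁ x₂ t s ht hs
    rw [← covariance_congr_ae (hUae x₁ ht) (hUae x₂ hs), covariance_isonormal, inner_heatLp_heatLp]

end HeatFieldVersion

/-! ### Measurability in the compact-open topology -/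

section ContinuousFunctionSpace

variable {X : Type*} [TopologicalSpace X]

lemma isClosed_ball_subset (U : Set ℝ) (r : ℝ) : IsClosed {y : ℝ | Metric.ball y r ⊆ U} := by
  have : {y : ℝ | Metric.ball y r ⊆ U} =
      (⋃ z ∈ Uᶜ, Metric.ball z r)ᶜ := by
    ext y
    simp only [mem_ofPred_eq, compl_iUnion, mem_iInter, mem_compl_iff]
    refine ⟨fun h z hz hy ↦ hz (h (Metric.mem_ball_comm.1 hy)), fun h z hz ↦ ?_⟩
    by_contra hzU
    exact h z hzU (Metric.mem_ball_comm.1 hz)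
  rw [this]
  exact (isOpen_biUnion fun _ _ ↦ Metric.isOpen_ball).isClosed_compl

/-- The compact image f(K) keeps a uniform distance from the complement of U. Having a given margin
is a closed condition, so it may be tested on a dense subset, which makes subbasic sets countable
combinations of evaluations. -/
lemma mapsTo_iff_exists_ball {f : X → ℝ} (hf : Continuous f) {K : Set X} (hK : IsCompact K)
    {U : Set ℝ} (hU : IsOpen U) {D : Set X} (hDK : D ⊆ K) (hD : K ⊆ closure D) :
    MapsTo f K U ↔ ∃ n : ℕ, ∀ x ∈ D, f x ∈ {y | Metric.ball y (1 / ((n : ℝ) + 1)) ⊆ U} := by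
  constructor
  · intro h
    obtain ⟨δ, hδ, hδU⟩ := (hK.image hf).exists_thickening_subset_open hU h.image_subset
    obtain ⟨n, hn⟩ := exists_nat_one_div_lt hδ
    refine ⟨n, fun x hx ↦ ((Metric.ball_subset_ball hn.le).trans ?_).trans hδU⟩
    exact Metric.ball_subset_thickening (mem_image_of_mem f (hDK hx)) δ
  · rintro ⟨n, hn⟩ x hx
    have h1 : closure D ⊆ f ⁻¹' {y : ℝ | Metric.ball y (1 / ((n : ℝ) + 1)) ⊆ U} :=
      closure_minimal hn ((isClosed_ball_subset U _).preimage hf)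
    exact h1 (hD hx) (Metric.mem_ball_self Nat.one_div_pos_of_nat)

/-- The Borel sigma-algebra of the compact-open topology is generated by the evaluations. -/
lemma measurable_continuousMap_of_eval [SecondCountableTopology X] [LocallyCompactSpace X] {Ω : Type*} {mΩ : MeasurableSpace Ω} {φ : Ω → C(X, ℝ)}
    (h : ∀ x, Measurable fun ω ↦ φ ω x) : Measurable[mΩ, borel C(X, ℝ)] φ := by
  rw [borel_eq_generateFrom_of_subbasis ContinuousMap.compactOpen_eq]
  refine @measurable_generateFrom _ _ mΩ _ _ ?_
  rintro _ ⟨K, hK, U, hU, rfl⟩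
  obtain ⟨D, hDc, hD⟩ := TopologicalSpace.exists_countable_dense K
  have hD' : K ⊆ closure ((↑) '' D : Set X) := by
    rw [Subtype.dense_iff] at hD
    exact hD
  have e : φ ⁻¹' {f | MapsTo f K U} = ⋃ n : ℕ, ⋂ x ∈ ((↑) '' D : Set X),
      (fun ω ↦ φ ω x) ⁻¹' {y | Metric.ball y (1 / ((n : ℝ) + 1)) ⊆ U} := by
    ext ω
    simp only [mem_preimage, mem_iUnion, mem_iInter]
    exact mapsTo_iff_exists_ball (φ ω).continuous hK hU
      (image_subset_iff.2 fun x _ ↦ x.2) hD'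
  rw [e]
  refine .iUnion fun n ↦ .biInter (hDc.image _) fun x _ ↦ h x ?_
  exact (isClosed_ball_subset U _).measurableSet

end ContinuousFunctionSpace

/-! ### Smooth functions as random elements of C^{2,1} -/

section Smooth

variable {d : ℕ}

/-- The open half space as a subset of `ℝ^d × ℝ`. -/
abbrev halfSpace (d : ℕ) : Set (Space d × ℝ) := univ ×ˢ Ioi (0 : ℝ)

lemma isOpen_halfSpace : IsOpen (halfSpace d) := isOpen_univ.prod isOpen_Ioi

lemma mem_halfSpace (p : HalfSpace d) : (p.1, (p.2 : ℝ)) ∈ halfSpace d := ⟨mem_univ _, p.2.2⟩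

lemma contDiffOn_fderiv_apply {f : Space d × ℝ → ℝ} (hf : ContDiffOn ℝ (⊤ : ℕ∞) f (halfSpace d))
    (v : Space d × ℝ) : ContDiffOn ℝ (⊤ : ℕ∞) (fun q ↦ fderiv ℝ f q v) (halfSpace d) :=
  (hf.fderiv_of_isOpen isOpen_halfSpace (by simp)).clm_apply contDiffOn_const

lemma hasDerivAt_line {f : Space d × ℝ → ℝ} (hf : ContDiffOn ℝ (⊤ : ℕ∞) f (halfSpace d))
    {q : Space d × ℝ} (hq : q ∈ halfSpace d) (v : Space d × ℝ) :
    HasDerivAt (fun h : ℝ ↦ f (q + h • v)) (fderiv ℝ f q v) 0 :=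
  (((hf.differentiableOn (by simp)).differentiableAt
    (isOpen_halfSpace.mem_nhds hq)).hasFDerivAt).hasLineDerivAt v

/-- Restriction to the half space of a function that is continuous there. -/
def restrictHalfSpace {f : Space d × ℝ → ℝ} (hf : ContDiffOn ℝ (⊤ : ℕ∞) f (halfSpace d)) :
    C(HalfSpace d, ℝ) where
  toFun p := f (p.1, p.2)
  continuous_toFun := hf.continuousOn.comp_continuous (by fun_prop) mem_halfSpace

/-- A function that is smooth on the half space as an element of `C21`. -/
def C21.ofSmooth {f : Space d × ℝ → ℝ} (hf : ContDiffOn ℝ (⊤ : ℕ∞) f (halfSpace d)) : C21 d where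
  toFun := restrictHalfSpace hf
  dx i := restrictHalfSpace (contDiffOn_fderiv_apply hf (EuclideanSpace.single i 1, 0))
  dxx i j := restrictHalfSpace (contDiffOn_fderiv_apply
    (contDiffOn_fderiv_apply hf (EuclideanSpace.single i 1, 0)) (EuclideanSpace.single j 1, 0))
  dt := restrictHalfSpace (contDiffOn_fderiv_apply hf (0, 1))
  hasDeriv_dx i p := by
    simpa [restrictHalfSpace] using
      hasDerivAt_line hf (mem_halfSpace p) (EuclideanSpace.single i 1, 0)
  hasDeriv_dxx i j p := by
    simpa [restrictHalfSpace] using hasDerivAt_line (contDiffOn_fderiv_apply hf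
      (EuclideanSpace.single i 1, 0)) (mem_halfSpace p) (EuclideanSpace.single j 1, 0)
  hasDeriv_dt p := by
    have h1 := hasDerivAt_line hf (mem_halfSpace p) (0, 1)
    have h2 : HasDerivAt (fun s : ℝ ↦ f (p.1, s)) (fderiv ℝ f (p.1, p.2) (0, 1)) (p.2 : ℝ) := by
      have h3 := HasDerivAt.comp_sub_const (p.2 : ℝ) (p.2 : ℝ) (f := fun h : ℝ ↦
        f ((p.1, (p.2 : ℝ)) + h • ((0 : Space d), (1 : ℝ)))) (by rwa [sub_self])
      simpa using h3
    refine h2.congr_of_eventuallyEq ?_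
    filter_upwards [lt_mem_nhds p.2.2] with s hs
    rw [timeExtend, dif_pos hs]
    rfl

lemma C21.ofSmooth_val {f : Space d × ℝ → ℝ} (hf : ContDiffOn ℝ (⊤ : ℕ∞) f (halfSpace d))
    (x : Space d) {t : ℝ} (ht : 0 < t) : (C21.ofSmooth hf).val x t = f (x, t) := by
  simp [C21.val, timeExtend, ht, C21.ofSmooth, restrictHalfSpace]

/-- A directional derivative is a limit of difference quotients with steps 1/(n+1); the offset N
keeps the displaced points in the half space, where measurability is known. -/
lemma measurable_fderiv_apply {Ω : Type*} {mΩ : MeasurableSpace Ω} {f : Ω → Space d × ℝ → ℝ}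
    (hf : ∀ ω, ContDiffOn ℝ (⊤ : ℕ∞) (f ω) (halfSpace d))
    (hm : ∀ q ∈ halfSpace d, Measurable fun ω ↦ f ω q) (v : Space d × ℝ)
    {q : Space d × ℝ} (hq : q ∈ halfSpace d) : Measurable fun ω ↦ fderiv ℝ (f ω) q v := by
  obtain ⟨N, hN⟩ : ∃ N : ℕ, ∀ n ≥ N, q + (1 / ((n : ℝ) + 1)) • v ∈ halfSpace d := by
    have h1 : Tendsto (fun n : ℕ ↦ q + (1 / ((n : ℝ) + 1)) • v) atTop (𝓝 (q + (0 : ℝ) • v)) :=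
      tendsto_const_nhds.add (tendsto_one_div_add_atTop_nhds_zero_nat.smul_const v)
    rw [zero_smul, add_zero] at h1
    exact eventually_atTop.1 (h1 (isOpen_halfSpace.mem_nhds hq))
  have hlim (ω : Ω) : Tendsto (fun n : ℕ ↦ (1 / (((n + N : ℕ) : ℝ) + 1))⁻¹ •
      (f ω (q + (1 / (((n + N : ℕ) : ℝ) + 1)) • v) - f ω q)) atTop (𝓝 (fderiv ℝ (f ω) q v)) := by
    have h1 := (hasDerivAt_iff_tendsto_slope_zero.1 (hasDerivAt_line (hf ω) hq v)).comp
      (tendsto_nhdsWithin_iff.2 ⟨tendsto_one_div_add_atTop_nhds_zero_nat (𝕜 := ℝ),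
        .of_forall fun n ↦ (Nat.one_div_pos_of_nat (α := ℝ)).ne'⟩)
    simpa [Function.comp_def] using (tendsto_add_atTop_iff_nat N).2 h1
  simp_rw [smul_eq_mul] at hlim
  refine measurable_of_tendsto_metrizable (fun n ↦ ?_) (tendsto_pi_nhds.2 hlim)
  exact ((hm _ (hN _ (Nat.le_add_left _ _))).sub (hm q hq)).const_mul _

instance : LocallyCompactSpace (Ioi (0 : ℝ)) := isOpen_Ioi.locallyCompactSpace

lemma C21.measurable_ofSmooth {Ω : Type*} {mΩ : MeasurableSpace Ω} {f : Ω → Space d × ℝ → ℝ}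
    (hf : ∀ ω, ContDiffOn ℝ (⊤ : ℕ∞) (f ω) (halfSpace d))
    (hm : ∀ q ∈ halfSpace d, Measurable fun ω ↦ f ω q) :
    Measurable fun ω ↦ C21.ofSmooth (hf ω) := by
  let _ : MeasurableSpace C(HalfSpace d, ℝ) := borel _
  have _ : BorelSpace C(HalfSpace d, ℝ) := ⟨rfl⟩
  -- Second countability makes the product σ-algebra on jets the Borel one, so measurability may be
  -- checked component by component.
  have _ : SecondCountableTopology C(HalfSpace d, ℝ) := inferInstance
  have hr {g : Ω → Space d × ℝ → ℝ} (hg : ∀ ω, ContDiffOn ℝ (⊤ : ℕ∞) (g ω) (halfSpace d))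
      (hgm : ∀ q ∈ halfSpace d, Measurable fun ω ↦ g ω q) :
      Measurable fun ω ↦ restrictHalfSpace (hg ω) :=
    measurable_continuousMap_of_eval fun p ↦ hgm _ (mem_halfSpace p)
  have hj : Measurable fun ω ↦ (C21.ofSmooth (hf ω)).jet := by
    have hd v : ∀ q ∈ halfSpace d, Measurable fun ω ↦ fderiv ℝ (f ω) q v :=
      fun q hq ↦ measurable_fderiv_apply hf hm v hq
    refine (hr hf hm).prodMk (.prodMk (measurable_pi_iff.2 fun i ↦ ?_)
      (.prodMk (measurable_pi_iff.2 fun i ↦ measurable_pi_iff.2 fun j ↦ ?_) ?_))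
    · exact hr (fun ω ↦ contDiffOn_fderiv_apply (hf ω) _) (hd _)
    · exact hr (fun ω ↦ contDiffOn_fderiv_apply (contDiffOn_fderiv_apply (hf ω) _) _)
        fun q hq ↦ measurable_fderiv_apply (fun ω ↦ contDiffOn_fderiv_apply (hf ω) _) (hd _) _ hq
    · exact hr (fun ω ↦ contDiffOn_fderiv_apply (hf ω) _) (hd _)
  have hb : (borel (C21 d)) = MeasurableSpace.comap C21.jet inferInstance := by
    rw [BorelSpace.measurable_eq (α := C(HalfSpace d, ℝ) × (Fin d → C(HalfSpace d, ℝ)) ×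
      (Fin d → Fin d → C(HalfSpace d, ℝ)) × C(HalfSpace d, ℝ))]
    exact borel_comap
  change Measurable[_, borel (C21 d)] _
  rw [hb]
  exact measurable_comap_iff.2 hj

end Smooth

/-! ### The field at one point in logarithmic time -/

section SelfSimilar

variable {d : ℕ}

/-- The reciprocal standard deviation of the field at time `e^τ`. -/
def normFactor (d : ℕ) (τ : ℝ) : ℝ := (√(8 * Real.pi) * Real.exp (τ / 2)) ^ ((d : ℝ) / 2)

lemma normFactor_pos (τ : ℝ) : 0 < normFactor d τ := by
  unfold normFactor
  positivity

lemma contDiff_normFactor : ContDiff ℝ (⊤ : ℕ∞) (normFactor d) := by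
  unfold normFactor
  refine ContDiff.rpow_const_of_ne (by fun_prop) fun τ ↦ ?_
  positivity

/-- The sum e^σ + e^τ equals 2 e^((σ+τ)/2) cosh((σ-τ)/2), and the variance at time t is K_{2t}(0) =
(8πt)^(-d/2). After normalization only the cosine remains. -/
lemma normFactor_mul_heatKernel (σ τ : ℝ) :
    normFactor d σ * normFactor d τ * heatKernel (Real.exp τ + Real.exp σ) (0 : Space d) =
      Real.cosh ((σ - τ) / 2) ^ (-((d : ℝ) / 2)) := by
  have hs : √(8 * Real.pi) * √(8 * Real.pi) = 8 * Real.pi := Real.mul_self_sqrt (by positivity)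
  have h1 : normFactor d σ * normFactor d τ =
      (8 * Real.pi * Real.exp ((σ + τ) / 2)) ^ ((d : ℝ) / 2) := by
    rw [normFactor, normFactor, ← Real.mul_rpow (by positivity) (by positivity)]
    congr 1
    rw [mul_mul_mul_comm, hs, ← Real.exp_add, add_div]
  have h2 : 4 * Real.pi * (Real.exp τ + Real.exp σ) =
      8 * Real.pi * Real.exp ((σ + τ) / 2) * Real.cosh ((σ - τ) / 2) := by
    have e1 : Real.exp σ = Real.exp ((σ + τ) / 2) * Real.exp ((σ - τ) / 2) := by
      rw [← Real.exp_add]; ring_nf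
    have e2 : Real.exp τ = Real.exp ((σ + τ) / 2) * Real.exp (-((σ - τ) / 2)) := by
      rw [← Real.exp_add]; ring_nf
    rw [Real.cosh_eq, e1, e2]
    ring
  have hc := Real.cosh_pos ((σ - τ) / 2)
  rw [h1, heatKernel, h2, neg_div, Real.mul_rpow (by positivity) hc.le, ← mul_assoc, ← mul_assoc,
    ← Real.rpow_add (by positivity)]
  simp

/-- The field at a fixed point of space, normalized and in logarithmic time. -/
def logProcess {Ω : Type} (U : Ω → Space d → ℝ → ℝ) (x : Space d) (τ : ℝ) (ω : Ω) : ℝ :=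
  normFactor d τ * U ω x (Real.exp τ)

variable {Ω : Type} {U : Ω → Space d → ℝ → ℝ}

lemma contDiff_logProcess
    (hs : ∀ ω, ContDiffOn ℝ (⊤ : ℕ∞) (fun p : Space d × ℝ ↦ U ω p.1 p.2) (halfSpace d))
    (x : Space d) (ω : Ω) : ContDiff ℝ (⊤ : ℕ∞) fun τ ↦ logProcess U x τ ω :=
  contDiff_normFactor.mul ((hs ω).comp_contDiff (f := fun τ ↦ (x, Real.exp τ)) (by fun_prop)
    fun τ ↦ ⟨mem_univ _, Real.exp_pos τ⟩)

lemma isSechProcess_logProcess [MeasurableSpace Ω] {P : Measure Ω}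
    (hs : ∀ ω, ContDiffOn ℝ (⊤ : ℕ∞) (fun p : Space d × ℝ ↦ U ω p.1 p.2) (halfSpace d))
    (hm : ∀ x t, 0 < t → Measurable fun ω ↦ U ω x t)
    (hg : IsGaussianProcess (fun (p : HalfSpace d) ω ↦ U ω p.1 p.2) P)
    (h0 : ∀ x t, 0 < t → ∫ ω, U ω x t ∂P = 0)
    (hc : ∀ x₁ x₂ t s, 0 < t → 0 < s →
      cov[fun ω ↦ U ω x₁ t, fun ω ↦ U ω x₂ s; P] = heatKernel (s + t) (x₁ - x₂))
    (x : Space d) : IsSechProcess ((d : ℝ) / 2) P (logProcess U x) where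
  measurable τ := (hm x _ (Real.exp_pos τ)).const_mul _
  continuous ω := (contDiff_logProcess hs x ω).continuous
  gaussian := (hg.comp_right fun τ : ℝ ↦ (x, ⟨Real.exp τ, Real.exp_pos τ⟩)).smul (normFactor d)
  centered τ := by
    simp_rw [logProcess, integral_const_mul, h0 x _ (Real.exp_pos τ), mul_zero]
  cov_eq σ τ := by
    rw [← normFactor_mul_heatKernel, ← sub_self x, ← hc x x _ _ (Real.exp_pos σ) (Real.exp_pos τ)]
    change cov[fun ω ↦ normFactor d σ * U ω x (Real.exp σ),
      fun ω ↦ normFactor d τ * U ω x (Real.exp τ); P] = _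
    rw [covariance_const_mul_left, covariance_const_mul_right, mul_assoc]

lemma forall_logProcess_ne_zero_iff (x : Space d) (ω : Ω) {T : ℝ} (hT : 0 < T) :
    (∀ τ ∈ Icc 0 (Real.log T), logProcess U x τ ω ≠ 0) ↔ ∀ t ∈ Icc 1 T, U ω x t ≠ 0 := by
  have hn (τ : ℝ) : logProcess U x τ ω ≠ 0 ↔ U ω x (Real.exp τ) ≠ 0 := by
    simp [logProcess, (normFactor_pos τ).ne']
  simp_rw [hn]
  constructor
  · intro h t ht
    have h0 : 0 < t := one_pos.trans_le ht.1
    simpa [Real.exp_log h0] using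
      h (Real.log t) ⟨Real.log_nonneg ht.1, Real.log_le_log h0 ht.2⟩
  · intro h τ hτ
    exact h _ ⟨Real.one_le_exp hτ.1, (Real.le_log_iff_exp_le hT).1 hτ.2⟩

end SelfSimilar

/-! ### Properties inherited from being a heat flow after every positive time -/

section Caloric

variable {d : ℕ} {u : Space d → ℝ → ℝ}

/-- From any positive time on, `u` is the heat flow of a moderate function. -/
def IsHeatFlow (u : Space d → ℝ → ℝ) : Prop :=
  ∀ τ, 0 < τ → ∃ σ ∈ Ioo 0 τ, ∃ g, Moderate g ∧ ∀ t x, σ < t → u x t = heatFlow g (t - σ) x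

lemma IsHeatFlow.contDiffOn (hu : IsHeatFlow u) :
    ContDiffOn ℝ (⊤ : ℕ∞) (fun p : Space d × ℝ ↦ u p.1 p.2) (halfSpace d) := by
  intro p hp
  obtain ⟨σ, hσ, g, hg, h⟩ := hu p.2 hp.2
  have h1 : ContDiffOn ℝ (⊤ : ℕ∞) (fun p : Space d × ℝ ↦ heatFlow g (p.2 - σ) p.1)
      (univ ×ˢ Ioi σ) :=
    hg.contDiffOn_heatFlow.comp (f := fun p : Space d × ℝ ↦ (p.1, p.2 - σ)) (by fun_prop)
      fun p hp ↦ ⟨mem_univ _, (sub_pos.2 hp.2 : 0 < p.2 - σ)⟩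
  have hmem : univ ×ˢ Ioi σ ∈ 𝓝 p := (isOpen_univ.prod isOpen_Ioi).mem_nhds ⟨mem_univ _, hσ.2⟩
  refine ((h1.contDiffAt hmem).congr_of_eventuallyEq ?_).contDiffWithinAt
  filter_upwards [hmem] with q hq
  exact h q.2 q.1 hq.2

lemma IsHeatFlow.deriv_eq (hu : IsHeatFlow u) (x : Space d) {t : ℝ} (ht : 0 < t) :
    deriv (fun s ↦ u x s) t = Laplacian.laplacian (fun y ↦ u y t) x := by
  obtain ⟨σ, hσ, g, hg, h⟩ := hu t ht
  have h1 : (fun s ↦ u x s) =ᶠ[𝓝 t] fun s ↦ heatFlow g (s - σ) x := by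
    filter_upwards [lt_mem_nhds hσ.2] with s hs
    exact h s x hs
  rw [h1.deriv_eq, deriv_comp_sub_const (f := fun s ↦ heatFlow g s x),
    hg.deriv_heatFlow (sub_pos.2 hσ.2), funext fun y ↦ h t y hσ.2]

lemma IsHeatFlow.semigroup (hu : IsHeatFlow u) (x : Space d) {t₁ t₂ : ℝ} (h₁ : 0 < t₁)
    (h₂ : t₁ < t₂) : Integrable (fun y ↦ heatKernel (t₂ - t₁) (x - y) * u y t₁) ∧
      u x t₂ = ∫ y, heatKernel (t₂ - t₁) (x - y) * u y t₁ := by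
  obtain ⟨σ, hσ, g, hg, h⟩ := hu t₁ h₁
  have h3 := hg.heatFlow_add (sub_pos.2 h₂) (sub_pos.2 hσ.2) x
  rw [show t₂ - t₁ + (t₁ - σ) = t₂ - σ by ring] at h3
  simpa only [h t₁ _ hσ.2, h t₂ _ (hσ.2.trans h₂)] using h3

end Caloric

end WhiteNoiseHeat

end

/-! ### Assembly of the theorem -/

theorem mainTheorem3 (d : ℕ) (hd : 1 ≤ d) :
    ∃ b : ℝ, IsPersistenceExponent ((d : ℝ) / 2 - 1) b ∧
    ∃ (Ω : Type) (_ : MeasurableSpace Ω) (P : Measure Ω) (φ : Ω → C21 d),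
      IsProbabilityMeasure P ∧ IsHeatField P φ ∧
      -- the heat equation on the half space
      (∀ (ω : Ω) (x : Space d) (t : ℝ), 0 < t →
        deriv (fun s : ℝ => (φ ω).val x s) t =
          Laplacian.laplacian (fun y : Space d => (φ ω).val y t) x) ∧
      -- smoothness on the half space
      (∀ ω : Ω, ContDiffOn ℝ (⊤ : ℕ∞) (fun p : Space d × ℝ => (φ ω).val p.1 p.2)
        (univ ×ˢ Ioi (0 : ℝ))) ∧
      -- the semigroup identity
      (∀ (ω : Ω) (x : Space d) (t₁ t₂ : ℝ), 0 < t₁ → t₁ < t₂ →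
        Integrable (fun y : Space d => heatKernel (t₂ - t₁) (x - y) * (φ ω).val y t₁) ∧
        (φ ω).val x t₂ =
          ∫ y : Space d, heatKernel (t₂ - t₁) (x - y) * (φ ω).val y t₁) ∧
      -- persistence probabilities
      (∀ x : Space d, ∃ ε : ℝ → ℝ, Tendsto ε atTop (𝓝 0) ∧
        ∀ᶠ T : ℝ in atTop,
          P.real {ω | ∀ t ∈ Icc (1 : ℝ) T, (φ ω).val x t ≠ 0} = T ^ (-b + ε T)) := by
  obtain ⟨Ω, mΩ, P, U, hP, hU, hm, hg, h0, hc⟩ := exists_heatField_version d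
  have hU' (ω : Ω) : IsHeatFlow (U ω) := hU ω
  have hs (ω : Ω) := (hU' ω).contDiffOn
  have ha : (0 : ℝ) < (d : ℝ) / 2 := by positivity
  have hY := isSechProcess_logProcess hs hm hg h0 hc
  obtain ⟨b, hb⟩ := (hY 0).exists_tendsto ha
  -- The covariance in logarithmic time does not involve x, so the exponent found at the origin
  -- serves every point.
  have hbx (x : Space d) :
      Tendsto (fun T ↦ -Real.log (persist P (logProcess U x) 0 0 T) / T) atTop (𝓝 b) := by
    refine hb.congr' ?_
    filter_upwards [eventually_ge_atTop 0] with T hT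
    rw [(hY 0).persist_eq (hY x) 0 0 0 hT]
  have hval (ω : Ω) (x : Space d) {t : ℝ} (ht : 0 < t) :
      (C21.ofSmooth (hs ω)).val x t = U ω x t := C21.ofSmooth_val (hs ω) x ht
  refine ⟨b, (hY 0).isPersistenceExponent ha (contDiff_logProcess hs 0) hb, Ω, mΩ, P,
    fun ω ↦ C21.ofSmooth (hs ω), hP, ⟨?_, ?_, ?_, ?_⟩, ?_, ?_, ?_, ?_⟩
  · exact C21.measurable_ofSmooth hs fun q hq ↦ hm q.1 q.2 hq.2
  · convert! hg using 3 with p ω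
    exact hval ω p.1 p.2.2
  · intro x t ht
    simpa only [hval _ x ht] using h0 x t ht
  · intro x₁ x₂ t s ht hs'
    simpa only [hval _ _ ht, hval _ _ hs'] using hc x₁ x₂ t s ht hs'
  · intro ω x t ht
    rw [funext fun y ↦ hval ω y ht, ← (hU' ω).deriv_eq x ht]
    refine Filter.EventuallyEq.deriv_eq ?_
    filter_upwards [lt_mem_nhds ht] with s hst
    exact hval ω x hst
  · intro ω
    exact (hs ω).congr fun p hp ↦ hval ω p.1 hp.2
  · intro ω x t₁ t₂ h₁ h₂
    simpa only [hval ω _ h₁, hval ω _ (h₁.trans h₂)] using (hU' ω).semigroup x h₁ h₂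
  · intro x
    obtain ⟨hp, hl⟩ := (hY x).tendsto_nonzero ha (hbx x)
    obtain ⟨ε, hε, hT⟩ := exists_rpow_of_tendsto_log hp hl
    refine ⟨ε, hε, ?_⟩
    filter_upwards [hT, eventually_gt_atTop 0] with T h1 h2
    rw [← h1]
    congr 1
    ext ω
    rw [mem_ofPred_eq, mem_ofPred_eq, forall_logProcess_ne_zero_iff x ω h2]
    exact forall₂_congr fun t ht ↦ by rw [hval ω x (one_pos.trans_le ht.1)]
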